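/- Let $\Gamma$ be a finite connected graph (multiple edges and self-loops allowed) with $n\ge 1$ edges, $\ell=\dim H_1(\Gamma,\mathbb R)$, and real masses $m_e$ on the edges. A cut is a set $C$ of edges whose complement is a disconnected union of trees that acquires a loop or becomes connected when any edge of $C$ is added back. Let $A=A_S\sqcup A_C\subset\mathbb Z^{n+1}$, with coordinates $a=(a_0,\dots,a_n)$, where $A_S$ consists of the points $(1,\vec S)$, for $S$ a spanning tree and $\vec S$ the exponent vector of $t^{\vec S}=\prod_{e\notin S}t_e$, and $A_C$ of the points $(0,\vec T)$, for $t^{\vec T}$ a monomial appearing in $\sum_{C\ \mathrm{cut}}P_C\prod_{e\in C}t_e+(\sum_e m_e^2t_e)\sum_S\prod_{e\notin S}t_e$ with the $P_C$ indeterminates. For $P=(P_a)\in\mathbb C^A$ put $\Psi=\sum_{(1,\vec S)\in A_S}P_{(1,\vec S)}\,t^{\vec S}$ and $Q=\sum_{(0,\vec T)\in A_C}P_{(0,\vec T)}\,t^{\vec T}$. For $P$ in $\mathcal P_+=\{P:\operatorname{Re}P_a>0\ \forall a\}$, $\operatorname{Re}c>0$, $\operatorname{Re}d<0$, $\operatorname{Re}v_e>0$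 let $$J(c,d,P,\vec v)=\int_{\Delta_{n-1}}\frac{Q^c}{\Psi^d}\,t^{\vec v}\,\Omega ,\qquad \Omega=\sum_{i=1}^n(-1)^{i+1}t_i\,dt_1\wedge\dots\wedge\widehat{dt_i}\wedge\dots\wedge dt_n,$$ over the standard simplex, with principal branches of the powers. The generalized amplitude $\int_{\mathbb R_+^n}e^{-Q/\Psi}\frac{Q^{c_1}}{\Psi^{c_2}}t^{\vec v}\,dt$ is understood, for all exponents $(c_1,c_2,\vec v)\in\mathbb C^{n+2}$, as $$I(P,(c_1,c_2,\vec v))=\Gamma\big(n+|\vec v|+c_1(\ell+1)-c_2\ell\big)\,J\big(-n-|\vec v|+(c_2-c_1)\ell,\ -n-|\vec v|+(c_2-c_1)(\ell+1),\ P,\ \vec v\big),\qquad |\vec v|=\sum_e v_e,$$ with $J$ replaced by its meromorphic continuation. **Theorem.** The function $J$ continues meromorphically in $(c,d,\vec v)$ to $\mathbb C^{n+2}$, holomorphically in $P\in\mathcal P_+$ (i.e. locally in the exponents it is a holomorphic function of exponents and $P$ divided by a nonzero holomorphic function of the exponents only), and the formula above defines $I$ as a function of the same kind on $\mathbb C^{n+2}\times\mathcal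 P_+$. Moreover, let $U\subset\mathbb C^A$ be a connected open set and let $I$ be a branch of the generalized amplitude over $U$, that is, given by the formula above from a meromorphic family over $U$ (of the same kind, not polar along the whole hyperplane of exponents involved) that coincides with the integral $J$ for $P$ in some nonempty open subset of $U\cap\mathcal P_+$. Let $w_0=(c_1,c_2,\vec v)$ and $w=(x,y,\vec u)$ be vectors in $\mathbb C^{n+2}$ such that $w_0+\epsilon w$ is not in the polar locus of $I$ for small $\epsilon\neq0$, and let $$I(P,w_0+\epsilon w)=\sum_{i\ge N}\epsilon^iI_i(P)\qquad(P\in U)$$ be the Laurent expansion at $\epsilon=0$, for some integer $N$ (for instance $N=-n$), with $I_i=0$ for $i<N$. Then every $I_i$ is holomorphic on $U$ and there: 1. for all integers $(n_a)_{a\in A}$ with $\sum_{a\in A} n_a a=0$, $$\Big(\prod_{n_a>0}\big(\tfrac{\partial}{\partial P_a}\big)^{n_a}-\prod_{n_a<0}\big(\tfrac{\partial}{\partial P_a}\big)^{-n_a}\Big)I_i=0;$$ 2. $$\Big(\sum_{a\in A}a_0P_a\tfrac{\partial}{\partial P_a}\Big)I_i=\big((\ell+1,-\ell-1,1,\dots,1)\cdot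 w_0+n\big)I_i+\big((\ell+1,-\ell-1,1,\dots,1)\cdot w\big)I_{i-1};$$ 3. for $k=1,\dots,n$, $$\Big(\sum_{a\in A}a_kP_a\tfrac{\partial}{\partial P_a}\Big)I_i=(-1-v_k)I_i-u_k\,I_{i-1}.$$ -/

import Mathlib

open Filter Topology

/-! ## Feynman graphs, spanning trees and cuts -/

/-- A graph with vertex type `V` and internal edges enumerated by `Fin n`, every edge carrying an
(arbitrary) orientation.  Multiple edges and self-loops are allowed. -/
structure FeynmanGraph (V : Type*) (n : ℕ) where
  src : Fin n → V
  tgt : Fin n → V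

namespace FeynmanGraph

variable {V : Type*} {n : ℕ} (Γ : FeynmanGraph V n)

/-- `u` and `v` can be joined by a path which uses only edges in `S`, in either direction. -/
def Joined (S : Finset (Fin n)) (u v : V) : Prop :=
  Relation.EqvGen (fun x y => ∃ e ∈ S, Γ.src e = x ∧ Γ.tgt e = y) u v

/-- The subgraph with all the vertices and with edge set `S` is connected. -/
def ConnectedBy (S : Finset (Fin n)) : Prop :=
  Nonempty V ∧ ∀ u v : V, Γ.Joined S u v

/-- The graph is connected. -/
def Connected : Prop := Γ.ConnectedBy Finset.univ

/-- The edge set `S` contains no loop: every edge of `S` is a bridge of the subgraph. -/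
def IsForest (S : Finset (Fin n)) : Prop :=
  ∀ e ∈ S, ¬ Γ.Joined (S.erase e) (Γ.src e) (Γ.tgt e)

/-- Spanning trees, as sets of edges. -/
def IsSpanningTree (S : Finset (Fin n)) : Prop :=
  Γ.ConnectedBy S ∧ Γ.IsForest S

/-- Cuts: the complement of `C` is a disconnected union of trees, and if any edge of `C` is added
back to it, then it has a loop or becomes connected. -/
def IsCut (C : Finset (Fin n)) : Prop :=
  Γ.IsForest Cᶜ ∧ ¬ Γ.ConnectedBy Cᶜ ∧
    ∀ e ∈ C, ¬ Γ.IsForest (insert e Cᶜ) ∨ Γ.ConnectedBy (insert e Cᶜ)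

open Classical in
/-- The boundary map from edge chains to vertex chains. -/
noncomputable def boundary : (Fin n → ℝ) →ₗ[ℝ] (V → ℝ) :=
  LinearMap.pi fun u =>
    ∑ e : Fin n, (((if Γ.tgt e = u then 1 else 0) - (if Γ.src e = u then 1 else 0) : ℝ)) •
      LinearMap.proj e

/-- The number of loops `ℓ`, the dimension of `H₁(Γ, ℝ)`. -/
noncomputable def loopNumber : ℕ := Module.finrank ℝ (LinearMap.ker Γ.boundary)

/-! ## The monomials of the two Symanzik polynomials, and the lattice points `A` -/

/-- The exponent vector of `∏ e ∈ S, t_e`. -/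
def expVec (S : Finset (Fin n)) : Fin n → ℕ := fun e => if e ∈ S then 1 else 0

/-- The set of spanning trees; it indexes the monomials of the first Symanzik polynomial. -/
abbrev SpanTree : Type := {S : Finset (Fin n) // Γ.IsSpanningTree S}

/-- `t ^ T` appears in
`Q_Γ = ∑_{cuts C} P_C ∏_{e ∈ C} t_e + (∑_e m_e² t_e) ∑_{trees S} ∏_{e ∉ S} t_e`,
where the `P_C` are indeterminates.  There is no cancellation, since the squares of the masses are
nonnegative. -/
def IsQMonomial (m : Fin n → ℝ) (T : Fin n → ℕ) : Prop :=
  (∃ C, Γ.IsCut C ∧ T = expVec C) ∨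
    ∃ e S, m e ≠ 0 ∧ Γ.IsSpanningTree S ∧ T = expVec Sᶜ + Pi.single e 1

/-- The set of monomials of `Q_Γ`. -/
abbrev QMonomial (m : Fin n → ℝ) : Type := {T : Fin n → ℕ // Γ.IsQMonomial m T}

instance finite_qMonomial (m : Fin n → ℝ) : Finite (Γ.QMonomial m) := by
  have h : {T : Fin n → ℕ | Γ.IsQMonomial m T} ⊆
      Set.range (fun C : Finset (Fin n) => expVec C) ∪
        Set.range (fun p : Fin n × Finset (Fin n) => expVec p.2ᶜ + Pi.single p.1 1) := by
    rintro T (⟨C, -, rfl⟩ | ⟨e, S, -, -, rfl⟩)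
    · exact Or.inl ⟨C, rfl⟩
    · exact Or.inr ⟨(e, S), rfl⟩
  exact (((Set.finite_range _).union (Set.finite_range _)).subset h).to_subtype

noncomputable instance fintype_spanTree : Fintype Γ.SpanTree := Fintype.ofFinite _

noncomputable instance fintype_qMonomial (m : Fin n → ℝ) : Fintype (Γ.QMonomial m) :=
  Fintype.ofFinite _

/-- The index set `A = A_S ⊔ A_C` of the coefficients. -/
abbrev Idx (m : Fin n → ℝ) : Type := Γ.SpanTree ⊕ Γ.QMonomial m

/-- The lattice point in `ℤ ^ (n + 1)` of an element of `A`: it is `(1, S)` for a spanning tree `S`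
(where the vector `S` has entry `1` at the edges which are not in `S`), and `(0, T)` for a monomial
`t ^ T` of `Q_Γ`. -/
def latticePoint (m : Fin n → ℝ) : Γ.Idx m → Fin (n + 1) → ℤ
  | Sum.inl S => Fin.cons 1 fun e => (expVec (S.1)ᶜ e : ℤ)
  | Sum.inr T => Fin.cons 0 fun e => (T.1 e : ℤ)

/-- The parameter space: all the coefficients `P_a`, `a ∈ A`, are independent variables. -/
abbrev Coeffs (m : Fin n → ℝ) : Type := Γ.Idx m → ℂ

/-- The first Symanzik polynomial with general coefficients. -/
noncomputable def Psi (m : Fin n → ℝ) (P : Γ.Coeffs m) (t : Fin n → ℝ) : ℂ :=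
  ∑ S : Γ.SpanTree, P (Sum.inl S) * ∏ e, (t e : ℂ) ^ expVec (S.1)ᶜ e

/-- The polynomial `Q_Γ` with general coefficients. -/
noncomputable def Q (m : Fin n → ℝ) (P : Γ.Coeffs m) (t : Fin n → ℝ) : ℂ :=
  ∑ T : Γ.QMonomial m, P (Sum.inr T) * ∏ e, (t e : ℂ) ^ T.1 e

/-- The set of coefficients with positive real parts.  For these, `Q_Γ` (if it is not identically
zero) and `Ψ_Γ` have positive real parts in the interior of the simplex, so that their complex
powers are given by the principal branch. -/
def rightHalf (m : Fin n → ℝ) : Set (Γ.Coeffs m) := {P | ∀ a, 0 < (P a).re}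

end FeynmanGraph

/-! ## Meromorphic families -/

section Meromorphic

variable {X Y : Type*} [NormedAddCommGroup X] [NormedSpace ℂ X]
  [NormedAddCommGroup Y] [NormedSpace ℂ Y]

/-- `F x P` is holomorphic in `x` and `P`, for `x` in a neighbourhood of `x₀` and `P ∈ U`. -/
def RegularAt (U : Set Y) (F : X → Y → ℂ) (x₀ : X) : Prop :=
  ∃ N ∈ 𝓝 x₀, AnalyticOnNhd ℂ (Function.uncurry F) (N ×ˢ U)

/-- `h` is a possible denominator on the neighbourhood `N` of `x₀`: it is holomorphic and it does
not vanish identically near `x₀`. -/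
def IsDenominator (h : X → ℂ) (N : Set X) (x₀ : X) : Prop :=
  N ∈ 𝓝 x₀ ∧ AnalyticOnNhd ℂ h N ∧ ∃ᶠ x in 𝓝 x₀, h x ≠ 0

/-- `F x P` is a meromorphic function of `x ∈ X` (locally a quotient of holomorphic functions)
which depends holomorphically on `P ∈ U`.  The last clause says that removable singularities have
been removed; the values of `F` at the remaining singularities are irrelevant. -/
def IsMeromorphicFamily (U : Set Y) (F : X → Y → ℂ) : Prop :=
  (∀ x₀ : X, ∃ (N : Set X) (h : X → ℂ) (G : X → Y → ℂ), IsDenominator h N x₀ ∧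
    AnalyticOnNhd ℂ (Function.uncurry G) (N ×ˢ U) ∧
    ∀ x ∈ N, h x ≠ 0 → ∀ P ∈ U, F x P = G x P / h x) ∧
  (∀ x₀ : X, (∃ (N : Set X) (h : X → ℂ) (G : X → Y → ℂ), IsDenominator h N x₀ ∧
    AnalyticOnNhd ℂ (Function.uncurry G) (N ×ˢ U) ∧
    ∀ x ∈ N, h x ≠ 0 → ∀ P ∈ U, F x P = G x P) → RegularAt U F x₀)

end Meromorphic

/-- `∑ i, a i * ε ^ i` is the Laurent expansion of `f` at `ε = 0`, and it has no term of degree less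
than `N`. -/
def HasLaurentExpansion (f : ℂ → ℂ) (N : ℤ) (a : ℤ → ℂ) : Prop :=
  (∀ i < N, a i = 0) ∧
    ∀ᶠ ε in 𝓝[≠] (0 : ℂ), HasSum (fun i : ℤ => a i * ε ^ i) (f ε)

/-! ## The generalized amplitudes -/

namespace FeynmanGraph

/-- The point of the standard simplex in `ℝ ^ (k + 1)` whose coordinates other than the first one
are given by `s`. -/
def simplexPoint {k : ℕ} (s : Fin k → ℝ) : Fin (k + 1) → ℝ := Fin.cons (1 - ∑ i, s i) s

variable {V : Type*} {k : ℕ} (Γ : FeynmanGraph V (k + 1)) (m : Fin (k + 1) → ℝ)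

/-- The integral `∫ Q_Γ ^ c / Ψ_Γ ^ d * t ^ v Ω` over the standard simplex, in terms of the
coordinates other than the first one.  On the simplex `Ω = ∑ i, ± t_i dt_0 ⋯ (omit dt_i) ⋯ dt_k` is
the Lebesgue measure in these coordinates. -/
noncomputable def integralJ (c d : ℂ) (v : Fin (k + 1) → ℂ) (P : Γ.Coeffs m) : ℂ :=
  ∫ s in {s : Fin k → ℝ | simplexPoint s ∈ stdSimplex ℝ (Fin (k + 1))},
    Γ.Q m P (simplexPoint s) ^ c / Γ.Psi m P (simplexPoint s) ^ d *
      ∏ e, (simplexPoint s e : ℂ) ^ v e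

/-- The space of the exponents `(c, d, v)`, respectively `(c₁, c₂, v)`. -/
abbrev Exps (k : ℕ) : Type := ℂ × ℂ × (Fin (k + 1) → ℂ)

/-- `J` is the meromorphic continuation in `(c, d, v)`, over the set `U` of coefficients, of (a
branch of) the integral, which converges for `Re c > 0`, `Re d < 0`, `Re v > 0`. -/
def IsContinuationJ (U : Set (Γ.Coeffs m)) (J : Exps k → Γ.Coeffs m → ℂ) : Prop :=
  IsMeromorphicFamily U J ∧
    ∃ W ⊆ U ∩ Γ.rightHalf m, IsOpen W ∧ W.Nonempty ∧
      ∀ (c d : ℂ) (v : Fin (k + 1) → ℂ), 0 < c.re → d.re < 0 → (∀ e, 0 < (v e).re) →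
        ∀ P ∈ W, J (c, d, v) P = Γ.integralJ m c d v P

/-- The exponents `(c, d, v)` of `J` which correspond to the exponents `(c₁, c₂, v)` of `I`. -/
noncomputable def toExpsJ (x : Exps k) : Exps k :=
  (-((k + 1 : ℕ) : ℂ) - ∑ e, x.2.2 e + (x.2.1 - x.1) * Γ.loopNumber,
   -((k + 1 : ℕ) : ℂ) - ∑ e, x.2.2 e + (x.2.1 - x.1) * (Γ.loopNumber + 1),
   x.2.2)

/-- The argument `n + |v| + c₁ (ℓ + 1) - c₂ ℓ` of the Gamma factor. -/
noncomputable def gammaArg (x : Exps k) : ℂ :=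
  ((k + 1 : ℕ) : ℂ) + ∑ e, x.2.2 e + x.1 * (Γ.loopNumber + 1) - x.2.1 * Γ.loopNumber

/-- `I` is (a branch over `U` of) the generalized amplitude
`∫ exp (-Q_Γ / Ψ_Γ) Q_Γ ^ c₁ / Ψ_Γ ^ c₂ t ^ v dt` over `ℝ₊ ^ n`, defined for all exponents as the
meromorphic function `Gamma (n + |v| + c₁ (ℓ + 1) - c₂ ℓ) * J (c, d, v)`, where `J` is the
meromorphic continuation of the integral over the simplex. -/
def IsGeneralizedAmplitude (U : Set (Γ.Coeffs m)) (I : Exps k → Γ.Coeffs m → ℂ) : Prop :=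
  IsMeromorphicFamily U I ∧ ∃ J, Γ.IsContinuationJ m U J ∧
    (∃ x, RegularAt U J (Γ.toExpsJ x)) ∧
    ∀ x, RegularAt U J (Γ.toExpsJ x) → (∀ j : ℕ, Γ.gammaArg x ≠ -(j : ℂ)) →
      ∀ P ∈ U, I x P = Complex.Gamma (Γ.gammaArg x) * J (Γ.toExpsJ x) P

end FeynmanGraph

/-! ## The GKZ operators -/

section GKZ

variable {A : Type*} [Fintype A]

open Classical in
/-- The partial derivative `∂f/∂P_a`. -/
noncomputable def partialDeriv (a : A) (f : (A → ℂ) → ℂ) : (A → ℂ) → ℂ :=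
  fun P => fderiv ℂ f P (Pi.single a 1)

/-- The differential monomial `∏_a (∂/∂P_a) ^ (ν a)`.  (On holomorphic functions the partial
derivatives commute, so the order of the factors, taken from an enumeration of `A`, does not
matter.) -/
noncomputable def monomialDeriv (ν : A → ℕ) (f : (A → ℂ) → ℂ) : (A → ℂ) → ℂ :=
  (Finset.univ : Finset A).toList.foldr (fun a g => (partialDeriv a)^[ν a] g) f

/-- The box operator `∏_{r_a > 0} (∂/∂P_a) ^ (r_a) - ∏_{r_a < 0} (∂/∂P_a) ^ (-r_a)`. -/
noncomputable def boxOp (r : A → ℤ) (f : (A → ℂ) → ℂ) : (A → ℂ) → ℂ :=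
  fun P => monomialDeriv (fun a => (r a).toNat) f P - monomialDeriv (fun a => (-r a).toNat) f P

/-- The Euler operator `∑_a μ_a P_a ∂/∂P_a`. -/
noncomputable def eulerOp (μ : A → ℤ) (f : (A → ℂ) → ℂ) : (A → ℂ) → ℂ :=
  fun P => ∑ a, (μ a : ℂ) * P a * partialDeriv a f P

end GKZ

/-!
Write the integral as `J (x, P) = ∫ Q ^ c Ψ ^ (-d) t ^ v` over the open simplex, with
`x = (c, d, v)`, and regard the exponent vectors of `Ψ` and `Q` as two families of lattice points.

*Convergence.*  Over the reals the edges of the graph are represented by the vectors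
`tgt e - src e`; forests are the linearly independent sets, spanning trees the bases, and
complements of cuts the independent sets with one element less (`isForest_iff`,
`isSpanningTree_iff`, `isCut_iff`).  By the greedy algorithm, for every ordering of the variables
one monomial of `Ψ` and one monomial of `Q` have the least degree in all the sets of smallest
variables at once (`isGreedy_treeExp`, `isGreedy_qMonomial`).  Hence on each sector of the simplex
one monomial dominates the form, which is comparable with it because the coefficients have
positive real parts, and no blow-up is needed: the integral converges and is holomorphic in
exponents and coefficients as soon as, for every nonempty proper set `I` of variables, the affine
form `facetForm I x = c * minDegree Q I - d * minDegree Ψ I + ∑ e ∈ I, (v e + 1)` has positive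
real part (`exists_norm_simplexIntegrand_le`, `analyticOnNhd_simplexIntegral`).

*Relations.*  The derivative with respect to a coefficient multiplies the integral by `c` or `-d`
and translates the exponents, so the two monomials of a box operator have the same effect
(`boxOp_simplexIntegral`).  The divergence theorem along the edges of the simplex
(`integral_simplexIntegrand_edge`) gives an Euler relation for every variable (`euler_relation`),
with an inhomogeneous term whose coefficient measures the deviation of the integrand from
homogeneity of degree `-n`.  For exponents which come from an amplitude this coefficient is zero
(`homogeneityForm_toExpsJ`).

*Continuation.*  The sum of the Euler relations over the variables in `I` expresses
`facetForm I x` times the integral through integrals whose exponents lie deeper in the half-space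
of `I` and no less deep in the others (`facetForm_mul_simplexIntegral`).  By induction the product
of the integral with all the `1 / Γ (facetForm I x)` is entire in `x`
(`exists_entire_simplexIntegral`).  In particular the denominator does not depend on `P`, and it
does not vanish identically on the exponents of the amplitudes (`im_facetForm_genericExps`), so
the amplitude exists.

*Branches.*  A meromorphic family over `U` which agrees with the integral for `P` in an open
subset is regular over the whole of `U` away from the zeros of the same denominator
(`IsMeromorphicFamily.regularAt_of_eq_on_open`).  These zeros meet a complex line in a countable
set, so that the identity theorem (`eq_zero_of_eq_zero_on_open`) carries the relations to all
`P ∈ U`, and continuity carries them to all the regular exponents (`IsGeneralizedAmplitude.gkz`).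
Finally the Laurent coefficients are circle integrals in `ε`, with which the operators commute; as
the eigenvalues are affine in `ε`, two consecutive coefficients appear in the Euler equations
(`laurentCoeff_of_family`).
-/

/-! ### Osgood's lemma and integrals with parameters -/

open MeasureTheory Metric in
/-- Cauchy's integral formula on a polydisc, for continuous functions which are holomorphic in each
variable separately. -/
theorem torusIntegral_prod_sub_inv_mul {n : ℕ} {f : (Fin n → ℂ) → ℂ} {c : Fin n → ℂ} {R : ℝ}
    (hR : 0 < R) (hf : ContinuousOn f (closedBall c R))
    (hd : ∀ x ∈ closedBall c R, ∀ i,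
      DifferentiableOn ℂ (fun z => f (Function.update x i z)) (closedBall (c i) R))
    {x : Fin n → ℂ} (hx : x ∈ ball c R) :
    (∯ ζ in T(c, fun _ => R), (∏ i, (ζ i - x i)⁻¹) * f ζ) =
      (2 * Real.pi * Complex.I) ^ n * f x := by
  induction n with
  | zero =>
    rw [torusIntegral_dim0]
    simp [Subsingleton.elim c x]
  | succ n ih =>
    have hmem : ∀ θ, torusMap c (fun _ => R) θ ∈ closedBall c R := by
      intro θ
      rw [mem_closedBall, dist_pi_le_iff hR.le]
      intro i
      simp [torusMap, dist_eq_norm, Complex.norm_exp, abs_of_pos hR]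
    have hne : ∀ θ i, torusMap c (fun _ => R) θ i - x i ≠ 0 := by
      intro θ i h
      have h1 : dist (x i) (c i) < R := (dist_le_pi_dist x c i).trans_lt hx
      rw [← sub_eq_zero.1 h] at h1
      simp [torusMap, dist_eq_norm, Complex.norm_exp, abs_of_pos hR] at h1
    have hcont : Continuous (torusMap c (fun _ => R)) := by
      unfold torusMap
      fun_prop
    rw [torusIntegral_succ]
    · have hx0 : x 0 ∈ ball (c 0) R := (dist_le_pi_dist x c 0).trans_lt hx
      have hxt : (fun i : Fin n => x i.succ) ∈ ball (c ∘ Fin.succ) R := by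
        rw [mem_ball, dist_pi_lt_iff hR]
        intro i
        exact (dist_le_pi_dist x c i.succ).trans_lt hx
      have hcons : ∀ z ∈ closedBall (c 0) R, ∀ y ∈ closedBall (c ∘ Fin.succ) R,
          (Fin.cons z y : Fin (n + 1) → ℂ) ∈ closedBall c R := by
        intro z hz y hy
        rw [mem_closedBall, dist_pi_le_iff hR.le] at hy ⊢
        intro i
        refine Fin.cases ?_ (fun j => ?_) i
        · simpa using hz
        · simpa using hy j
      have key : ∀ z ∈ sphere (c 0) R,
          (∯ y in T(c ∘ Fin.succ, (fun _ => R) ∘ Fin.succ),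
            (∏ i, ((Fin.cons z y : Fin (n + 1) → ℂ) i - x i)⁻¹) * f (Fin.cons z y)) =
          (2 * Real.pi * Complex.I) ^ n *
            ((z - x 0)⁻¹ * f (Fin.cons z fun i : Fin n => x i.succ)) := by
        intro z hz
        have hz' := sphere_subset_closedBall hz
        have h1 := ih (f := fun y => f (Fin.cons z y)) (c := c ∘ Fin.succ) ?_ ?_ hxt
        · have h2 : ∀ y : Fin n → ℂ,
              (∏ i, ((Fin.cons z y : Fin (n + 1) → ℂ) i - x i)⁻¹) * f (Fin.cons z y) =
              (z - x 0)⁻¹ * ((∏ i, (y i - x i.succ)⁻¹) * f (Fin.cons z y)) := by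
            intro y
            rw [Fin.prod_univ_succ]
            simp [mul_assoc]
          simp_rw [h2]
          rw [torusIntegral_const_mul]
          change (z - x 0)⁻¹ * (∯ y in T(c ∘ Fin.succ, fun _ => R), _) = _
          rw [h1]
          ring
        · refine hf.comp (Continuous.continuousOn (by fun_prop)) ?_
          intro y hy
          exact hcons z hz' y hy
        · intro y hy i
          have := hd _ (hcons z hz' y hy) i.succ
          simpa [Fin.cons_update] using this
      have hcong : (∮ z in C(c 0, R), (2 * Real.pi * Complex.I) ^ n *
          ((z - x 0)⁻¹ * f (Fin.cons z fun i : Fin n => x i.succ))) =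
          (2 * Real.pi * Complex.I) ^ (n + 1) * f x := by
        rw [circleIntegral.integral_const_mul]
        have h3 := hd x (ball_subset_closedBall hx) 0
        have h4 : ∀ z, Function.update x 0 z = Fin.cons z fun i : Fin n => x i.succ := by
          intro z
          ext i
          refine Fin.cases ?_ (fun j => ?_) i <;> simp
        simp_rw [h4] at h3
        have h5 := (DifferentiableOn.diffContOnCl
          (h3.mono closure_ball_subset_closedBall)).circleIntegral_sub_inv_smul hx0
        simp only [smul_eq_mul] at h5
        rw [h5]
        have : (Fin.cons (x 0) fun i : Fin n => x i.succ) = x := Fin.cons_self_tail x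
        rw [this]
        ring
      rw [← hcong]
      exact circleIntegral.integral_congr hR.le key
    · refine ContinuousOn.integrableOn_compact isCompact_Icc (Continuous.continuousOn ?_)
      refine Continuous.mul ?_ (hf.comp_continuous hcont hmem)
      refine continuous_finsetProd _ fun i _ => ?_
      exact Continuous.inv₀ (((continuous_apply i).comp hcont).sub continuous_const)
        fun θ => hne θ i

open MeasureTheory in
/-- Integration over a compact space, as a continuous linear functional on `C(K, ℂ)`. -/
theorem exists_integral_continuousLinearMap {K : Type*} [TopologicalSpace K] [CompactSpace K]
    [MeasurableSpace K] [OpensMeasurableSpace K] (μ : Measure K) [IsFiniteMeasure μ] :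
    ∃ Φ : C(K, ℂ) →L[ℂ] ℂ, ∀ g, Φ g = ∫ t, g t ∂μ := by
  have hint : ∀ g : C(K, ℂ), Integrable g μ := fun g => by
    refine Integrable.of_bound (g.continuous.aestronglyMeasurable_of_compactSpace) ‖g‖ ?_
    exact Eventually.of_forall fun t => g.norm_coe_le_norm t
  refine ⟨LinearMap.mkContinuous
    { toFun := fun g => ∫ t, g t ∂μ
      map_add' := fun g h => integral_add (hint g) (hint h)
      map_smul' := fun a g => integral_const_mul a _ } (μ.real Set.univ) ?_, fun g => rfl⟩
  intro g
  have := norm_integral_le_of_norm_le_const (μ := μ) (f := g)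
    (Eventually.of_forall fun t => g.norm_coe_le_norm t)
  rw [mul_comm]
  exact this

open MeasureTheory Metric in
/-- Osgood's lemma on `ℂ ^ n`.  The Cauchy kernel is an analytic function of the parameter, with
values in the Banach algebra of the continuous functions on the torus. -/
theorem analyticAt_of_continuousOn_of_separately {n : ℕ} {f : (Fin n → ℂ) → ℂ} {c : Fin n → ℂ}
    {R : ℝ} (hR : 0 < R) (hf : ContinuousOn f (closedBall c R))
    (hd : ∀ x ∈ closedBall c R, ∀ i,
      DifferentiableOn ℂ (fun z => f (Function.update x i z)) (closedBall (c i) R)) :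
    AnalyticAt ℂ f c := by
  let K := Set.Icc (0 : Fin n → ℝ) (fun _ => 2 * Real.pi)
  have hcont : Continuous (torusMap c (fun _ => R)) := by
    unfold torusMap
    fun_prop
  have hmem : ∀ θ, torusMap c (fun _ => R) θ ∈ closedBall c R := by
    intro θ
    rw [mem_closedBall, dist_pi_le_iff hR.le]
    intro i
    simp [torusMap, dist_eq_norm, Complex.norm_exp, abs_of_pos hR]
  have : IsFiniteMeasure (Measure.comap (Subtype.val : K → Fin n → ℝ) volume) := by
    refine ⟨?_⟩
    rw [Measure.comap_apply _ Subtype.val_injective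
      (fun s hs => measurableSet_Icc.subtype_image hs) _ MeasurableSet.univ]
    simpa using! (isCompact_Icc (a := (0 : Fin n → ℝ)) (b := fun _ => 2 * Real.pi)).measure_lt_top
  obtain ⟨Φ, hΦ⟩ := exists_integral_continuousLinearMap
    (Measure.comap (Subtype.val : K → Fin n → ℝ) volume)
  let w : C(K, ℂ) := ⟨fun θ => (∏ i, (R : ℂ) * Complex.exp (θ.1 i * Complex.I) * Complex.I) *
      f (torusMap c (fun _ => R) θ.1), by
    refine Continuous.mul (continuous_finsetProd _ fun i _ => ?_) ?_
    · have h : Continuous fun θ : K => ((θ.1 i : ℝ) : ℂ) :=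
        Complex.continuous_ofReal.comp ((continuous_apply i).comp continuous_subtype_val)
      exact (continuous_const.mul (Complex.continuous_exp.comp (h.mul continuous_const))).mul
        continuous_const
    exact hf.comp_continuous (hcont.comp continuous_subtype_val) fun θ => hmem _⟩
  let ζ : Fin n → C(K, ℂ) := fun i => ⟨fun θ => torusMap c (fun _ => R) θ.1 i,
    (continuous_apply i).comp (hcont.comp continuous_subtype_val)⟩
  let L : Fin n → (Fin n → ℂ) →L[ℂ] C(K, ℂ) := fun i =>
    (ContinuousLinearMap.proj i).smulRight (1 : C(K, ℂ))
  have hLapp : ∀ x i θ, (ζ i - L i x) θ = torusMap c (fun _ => R) θ.1 i - x i := by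
    intro x i θ
    simp [L, ζ]
  have hne : ∀ x ∈ ball c R, ∀ θ i, torusMap c (fun _ => R) θ i - x i ≠ 0 := by
    intro x hx θ i h
    have h1 : dist (x i) (c i) < R := (dist_le_pi_dist x c i).trans_lt hx
    rw [← sub_eq_zero.1 h] at h1
    simp [torusMap, dist_eq_norm, Complex.norm_exp, abs_of_pos hR] at h1
  have hunit : ∀ x ∈ ball c R, ∀ i, IsUnit (ζ i - L i x) := by
    intro x hx i
    rw [ContinuousMap.isUnit_iff_forall_ne_zero]
    intro θ
    rw [hLapp]
    exact hne x hx _ i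
  have hval : ∀ x ∈ ball c R, ∀ i θ, (Ring.inverse (ζ i - L i x)) θ =
      (torusMap c (fun _ => R) θ.1 i - x i)⁻¹ := by
    intro x hx i θ
    have h1 := Ring.mul_inverse_cancel _ (hunit x hx i)
    have h2 := congrArg (fun g : C(K, ℂ) => g θ) h1
    simp only [ContinuousMap.mul_apply, hLapp, ContinuousMap.one_apply] at h2
    exact eq_inv_of_mul_eq_one_right h2
  have hana : AnalyticAt ℂ (fun x => Φ (w * ∏ i, Ring.inverse (ζ i - L i x))) c := by
    refine (Φ.analyticAt _).comp ?_
    refine analyticAt_const.mul ?_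
    refine Finset.analyticAt_fun_prod _ fun i _ => ?_
    obtain ⟨u, hu⟩ := hunit c (mem_ball_self hR) i
    have h1 : AnalyticAt ℂ (Ring.inverse : C(K, ℂ) → C(K, ℂ)) (ζ i - L i c) := by
      rw [← hu]
      exact analyticAt_inverse u
    exact h1.comp (f := fun x => ζ i - L i x) (analyticAt_const.sub ((L i).analyticAt c))
  have hπ : (2 * Real.pi * Complex.I : ℂ) ^ n ≠ 0 :=
    pow_ne_zero _ Complex.two_pi_I_ne_zero
  have heq : ∀ᶠ x in 𝓝 c, ((2 * Real.pi * Complex.I : ℂ) ^ n)⁻¹ *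
      Φ (w * ∏ i, Ring.inverse (ζ i - L i x)) = f x := by
    filter_upwards [ball_mem_nhds c hR] with x hx
    rw [inv_mul_eq_iff_eq_mul₀ hπ, ← torusIntegral_prod_sub_inv_mul hR hf hd hx, hΦ]
    rw [torusIntegral, ← integral_subtype_comap measurableSet_Icc]
    refine integral_congr_ae (Eventually.of_forall fun θ => ?_)
    simp only [ContinuousMap.mul_apply, ContinuousMap.coe_prod, Finset.prod_apply, hval x hx,
      smul_eq_mul]
    simp only [w, ContinuousMap.coe_mk]
    ring
  exact (analyticAt_const.mul hana).congr heq

/-- Osgood's lemma: a continuous function on an open subset of a finite-dimensional complex space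
is analytic if its restrictions to all complex lines are holomorphic. -/
theorem analyticOnNhd_of_continuousOn_of_line {E : Type*} [NormedAddCommGroup E] [NormedSpace ℂ E]
    [FiniteDimensional ℂ E] {f : E → ℂ} {U : Set E} (hU : IsOpen U) (hf : ContinuousOn f U)
    (hd : ∀ x ∈ U, ∀ y, DifferentiableAt ℂ (fun z : ℂ => f (x + z • y)) 0) :
    AnalyticOnNhd ℂ f U := by
  intro x hx
  let e : E ≃L[ℂ] (Fin (Module.finrank ℂ E) → ℂ) :=
    ContinuousLinearEquiv.ofFinrankEq (by simp)
  have hV : IsOpen (e.symm ⁻¹' U) := hU.preimage e.symm.continuous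
  have hxV : e x ∈ e.symm ⁻¹' U := by simpa using hx
  obtain ⟨R, hR, hball⟩ := Metric.nhds_basis_closedBall.mem_iff.1 (hV.mem_nhds hxV)
  have h1 : AnalyticAt ℂ (f ∘ e.symm) (e x) := by
    refine analyticAt_of_continuousOn_of_separately hR
      ((hf.comp e.symm.continuous.continuousOn (Set.mapsTo_preimage _ _)).mono hball) ?_
    intro y hy i z hz
    have hmem : Function.update y i z ∈ Metric.closedBall (e x) R := by
      rw [Metric.mem_closedBall, dist_pi_le_iff hR.le] at hy ⊢
      intro j
      by_cases hj : j = i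
      · subst hj
        simpa using hz
      · simpa [hj] using hy j
    have h2 := hd (e.symm (Function.update y i z)) (hball hmem) (e.symm (Pi.single i 1))
    have h3 : DifferentiableAt ℂ (fun z' : ℂ => f (e.symm (Function.update y i z)
        + (z' - z) • e.symm (Pi.single i 1))) z := by
      refine DifferentiableAt.comp (𝕜 := ℂ) (g := fun z' : ℂ => f (e.symm (Function.update y i z)
        + z' • e.symm (Pi.single i 1))) (f := fun z' : ℂ => z' - z) z ?_ (by fun_prop)
      simpa using h2
    refine (h3.congr_of_eventuallyEq (Eventually.of_forall fun z' => ?_)).differentiableWithinAt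
    simp only [Function.comp]
    congr 1
    rw [← map_smul, ← map_add]
    congr 1
    ext j
    by_cases hj : j = i
    · subst hj
      simp
    · simp [hj]
  refine AnalyticAt.congr (h1.comp (f := fun x => e x) (e.analyticAt x)) ?_
  exact Eventually.of_forall fun y => by simp

/-- On a finite-dimensional space, complex differentiability on an open set implies analyticity. -/
theorem DifferentiableOn.analyticOnNhd_of_finiteDimensional {E : Type*} [NormedAddCommGroup E]
    [NormedSpace ℂ E] [FiniteDimensional ℂ E] {f : E → ℂ} {U : Set E}
    (hf : DifferentiableOn ℂ f U) (hU : IsOpen U) : AnalyticOnNhd ℂ f U := by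
  refine analyticOnNhd_of_continuousOn_of_line hU hf.continuousOn fun x hx y => ?_
  have h1 : DifferentiableAt ℂ f (x + (0 : ℂ) • y) := by
    simpa using hf.differentiableAt (hU.mem_nhds hx)
  exact DifferentiableAt.comp (𝕜 := ℂ) (g := f) (f := fun z : ℂ => x + z • y) 0 h1 (by fun_prop)

open MeasureTheory in
/-- The derivative of a parametric integral along a complex line.  Cauchy's estimate turns a bound
for the integrand into a bound for its derivative. -/
theorem hasDerivAt_integral_of_dominated_of_differentiableOn {α : Type*} [MeasurableSpace α]
    {μ : Measure α} {f : ℂ → α → ℂ} {r : ℝ} (hr : 0 < r) {g : α → ℝ} (hg : Integrable g μ)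
    (hmeas : ∀ z ∈ Metric.ball (0 : ℂ) r, AEStronglyMeasurable (f z) μ)
    (hdiff : ∀ᵐ t ∂μ, DifferentiableOn ℂ (fun z => f z t) (Metric.ball 0 r))
    (hbd : ∀ᵐ t ∂μ, ∀ z ∈ Metric.ball (0 : ℂ) r, ‖f z t‖ ≤ g t) :
    HasDerivAt (fun z => ∫ t, f z t ∂μ) (∫ t, deriv (fun z => f z t) 0 ∂μ) 0 := by
  have h0 : (0 : ℂ) ∈ Metric.ball (0 : ℂ) r := Metric.mem_ball_self hr
  have hr2 : 0 < r / 2 := by positivity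
  refine (hasDerivAt_integral_of_dominated_loc_of_deriv_le (F := f)
    (F' := fun z t => deriv (fun z => f z t) z) (bound := fun t => g t / (r / 3))
    (Metric.ball_mem_nhds (0 : ℂ) hr2) ?_ ?_ ?_ ?_ (hg.div_const _) ?_).2
  · filter_upwards [Metric.ball_mem_nhds (0 : ℂ) hr] with z hz using hmeas z hz
  · refine hg.mono' (hmeas 0 h0) ?_
    filter_upwards [hbd] with t ht using ht 0 h0
  · -- the derivative is a limit of difference quotients, hence measurable
    have hlim : Tendsto (fun j : ℕ => (((r / 2) / ((j : ℝ) + 1) : ℝ) : ℂ)) atTop (𝓝[≠] 0) := by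
      refine tendsto_nhdsWithin_iff.2 ⟨?_, Eventually.of_forall fun j => ?_⟩
      · have := tendsto_one_div_add_atTop_nhds_zero_nat (𝕜 := ℝ)
        have h2 := (this.const_mul (r / 2)).ofReal
        simpa [div_eq_mul_inv] using h2
      · have : 0 < (r / 2) / ((j : ℝ) + 1) := by positivity
        exact Complex.ofReal_ne_zero.2 this.ne'
    refine aestronglyMeasurable_of_tendsto_ae atTop
      (f := fun (j : ℕ) t => ((((r / 2) / ((j : ℝ) + 1) : ℝ) : ℂ))⁻¹ •
        (f (0 + (((r / 2) / ((j : ℝ) + 1) : ℝ) : ℂ)) t - f 0 t)) ?_ ?_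
    · intro j
      change AEStronglyMeasurable (((((r / 2) / ((j : ℝ) + 1) : ℝ) : ℂ))⁻¹ •
        (f (0 + (((r / 2) / ((j : ℝ) + 1) : ℝ) : ℂ)) - f 0)) μ
      refine ((hmeas _ ?_).sub (hmeas 0 h0)).const_smul _
      have h1 : (0 : ℝ) < (r / 2) / ((j : ℝ) + 1) := by positivity
      have h2 : (r / 2) / ((j : ℝ) + 1) ≤ r / 2 :=
        div_le_self hr2.le (by linarith [(Nat.cast_nonneg j : (0 : ℝ) ≤ j)])
      rw [zero_add, mem_ball_zero_iff, Complex.norm_real, Real.norm_eq_abs, abs_of_pos h1]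
      linarith
    · filter_upwards [hdiff] with t ht
      have h1 := (ht.differentiableAt (Metric.ball_mem_nhds (0 : ℂ) hr)).hasDerivAt
      exact h1.tendsto_slope_zero.comp hlim
  · filter_upwards [hdiff, hbd] with t ht hb z hz
    refine Complex.norm_deriv_le_of_forall_mem_sphere_norm_le (by positivity) ?_ ?_
    · refine DifferentiableOn.diffContOnCl (ht.mono fun y hy => ?_)
      have h3 := Metric.closure_ball_subset_closedBall hy
      simp only [Metric.mem_closedBall, Metric.mem_ball] at h3 hz ⊢
      linarith [dist_triangle y z 0]
    · intro y hy
      refine hb y ?_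
      simp only [mem_sphere_iff_norm, Metric.mem_ball] at hy hz ⊢
      rw [← dist_eq_norm] at hy
      linarith [dist_triangle y z 0]
  · filter_upwards [hdiff] with t ht z hz
    refine (ht.differentiableAt (Metric.isOpen_ball.mem_nhds ?_)).hasDerivAt
    exact Metric.ball_subset_ball (by linarith) hz

open MeasureTheory in
/-- A locally dominated parametric integral of holomorphic functions is analytic in the parameter,
and it can be differentiated under the integral sign. -/
theorem analyticOnNhd_integral_of_dominated {E : Type*} [NormedAddCommGroup E] [NormedSpace ℂ E]
    [FiniteDimensional ℂ E] {α : Type*} [MeasurableSpace α] {μ : Measure α} {U : Set E}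
    (hU : IsOpen U) {f : E → α → ℂ} (hmeas : ∀ x ∈ U, AEStronglyMeasurable (f x) μ)
    (hdiff : ∀ᵐ t ∂μ, DifferentiableOn ℂ (fun x => f x t) U)
    (hbd : ∀ x ∈ U, ∃ N ∈ 𝓝 x, ∃ g : α → ℝ, Integrable g μ ∧ ∀ᵐ t ∂μ, ∀ y ∈ N, ‖f y t‖ ≤ g t) :
    AnalyticOnNhd ℂ (fun x => ∫ t, f x t ∂μ) U ∧
      ∀ x ∈ U, ∀ y, fderiv ℂ (fun x => ∫ t, f x t ∂μ) x y =
        ∫ t, fderiv ℂ (fun x => f x t) x y ∂μ := by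
  have hline : ∀ x ∈ U, ∀ y, HasDerivAt (fun z : ℂ => ∫ t, f (x + z • y) t ∂μ)
      (∫ t, fderiv ℂ (fun x => f x t) x y ∂μ) 0 := by
    intro x hx y
    obtain ⟨N, hN, g, hg, hb⟩ := hbd x hx
    have hc : ContinuousAt (fun z : ℂ => x + z • y) 0 := by fun_prop
    have h1 : (fun z : ℂ => x + z • y) ⁻¹' (N ∩ U) ∈ 𝓝 (0 : ℂ) := by
      refine hc.preimage_mem_nhds ?_
      simpa using inter_mem hN (hU.mem_nhds hx)
    obtain ⟨r, hr, hball⟩ := Metric.mem_nhds_iff.1 h1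
    have h2 := hasDerivAt_integral_of_dominated_of_differentiableOn (μ := μ)
      (f := fun z t => f (x + z • y) t) hr hg (fun z hz => hmeas _ (hball hz).2) ?_ ?_
    · convert! h2 using 1
      refine integral_congr_ae ?_
      filter_upwards [hdiff] with t ht
      have h3 : HasFDerivAt (fun x => f x t) (fderiv ℂ (fun x => f x t) x) (x + (0 : ℂ) • y) := by
        simpa using (ht.differentiableAt (hU.mem_nhds hx)).hasFDerivAt
      have h4 : HasDerivAt (fun z : ℂ => x + z • y) y 0 := by
        simpa using ((hasDerivAt_id (0 : ℂ)).smul_const y).const_add x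
      exact (h3.comp_hasDerivAt (0 : ℂ) h4).deriv.symm
    · filter_upwards [hdiff] with t ht
      exact ht.comp (Differentiable.differentiableOn (by fun_prop)) fun z hz => (hball hz).2
    · filter_upwards [hb] with t ht z hz using ht _ (hball hz).1
  have hana : AnalyticOnNhd ℂ (fun x => ∫ t, f x t ∂μ) U := by
    refine analyticOnNhd_of_continuousOn_of_line hU ?_ fun x hx y =>
      (hline x hx y).differentiableAt
    intro x hx
    obtain ⟨N, hN, g, hg, hb⟩ := hbd x hx
    refine (continuousAt_of_dominated (bound := g) ?_ ?_ hg ?_).continuousWithinAt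
    · filter_upwards [hU.mem_nhds hx] with y hy using hmeas y hy
    · filter_upwards [hN] with y hy
      filter_upwards [hb] with t ht using ht y hy
    · filter_upwards [hdiff] with t ht
      exact (ht.differentiableAt (hU.mem_nhds hx)).continuousAt
  refine ⟨hana, fun x hx y => ?_⟩
  have h3 : HasFDerivAt (fun x => ∫ t, f x t ∂μ) (fderiv ℂ (fun x => ∫ t, f x t ∂μ) x)
      (x + (0 : ℂ) • y) := by
    simpa using (hana x hx).differentiableAt.hasFDerivAt
  have h4 : HasDerivAt (fun z : ℂ => x + z • y) y 0 := by
    simpa using ((hasDerivAt_id (0 : ℂ)).smul_const y).const_add x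
  have h5 := h3.comp_hasDerivAt (0 : ℂ) h4
  exact h5.unique (hline x hx y)

open MeasureTheory Metric in
/-- Circle integrals depend analytically on parameters. -/
theorem analyticOnNhd_circleIntegral {E : Type*} [NormedAddCommGroup E] [NormedSpace ℂ E]
    [FiniteDimensional ℂ E] {U : Set E} (hU : IsOpen U) {f : E → ℂ → ℂ} {c : ℂ} {R : ℝ}
    (hR : 0 ≤ R) (hc : ContinuousOn (Function.uncurry f) (U ×ˢ sphere c R))
    (hd : ∀ ζ ∈ sphere c R, DifferentiableOn ℂ (fun x => f x ζ) U) :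
    AnalyticOnNhd ℂ (fun x => ∮ ζ in C(c, R), f x ζ) U ∧
      ∀ x ∈ U, ∀ y, fderiv ℂ (fun x => ∮ ζ in C(c, R), f x ζ) x y =
        ∮ ζ in C(c, R), fderiv ℂ (fun x => f x ζ) x y := by
  have : ProperSpace E := FiniteDimensional.proper ℂ E
  have hmem : ∀ θ, circleMap c R θ ∈ sphere c R := circleMap_mem_sphere c hR
  have key := analyticOnNhd_integral_of_dominated (μ := volume.restrict (Set.Ioc 0 (2 * Real.pi)))
    hU (f := fun x θ => deriv (circleMap c R) θ • f x (circleMap c R θ)) ?_ ?_ ?_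
  · constructor
    · refine key.1.congr hU fun x hx => ?_
      simp only [circleIntegral, intervalIntegral.integral_of_le Real.two_pi_pos.le]
    · intro x hx y
      have h1 := key.2 x hx y
      simp only [circleIntegral, intervalIntegral.integral_of_le Real.two_pi_pos.le]
      rw [h1]
      refine integral_congr_ae (Eventually.of_forall fun θ => ?_)
      have h2 : DifferentiableAt ℂ (fun x => f x (circleMap c R θ)) x :=
        (hd _ (hmem θ)).differentiableAt (hU.mem_nhds hx)
      simp only [smul_eq_mul]
      rw [fderiv_const_mul h2]
      simp
  · intro x hx
    refine Continuous.aestronglyMeasurable ?_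
    have hder : deriv (circleMap c R) = fun θ => circleMap 0 R θ * Complex.I := by
      ext θ
      simp
    have hder' : Continuous (deriv (circleMap c R)) := by
      rw [hder]
      fun_prop
    refine hder'.smul ?_
    exact hc.comp_continuous (f := fun θ => (x, circleMap c R θ)) (by fun_prop)
      fun θ => ⟨hx, hmem θ⟩
  · exact Eventually.of_forall fun θ => (hd _ (hmem θ)).fun_const_smul _
  · intro x hx
    obtain ⟨r, hr, hball⟩ := nhds_basis_closedBall.mem_iff.1 (hU.mem_nhds hx)
    have hcomp : IsCompact (closedBall x r ×ˢ sphere c R) :=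
      (isCompact_closedBall x r).prod (isCompact_sphere c R)
    obtain ⟨M, hM⟩ := hcomp.exists_bound_of_continuousOn
      (hc.mono (Set.prod_mono hball subset_rfl))
    refine ⟨closedBall x r, closedBall_mem_nhds x hr, fun _ => R * M, integrable_const _,
      Eventually.of_forall fun θ y hy => ?_⟩
    rw [norm_smul]
    have h1 : ‖deriv (circleMap c R) θ‖ = R := by simp [abs_of_nonneg hR]
    rw [h1]
    exact mul_le_mul_of_nonneg_left (hM (y, _) ⟨hy, hmem θ⟩) hR

/-! ### Meromorphic families -/

theorem eq_of_frequently_eq_of_continuousAt {X : Type*} [TopologicalSpace X] {f g : X → ℂ} {x : X}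
    (hf : ContinuousAt f x) (hg : ContinuousAt g x) (h : ∃ᶠ y in 𝓝 x, f y = g y) : f x = g x := by
  by_contra hne
  have h1 : ∀ᶠ y in 𝓝 x, f y - g y ≠ 0 := (hf.sub hg).eventually_ne (sub_ne_zero.2 hne)
  exact h (h1.mono fun y hy => sub_ne_zero.1 hy)

/-- The zeros of an entire function of one variable which does not vanish identically are
countable. -/
theorem AnalyticOnNhd.countable_zeros {ψ : ℂ → ℂ} (hψ : AnalyticOnNhd ℂ ψ Set.univ) {z₀ : ℂ}
    (hz₀ : ψ z₀ ≠ 0) : {z | ψ z = 0}.Countable := by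
  refine IsLindelof.countable (HereditarilyLindelofSpace.isLindelof _) ?_
  rw [discreteTopology_subtype_iff]
  intro z _
  rw [← disjoint_iff, disjoint_principal_right]
  rcases (hψ z (Set.mem_univ z)).eventually_eq_zero_or_eventually_ne_zero with h | h
  · exact absurd (hψ.eqOn_zero_of_preconnected_of_eventuallyEq_zero isPreconnected_univ
      (Set.mem_univ z) h (Set.mem_univ z₀)) hz₀
  · exact h

section MeromorphicFamilies

variable {X Y : Type*} [NormedAddCommGroup X] [NormedSpace ℂ X]
  [NormedAddCommGroup Y] [NormedSpace ℂ Y]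

theorem AnalyticOnNhd.isDenominator {h : X → ℂ} (hh : AnalyticOnNhd ℂ h Set.univ) {x₁ : X}
    (hx₁ : h x₁ ≠ 0) (x₀ : X) : IsDenominator h Set.univ x₀ := by
  refine ⟨univ_mem, hh, fun hev => hx₁ ?_⟩
  exact hh.eqOn_zero_of_preconnected_of_eventuallyEq_zero isPreconnected_univ
    (Set.mem_univ x₀) (hev.mono fun x hx => not_not.1 hx) (Set.mem_univ x₁)

theorem IsDenominator.mono {h : X → ℂ} {N N' : Set X} {x₀ : X} (hN : IsDenominator h N x₀)
    (hN' : N' ∈ 𝓝 x₀) (hsub : N' ⊆ N) : IsDenominator h N' x₀ :=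
  ⟨hN', hN.2.1.mono hsub, hN.2.2⟩

/-- By the identity theorem, a denominator vanishes identically near no point of a ball around
`x₀`. -/
theorem IsDenominator.exists_ball {h : X → ℂ} {N : Set X} {x₀ : X} (hN : IsDenominator h N x₀) :
    ∃ r > 0, Metric.ball x₀ r ⊆ N ∧ ∀ x ∈ Metric.ball x₀ r, ∃ᶠ y in 𝓝 x, h y ≠ 0 := by
  obtain ⟨r, hr, hball⟩ := Metric.mem_nhds_iff.1 hN.1
  refine ⟨r, hr, hball, fun x hx hev => hN.2.2 ?_⟩
  have h1 := (hN.2.1.mono hball).eqOn_zero_of_preconnected_of_eventuallyEq_zero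
    (convex_ball x₀ r).isPreconnected hx (hev.mono fun x hx => not_not.1 hx)
  filter_upwards [Metric.ball_mem_nhds x₀ hr] with y hy
  exact not_not.2 (h1 hy)

theorem IsDenominator.mul {h h' : X → ℂ} {N N' : Set X} {x₀ : X} (hN : IsDenominator h N x₀)
    (hN' : IsDenominator h' N' x₀) : IsDenominator (fun x => h x * h' x) (N ∩ N') x₀ := by
  refine ⟨inter_mem hN.1 hN'.1, fun x hx => (hN.2.1 x hx.1).mul (hN'.2.1 x hx.2), ?_⟩
  obtain ⟨r, hr, hball, hfr⟩ := hN'.exists_ball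
  intro hev
  refine hN.2.2 ?_
  filter_upwards [eventually_eventually_nhds.2 hev, Metric.ball_mem_nhds x₀ hr,
    (eventually_mem_nhds_iff.2 hN.1)] with y hy hyr hyN hne
  have h1 := (hN.2.1 y (mem_of_mem_nhds hyN)).continuousAt.eventually_ne hne
  refine hfr y hyr ?_
  filter_upwards [hy, h1] with z hz hz1 hz2
  exact hz (mul_ne_zero hz1 hz2)

theorem RegularAt.eventually {U : Set Y} {F : X → Y → ℂ} {x₀ : X} (h : RegularAt U F x₀) :
    ∀ᶠ x in 𝓝 x₀, RegularAt U F x := by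
  obtain ⟨N, hN, hF⟩ := h
  filter_upwards [eventually_mem_nhds_iff.2 hN] with x hx using ⟨N, hx, hF⟩

theorem RegularAt.analyticAt {U : Set Y} {F : X → Y → ℂ} {x₀ : X} (h : RegularAt U F x₀)
    {P : Y} (hP : P ∈ U) : AnalyticAt ℂ (Function.uncurry F) (x₀, P) := by
  obtain ⟨N, hN, hF⟩ := h
  exact hF _ ⟨mem_of_mem_nhds hN, hP⟩

theorem RegularAt.analyticAt_left {U : Set Y} {F : X → Y → ℂ} {x₀ : X} (h : RegularAt U F x₀)
    {P : Y} (hP : P ∈ U) : AnalyticAt ℂ (fun x => F x P) x₀ :=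
  (h.analyticAt hP).comp (f := fun x => (x, P)) (analyticAt_id.prod analyticAt_const)

theorem RegularAt.analyticOnNhd_right {U : Set Y} {F : X → Y → ℂ} {x₀ : X} (h : RegularAt U F x₀) :
    AnalyticOnNhd ℂ (F x₀) U := fun _ hP =>
  (h.analyticAt hP).comp (f := fun P => (x₀, P)) (analyticAt_const.prod analyticAt_id)

/-- A family is regular wherever it agrees with an analytic one. -/
theorem RegularAt.of_eventuallyEq {U : Set Y} (hU : IsOpen U) {F G : X → Y → ℂ} {x₀ : X}
    {N : Set X} (hN : N ∈ 𝓝 x₀) (hG : AnalyticOnNhd ℂ (Function.uncurry G) (N ×ˢ U))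
    (heq : ∀ x ∈ N, ∀ P ∈ U, F x P = G x P) : RegularAt U F x₀ := by
  refine ⟨interior N, interior_mem_nhds.2 hN, ?_⟩
  refine (hG.mono (Set.prod_mono interior_subset subset_rfl)).congr (isOpen_interior.prod hU) ?_
  rintro ⟨x, P⟩ ⟨hx, hP⟩
  exact (heq x (interior_subset hx) P hP).symm

theorem RegularAt.congr {U : Set Y} (hU : IsOpen U) {F G : X → Y → ℂ} {x₀ : X}
    (hG : RegularAt U G x₀) (heq : ∀ᶠ x in 𝓝 x₀, ∀ P ∈ U, F x P = G x P) : RegularAt U F x₀ := by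
  obtain ⟨N, hN, hF⟩ := hG
  exact RegularAt.of_eventuallyEq hU (inter_mem hN heq)
    (hF.mono (Set.prod_mono Set.inter_subset_left subset_rfl)) fun x hx => hx.2

theorem AnalyticOnNhd.uncurry_div {N : Set X} {U : Set Y} {h : X → ℂ} {G : X → Y → ℂ}
    (hG : AnalyticOnNhd ℂ (Function.uncurry G) (N ×ˢ U)) (hh : AnalyticOnNhd ℂ h N) :
    AnalyticOnNhd ℂ (Function.uncurry fun x P => G x P / h x) ((N ∩ {x | h x ≠ 0}) ×ˢ U) := by
  rintro ⟨x, P⟩ ⟨⟨hx, hx'⟩, hP⟩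
  refine (hG (x, P) ⟨hx, hP⟩).div (g := fun p : X × Y => h p.1) ?_ hx'
  exact AnalyticAt.comp (g := h) (f := fun p : X × Y => p.1) (hh x hx) analyticAt_fst

/-- A quotient of analytic families is regular where the denominator does not vanish. -/
theorem RegularAt.of_quotient {U : Set Y} (hU : IsOpen U) {F G : X → Y → ℂ} {h : X → ℂ}
    {N : Set X} {x₀ : X} (hN : N ∈ 𝓝 x₀) (hh : AnalyticOnNhd ℂ h N)
    (hG : AnalyticOnNhd ℂ (Function.uncurry G) (N ×ˢ U))
    (heq : ∀ x ∈ N, h x ≠ 0 → ∀ P ∈ U, F x P = G x P / h x) (hx₀ : h x₀ ≠ 0) :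
    RegularAt U F x₀ := by
  have hN' : N ∩ {x | h x ≠ 0} ∈ 𝓝 x₀ :=
    inter_mem hN ((hh x₀ (mem_of_mem_nhds hN)).continuousAt.eventually_ne hx₀)
  exact RegularAt.of_eventuallyEq hU hN' (hG.uncurry_div hh) fun x hx => heq x hx.1 hx.2

/-- Filling in the removable singularities: a family which is locally a quotient of holomorphic
functions can be modified, away from the points where it is regular, so as to become a meromorphic
family. -/
theorem exists_isMeromorphicFamily {U : Set Y} (hU : IsOpen U) (F : X → Y → ℂ)
    (hF : ∀ x₀ : X, ∃ (N : Set X) (h : X → ℂ) (G : X → Y → ℂ), IsDenominator h N x₀ ∧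
      AnalyticOnNhd ℂ (Function.uncurry G) (N ×ˢ U) ∧
      ∀ x ∈ N, h x ≠ 0 → ∀ P ∈ U, F x P = G x P / h x) :
    ∃ F' : X → Y → ℂ, IsMeromorphicFamily U F' ∧
      ∀ x, RegularAt U F x → RegularAt U F' x ∧ ∀ P ∈ U, F' x P = F x P := by
  classical
  let Rem : X → (X → Y → ℂ) → Prop := fun x₀ G => ∃ (N : Set X) (h : X → ℂ),
    IsDenominator h N x₀ ∧ AnalyticOnNhd ℂ (Function.uncurry G) (N ×ˢ U) ∧
    ∀ x ∈ N, h x ≠ 0 → ∀ P ∈ U, F x P = G x P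
  let F' : X → Y → ℂ := fun x P => if hx : ∃ G, Rem x G then hx.choose x P else F x P
  -- two extensions over a removable singularity have the same value there
  have huniq : ∀ x₀ G G', Rem x₀ G → Rem x₀ G' → ∀ P ∈ U, G x₀ P = G' x₀ P := by
    rintro x₀ G G' ⟨N, h, hh, hG, hFG⟩ ⟨N', h', hh', hG', hFG'⟩ P hP
    have hd := hh.mul hh'
    refine eq_of_frequently_eq_of_continuousAt (f := fun x => G x P) (g := fun x => G' x P)
      ((hG (x₀, P) ⟨mem_of_mem_nhds hh.1, hP⟩).continuousAt.comp (f := fun x => (x, P))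
        (by fun_prop))
      ((hG' (x₀, P) ⟨mem_of_mem_nhds hh'.1, hP⟩).continuousAt.comp (f := fun x => (x, P))
        (by fun_prop)) ?_
    refine (hd.2.2.and_eventually hd.1).mono ?_
    rintro x ⟨hx, hxN, hxN'⟩
    exact (hFG x hxN (left_ne_zero_of_mul hx) P hP).symm.trans
      (hFG' x hxN' (right_ne_zero_of_mul hx) P hP)
  have hF' : ∀ x₀ G, Rem x₀ G → ∀ P ∈ U, F' x₀ P = G x₀ P := by
    intro x₀ G hG P hP
    have hx : ∃ G, Rem x₀ G := ⟨G, hG⟩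
    simp only [F', dif_pos hx]
    exact huniq x₀ _ _ hx.choose_spec hG P hP
  have hreg : ∀ x, RegularAt U F x → ∀ P ∈ U, F' x P = F x P := by
    rintro x ⟨N, hN, hFN⟩
    exact hF' x F ⟨N, fun _ => 1, ⟨hN, analyticOnNhd_const,
      (Eventually.of_forall fun _ => one_ne_zero).frequently⟩, hFN, fun _ _ _ _ _ => rfl⟩
  refine ⟨F', ⟨fun x₀ => ?_, fun x₀ => ?_⟩, fun x hx => ⟨?_, hreg x hx⟩⟩
  · obtain ⟨N, h, G, hh, hG, hFG⟩ := hF x₀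
    have hint : interior N ∈ 𝓝 x₀ := interior_mem_nhds.2 hh.1
    refine ⟨interior N, h, G, hh.mono hint interior_subset,
      hG.mono (Set.prod_mono interior_subset subset_rfl), fun x hx hne P hP => ?_⟩
    rw [hreg x (RegularAt.of_quotient hU (mem_interior_iff_mem_nhds.1 hx) hh.2.1 hG hFG hne) P hP]
    exact hFG x (interior_subset hx) hne P hP
  · rintro ⟨N, h, G, hh, hG, hFG⟩
    obtain ⟨N₁, h₁, G₁, hh₁, hG₁, hFG₁⟩ := hF x₀
    obtain ⟨r, hr, hball, hfr⟩ := (hh.mul hh₁).exists_ball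
    refine RegularAt.of_eventuallyEq hU (Metric.ball_mem_nhds x₀ hr)
      (hG.mono (Set.prod_mono (hball.trans Set.inter_subset_left) subset_rfl)) fun x hx P hP => ?_
    refine hF' x G ⟨Metric.ball x₀ r, fun x => h x * h₁ x,
      ⟨Metric.isOpen_ball.mem_nhds hx, (hh.mul hh₁).2.1.mono hball, hfr x hx⟩,
      hG.mono (Set.prod_mono (hball.trans Set.inter_subset_left) subset_rfl), ?_⟩ P hP
    intro y hy hne Q hQ
    rw [← hFG y (hball hy).1 (left_ne_zero_of_mul hne) Q hQ]
    refine (hreg y (RegularAt.of_quotient hU (Filter.mem_of_superset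
      (Metric.isOpen_ball.mem_nhds hy) (hball.trans Set.inter_subset_right)) hh₁.2.1 hG₁ hFG₁
      (right_ne_zero_of_mul hne)) Q hQ).symm
  · exact hx.congr hU (hx.eventually.mono fun y hy => hreg y hy)

/-- An identity theorem off the zeros of an entire function: as the zeros of this function on a
complex line are countable, they do not disconnect the line. -/
theorem eq_zero_of_eq_zero_on_open {h φ : X → ℂ} (hh : AnalyticOnNhd ℂ h Set.univ)
    (hφ : AnalyticOnNhd ℂ φ {x | h x ≠ 0}) {B : Set X} (hB : IsOpen B) (hBne : B.Nonempty)
    (h0 : ∀ x ∈ B, h x ≠ 0 → φ x = 0) {x : X} (hx : h x ≠ 0) : φ x = 0 := by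
  obtain ⟨b, hb⟩ := hBne
  obtain ⟨x₁, hx₁, hx₁B⟩ :=
    ((hh.isDenominator hx b).2.2.and_eventually (hB.mem_nhds hb)).exists
  let l : ℂ → X := fun z => x + z • (x₁ - x)
  have hl : AnalyticOnNhd ℂ l Set.univ := fun z _ =>
    analyticAt_const.add (analyticAt_id.smul analyticAt_const)
  have hl0 : l 0 = x := by simp [l]
  have hl1 : l 1 = x₁ := by simp [l]
  have hψ : AnalyticOnNhd ℂ (fun z => h (l z)) Set.univ := fun z hz =>
    (hh (l z) (Set.mem_univ _)).comp (hl z hz)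
  have hcount : {z | h (l z) = 0}.Countable := hψ.countable_zeros (z₀ := 0) (by rwa [hl0])
  have hconn : IsPreconnected {z | h (l z) = 0}ᶜ :=
    (hcount.isConnected_compl_of_one_lt_rank (by simp [Complex.rank_real_complex])).isPreconnected
  have hφl : AnalyticOnNhd ℂ (fun z => φ (l z)) {z | h (l z) = 0}ᶜ := fun z hz =>
    (hφ (l z) hz).comp (hl z (Set.mem_univ z))
  have hev : ∀ᶠ z in 𝓝 (1 : ℂ), φ (l z) = 0 := by
    have hc : ContinuousAt l 1 := (hl 1 (Set.mem_univ 1)).continuousAt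
    have h1 : ∀ᶠ y in 𝓝 (l 1), y ∈ B ∧ h y ≠ 0 := by
      rw [hl1]
      exact (hB.eventually_mem hx₁B).and ((hh x₁ (Set.mem_univ _)).continuousAt.eventually_ne hx₁)
    exact (hc.eventually h1).mono fun z hz => h0 _ hz.1 hz.2
  have := hφl.eqOn_zero_of_preconnected_of_eventuallyEq_zero hconn (z₀ := 1)
    (by simpa [hl1] using hx₁) hev (x := 0) (by simpa [hl0] using hx)
  simpa [hl0] using this

/-- If a meromorphic family agrees with the quotient `G₀ / h₀` of entire functions of the exponents
on an open set of exponents, for `P ∈ W`, then it does so wherever it is regular. -/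
theorem IsMeromorphicFamily.mul_eq_of_eq_on_open {U W : Set Y} (hU : IsOpen U) {J : X → Y → ℂ}
    (hJ : IsMeromorphicFamily U J) (hWU : W ⊆ U)
    {h₀ : X → ℂ} {G₀ : X → Y → ℂ} (hh₀ : AnalyticOnNhd ℂ h₀ Set.univ)
    (hG₀ : ∀ P ∈ W, AnalyticOnNhd ℂ (fun x => G₀ x P) Set.univ)
    {B : Set X} (hB : IsOpen B) (hBne : B.Nonempty)
    (heq : ∀ x ∈ B, ∀ P ∈ W, h₀ x * J x P = G₀ x P) {x : X} (hx : RegularAt U J x)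
    {P : Y} (hP : P ∈ W) : h₀ x * J x P = G₀ x P := by
  -- the set of points near which the equality holds is open and closed, and it is nonempty
  let A : Set X := {x₀ | ∀ᶠ x in 𝓝 x₀, RegularAt U J x → ∀ P ∈ W, h₀ x * J x P = G₀ x P}
  have hAo : IsOpen A := isOpen_setOfPred_eventually_nhds
  have hAc : IsClosed A := by
    refine isClosed_of_closure_subset fun x₀ hx₀ => ?_
    obtain ⟨N, h, G, hh, hG, hJG⟩ := hJ.1 x₀
    obtain ⟨r, hr, hball, hfr⟩ := hh.exists_ball
    have hreg : ∀ x ∈ Metric.ball x₀ r, h x ≠ 0 → RegularAt U J x := fun x hx hne =>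
      RegularAt.of_quotient hU (Filter.mem_of_superset (Metric.isOpen_ball.mem_nhds hx) hball)
        hh.2.1 hG hJG hne
    obtain ⟨x₁, hx₁, hx₁A⟩ := mem_closure_iff.1 hx₀ _ Metric.isOpen_ball
      (Metric.mem_ball_self hr)
    obtain ⟨x₂, hx₂, hx₂A, hx₂b⟩ := ((hfr x₁ hx₁).and_eventually
      ((hAo.eventually_mem hx₁A).and (Metric.isOpen_ball.eventually_mem hx₁))).exists
    have hcross : ∀ P ∈ W, Set.EqOn (fun x => h₀ x * G x P) (fun x => h x * G₀ x P)
        (Metric.ball x₀ r) := by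
      intro P hP
      refine AnalyticOnNhd.eqOn_of_preconnected_of_eventuallyEq (𝕜 := ℂ) ?_ ?_
        (convex_ball x₀ r).isPreconnected hx₂b ?_
      · intro x hx
        exact (hh₀ x (Set.mem_univ x)).mul ((hG (x, P) ⟨hball hx, hWU hP⟩).comp
          (f := fun x => (x, P)) (analyticAt_id.prod analyticAt_const))
      · intro x hx
        exact (hh.2.1 x (hball hx)).mul (hG₀ P hP x (Set.mem_univ x))
      · filter_upwards [hx₂A, Metric.isOpen_ball.mem_nhds hx₂b,
          (hh.2.1 x₂ (hball hx₂b)).continuousAt.eventually_ne hx₂] with x hxA hxb hxne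
        have h1 := hxA (hreg x hxb hxne) P hP
        rw [hJG x (hball hxb) hxne P (hWU hP)] at h1
        rw [← h1]
        field_simp
    change ∀ᶠ x in 𝓝 x₀, _
    filter_upwards [Metric.ball_mem_nhds x₀ hr] with x hx hxreg P hP
    refine eq_of_frequently_eq_of_continuousAt (f := fun x => h₀ x * J x P)
      (g := fun x => G₀ x P) ((hh₀ x (Set.mem_univ x)).continuousAt.mul
        (hxreg.analyticAt_left (hWU hP)).continuousAt)
      (hG₀ P hP x (Set.mem_univ x)).continuousAt ?_
    refine ((hfr x hx).and_eventually (Metric.isOpen_ball.mem_nhds hx)).mono ?_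
    rintro y ⟨hyne, hyb⟩
    have h1 := hcross P hP hyb
    simp only at h1
    rw [hJG y (hball hyb) hyne P (hWU hP), ← mul_div_assoc, h1]
    field_simp
  obtain ⟨b, hb⟩ := hBne
  have huniv : A = Set.univ := IsClopen.eq_univ ⟨hAc, hAo⟩
    ⟨b, by
      change ∀ᶠ x in 𝓝 b, _
      filter_upwards [hB.mem_nhds hb] with x hx _ using heq x hx⟩
  have hxA : x ∈ A := huniv ▸ Set.mem_univ x
  exact hxA.self_of_nhds hx P hP

/-- The polar locus of a meromorphic family does not depend on the domain of the parameter: if the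
family agrees with `G₀ / h₀` for `P` in a nonempty open subset `W` of `U`, then it is regular over
the whole of `U` outside the zeros of `h₀`.  Near such a point the family is the mean of its values
over a circle which avoids the zeros of the local denominator, first for `P ∈ W` and then for all
`P ∈ U`. -/
theorem IsMeromorphicFamily.regularAt_of_eq_on_open [FiniteDimensional ℂ X]
    [FiniteDimensional ℂ Y] {U W : Set Y} (hU : IsOpen U) (hUc : IsPreconnected U)
    {J : X → Y → ℂ} (hJ : IsMeromorphicFamily U J) (hW : IsOpen W) (hWne : W.Nonempty)
    (hWU : W ⊆ U) {h₀ : X → ℂ} {G₀ : X → Y → ℂ} (hh₀ : AnalyticOnNhd ℂ h₀ Set.univ)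
    (hG₀ : ∀ P ∈ W, AnalyticOnNhd ℂ (fun x => G₀ x P) Set.univ)
    {B : Set X} (hB : IsOpen B) (hBne : B.Nonempty)
    (heq : ∀ x ∈ B, ∀ P ∈ W, h₀ x * J x P = G₀ x P) {x₀ : X} (hx₀ : h₀ x₀ ≠ 0) :
    RegularAt U J x₀ := by
  obtain ⟨N, h, G, hh, hG, hJG⟩ := hJ.1 x₀
  obtain ⟨r, hr, hball, hfr⟩ := hh.exists_ball
  have hreg : ∀ x ∈ Metric.ball x₀ r, h x ≠ 0 → RegularAt U J x := fun x hx hne =>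
    RegularAt.of_quotient hU (Filter.mem_of_superset (Metric.isOpen_ball.mem_nhds hx) hball)
      hh.2.1 hG hJG hne
  have hJ₀ : ∀ x, RegularAt U J x → ∀ P ∈ W, h₀ x * J x P = G₀ x P := fun x hx P hP =>
    hJ.mul_eq_of_eq_on_open hU hWU hh₀ hG₀ hB hBne heq hx hP
  obtain ⟨x₁, hx₁, hx₁b⟩ := ((hfr x₀ (Metric.mem_ball_self hr)).and_eventually
    (Metric.ball_mem_nhds x₀ hr)).exists
  let ξ := x₁ - x₀
  let L : X × ℂ → X := fun p => p.1 + p.2 • ξ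
  have hL : Continuous L := by fun_prop
  -- a small circle around `x₀` in the complex line through `x₁` avoids the zeros of `h`
  have hpunct : ∀ᶠ z in 𝓝[≠] (0 : ℂ), h (x₀ + z • ξ) ≠ 0 := by
    let D : Set ℂ := (fun z : ℂ => x₀ + z • ξ) ⁻¹' Metric.ball x₀ r
    have hDc : Convex ℝ D := by
      intro a ha b hb s t hs ht hst
      have := convex_ball x₀ r ha hb hs ht hst
      change x₀ + (s • a + t • b) • ξ ∈ Metric.ball x₀ r
      convert this using 1
      have h2 : x₀ = s • x₀ + t • x₀ := by rw [← add_smul, hst, one_smul]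
      simp only [smul_add, add_smul, smul_assoc]
      nth_rewrite 1 [h2]
      abel
    have hφ : AnalyticOnNhd ℂ (fun z : ℂ => h (x₀ + z • ξ)) D := fun z hz =>
      (hh.2.1 _ (hball hz)).comp (f := fun z : ℂ => x₀ + z • ξ)
        (analyticAt_const.add (analyticAt_id.smul analyticAt_const))
    have h0D : (0 : ℂ) ∈ D := by simp [D, hr]
    have h1D : (1 : ℂ) ∈ D := by simpa [D, ξ] using hx₁b
    rcases (hφ 0 h0D).eventually_eq_zero_or_eventually_ne_zero with h1 | h1
    · exact absurd (hφ.eqOn_zero_of_preconnected_of_eventuallyEq_zero hDc.isPreconnected h0D h1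
        h1D) (by simpa [ξ] using hx₁)
    · exact h1
  have hnice : ∀ᶠ z in 𝓝 (0 : ℂ), x₀ + z • ξ ∈ Metric.ball x₀ r ∧ h₀ (x₀ + z • ξ) ≠ 0 := by
    have hc : ContinuousAt (fun z : ℂ => x₀ + z • ξ) 0 := by fun_prop
    refine hc.eventually (p := fun y => y ∈ Metric.ball x₀ r ∧ h₀ y ≠ 0) ?_
    simp only [zero_smul, add_zero]
    exact (Metric.isOpen_ball.eventually_mem (Metric.mem_ball_self hr)).and
      ((hh₀ x₀ (Set.mem_univ _)).continuousAt.eventually_ne hx₀)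
  obtain ⟨ρ, hρ, hρball⟩ := Metric.nhds_basis_closedBall.mem_iff.1
    (hnice.and (eventually_nhdsWithin_iff.1 hpunct))
  have hsph : ∀ z ∈ Metric.sphere (0 : ℂ) ρ, h (x₀ + z • ξ) ≠ 0 := by
    intro z hz
    refine (hρball (Metric.sphere_subset_closedBall hz)).2 fun hz0 => ?_
    rw [Set.mem_singleton_iff.1 hz0] at hz
    simp at hz
    exact hρ.ne hz
  have hev1 : ∀ᶠ x in 𝓝 x₀, ∀ z ∈ Metric.closedBall (0 : ℂ) ρ,
      L (x, z) ∈ Metric.ball x₀ r ∧ h₀ (L (x, z)) ≠ 0 := by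
    refine (isCompact_closedBall (0 : ℂ) ρ).eventually_forall_of_forall_eventually fun z hz => ?_
    refine (hL.continuousAt (x := (x₀, z))).eventually
      (p := fun y => y ∈ Metric.ball x₀ r ∧ h₀ y ≠ 0) ?_
    exact (Metric.isOpen_ball.eventually_mem (hρball hz).1.1).and
      ((hh₀ _ (Set.mem_univ _)).continuousAt.eventually_ne (hρball hz).1.2)
  have hev2 : ∀ᶠ x in 𝓝 x₀, ∀ z ∈ Metric.sphere (0 : ℂ) ρ, h (L (x, z)) ≠ 0 := by
    refine (isCompact_sphere (0 : ℂ) ρ).eventually_forall_of_forall_eventually fun z hz => ?_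
    refine (hL.continuousAt (x := (x₀, z))).eventually (p := fun y => h y ≠ 0) ?_
    have hzb := (hρball (Metric.sphere_subset_closedBall hz)).1.1
    exact (hh.2.1 _ (hball hzb)).continuousAt.eventually_ne (hsph z hz)
  obtain ⟨N', hN', hN'o, hx₀N'⟩ := eventually_nhds_iff.1
    ((hev1.and hev2).and (Metric.isOpen_ball.eventually_mem (Metric.mem_ball_self hr)))
  let Gt : X → Y → ℂ := fun x P => (2 * Real.pi * Complex.I : ℂ)⁻¹ *
    ∮ z in C(0, ρ), (z - 0)⁻¹ * (G (L (x, z)) P / h (L (x, z)))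
  have hquot : AnalyticOnNhd ℂ (fun q : X × Y => G q.1 q.2 / h q.1)
      ((N ∩ {x | h x ≠ 0}) ×ˢ U) := hG.uncurry_div hh.2.1
  have hsphmem : ∀ x ∈ N', ∀ z ∈ Metric.sphere (0 : ℂ) ρ, L (x, z) ∈ N ∩ {x | h x ≠ 0} :=
    fun x hx z hz => ⟨hball ((hN' x hx).1.1 z (Metric.sphere_subset_closedBall hz)).1,
      (hN' x hx).1.2 z hz⟩
  have hGt : AnalyticOnNhd ℂ (Function.uncurry Gt) (N' ×ˢ U) := by
    have h1 := (analyticOnNhd_circleIntegral (E := X × Y) (U := N' ×ˢ U) (hN'o.prod hU)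
      (f := fun q z => (z - 0)⁻¹ * (G (L (q.1, z)) q.2 / h (L (q.1, z)))) (c := 0) hρ.le ?_ ?_).1
    · exact fun q hq => analyticAt_const.mul (h1 q hq)
    · refine ContinuousOn.mul (ContinuousOn.inv₀ (by fun_prop) ?_) ?_
      · rintro ⟨q, z⟩ ⟨-, hz⟩ h0
        simp only [sub_zero] at h0
        subst h0
        simp at hz
        exact hρ.ne hz
      · exact hquot.continuousOn.comp (f := fun p : (X × Y) × ℂ => (L (p.1.1, p.2), p.1.2))
          (Continuous.continuousOn (by fun_prop)) fun p hp => ⟨hsphmem _ hp.1.1 _ hp.2, hp.1.2⟩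
    · intro z hz
      refine DifferentiableOn.const_mul ?_ _
      exact hquot.differentiableOn.comp (f := fun q : X × Y => (L (q.1, z), q.2))
        (Differentiable.differentiableOn (by fun_prop)) fun q hq => ⟨hsphmem _ hq.1 _ hz, hq.2⟩
  have hGtW : ∀ x ∈ N', ∀ P ∈ W, Gt x P = G₀ x P / h₀ x := by
    intro x hx P hP
    have h1 : ∀ z ∈ Metric.sphere (0 : ℂ) ρ, (z - 0)⁻¹ * (G (L (x, z)) P / h (L (x, z))) =
        (z - 0)⁻¹ • (G₀ (L (x, z)) P / h₀ (L (x, z))) := by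
      intro z hz
      obtain ⟨hb, hne₀⟩ := (hN' x hx).1.1 z (Metric.sphere_subset_closedBall hz)
      have hne := (hN' x hx).1.2 z hz
      have h2 := hJ₀ _ (hreg _ hb hne) P hP
      rw [← hJG _ (hball hb) hne P (hWU hP), ← h2, smul_eq_mul]
      field_simp
    have hd : DifferentiableOn ℂ (fun z => G₀ (L (x, z)) P / h₀ (L (x, z)))
        (Metric.closedBall 0 ρ) := by
      intro z hz
      have hLz : DifferentiableAt ℂ (fun z => L (x, z)) z := by fun_prop
      have h3 : DifferentiableAt ℂ (fun z => G₀ (L (x, z)) P) z :=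
        DifferentiableAt.comp (g := fun y => G₀ y P) z
          (hG₀ P hP _ (Set.mem_univ _)).differentiableAt hLz
      have h4 : DifferentiableAt ℂ (fun z => h₀ (L (x, z))) z :=
        DifferentiableAt.comp (g := h₀) z (hh₀ _ (Set.mem_univ _)).differentiableAt hLz
      exact (h3.div h4 ((hN' x hx).1.1 z hz).2).differentiableWithinAt
    have h2 := (DifferentiableOn.diffContOnCl
      (hd.mono Metric.closure_ball_subset_closedBall)).circleIntegral_sub_inv_smul
      (Metric.mem_ball_self hρ)
    simp only [Gt]
    rw [circleIntegral.integral_congr hρ.le h1, h2, smul_eq_mul,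
      inv_mul_cancel_left₀ Complex.two_pi_I_ne_zero]
    simp [L]
  refine hJ.2 x₀ ⟨N', h, Gt, hh.mono (hN'o.mem_nhds hx₀N') fun x hx => hball (hN' x hx).2, hGt, ?_⟩
  intro x hx hne P hP
  have hxreg := hreg x (hN' x hx).2 hne
  obtain ⟨P₁, hP₁⟩ := hWne
  refine hxreg.analyticOnNhd_right.eqOn_of_preconnected_of_eventuallyEq (𝕜 := ℂ)
    (g := fun P => Gt x P) (fun Q hQ => ?_) hUc (hWU hP₁) ?_ hP
  · exact (hGt (x, Q) ⟨hx, hQ⟩).comp (f := fun Q => (x, Q)) (analyticAt_const.prod analyticAt_id)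
  · filter_upwards [hW.mem_nhds hP₁] with Q hQ
    have h0x : h₀ x ≠ 0 := by
      simpa [L] using ((hN' x hx).1.1 0 (Metric.mem_closedBall_self hρ.le)).2
    rw [hGtW x hx Q hQ, ← hJ₀ x hxreg Q hQ]
    field_simp

end MeromorphicFamilies

/-! ### Laurent coefficients as circle integrals -/

theorem HasLaurentExpansion.mono {f : ℂ → ℂ} {N N' : ℤ} {a : ℤ → ℂ}
    (h : HasLaurentExpansion f N a) (hN : N' ≤ N) : HasLaurentExpansion f N' a :=
  ⟨fun i hi => h.1 i (hi.trans_le hN), h.2⟩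

/-- The coefficients of a Laurent expansion are given by integrals over every circle in the
punctured disc of holomorphy, whatever the domain of convergence is known to be. -/
theorem HasLaurentExpansion.coeff_eq_circleIntegral {f : ℂ → ℂ} {N : ℤ} {a : ℤ → ℂ}
    (h : HasLaurentExpansion f N a) {ρ r : ℝ} (hr : 0 < r) (hrρ : r < ρ)
    (hf : DifferentiableOn ℂ f (Metric.ball 0 ρ \ {0})) (i : ℤ) :
    a i = (2 * Real.pi * Complex.I : ℂ)⁻¹ * ∮ ζ in C(0, r), ζ ^ (-i - 1) * f ζ := by
  wlog hi : N ≤ i generalizing N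
  · exact this (h.mono (le_of_not_ge hi)) le_rfl
  obtain ⟨n, rfl⟩ : ∃ n : ℕ, i = N + n := ⟨(i - N).toNat, by omega⟩
  let b : ℕ → ℂ := fun j => a (N + j)
  let g : ℂ → ℂ := Function.update (fun ε => ε ^ (-N) * f ε) 0 (b 0)
  have hg0 : ∀ ε, ε ≠ 0 → g ε = ε ^ (-N) * f ε := fun ε hε => Function.update_of_ne hε _ _
  have hsum : ∀ᶠ ε in 𝓝 (0 : ℂ), HasSum (fun j : ℕ => ε ^ j • b j) (g ε) := by
    filter_upwards [eventually_nhdsWithin_iff.1 h.2] with ε hε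
    by_cases hε0 : ε = 0
    · subst hε0
      have : g 0 = b 0 := Function.update_self _ _ _
      rw [this]
      exact HasSum.hasSum_at_zero b
    · have h1 := hε hε0
      have hinj : Function.Injective (fun j : ℕ => N + (j : ℤ)) := fun j j' hjj => by
        simpa using hjj
      have h2 : HasSum (fun j : ℕ => a (N + j) * ε ^ (N + (j : ℤ))) (f ε) := by
        refine (hinj.hasSum_iff ?_).2 h1
        intro m hm
        rw [h.1 m, zero_mul]
        by_contra hlt
        exact hm ⟨(m - N).toNat, by simp only; omega⟩
      have h3 := h2.mul_left (ε ^ (-N))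
      rw [hg0 ε hε0]
      refine h3.congr_fun fun j => ?_
      rw [zpow_add₀ hε0, zpow_neg, zpow_natCast, smul_eq_mul]
      have := zpow_ne_zero N hε0
      simp only [b]
      field_simp
  have hp : HasFPowerSeriesAt g (FormalMultilinearSeries.ofScalars ℂ b) 0 := by
    rw [hasFPowerSeriesAt_iff]
    simpa [FormalMultilinearSeries.coeff_ofScalars] using hsum
  have hgd : DifferentiableOn ℂ g (Metric.closedBall 0 r) := by
    intro z hz
    by_cases hz0 : z = 0
    · rw [hz0]
      exact hp.differentiableAt.differentiableWithinAt
    · have hzρ : z ∈ Metric.ball (0 : ℂ) ρ := Metric.closedBall_subset_ball hrρ hz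
      have h1 : DifferentiableAt ℂ f z := hf.differentiableAt
        ((Metric.isOpen_ball.sdiff isClosed_singleton).mem_nhds ⟨hzρ, hz0⟩)
      have h2 : DifferentiableAt ℂ (fun ε : ℂ => ε ^ (-N) * f ε) z :=
        (differentiableAt_zpow.2 (Or.inl hz0)).mul h1
      refine (h2.congr_of_eventuallyEq ?_).differentiableWithinAt
      filter_upwards [isOpen_ne.mem_nhds hz0] with ε hε using hg0 ε hε
  lift r to NNReal using hr.le
  have hq := (hgd.hasFPowerSeriesOnBall (by exact_mod_cast hr)).hasFPowerSeriesAt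
  have heq := hp.eq_formalMultilinearSeries hq
  have h4 := congrArg (fun p : FormalMultilinearSeries ℂ ℂ ℂ => p n fun _ => 1) heq
  simp only [cauchyPowerSeries_apply, FormalMultilinearSeries.ofScalars_apply_eq] at h4
  simp only [one_pow, smul_eq_mul, mul_one] at h4
  change b n = _
  rw [h4]
  congr 1
  refine circleIntegral.integral_congr hr.le fun ζ hζ => ?_
  have hζ0 : ζ ≠ 0 := by
    rintro rfl
    simp at hζ
    exact hr.ne' (by exact_mod_cast hζ.symm)
  rw [hg0 ζ hζ0, show -(N + (n : ℤ)) - 1 = -N + (-(n : ℤ) + -1) by ring, zpow_add₀ hζ0,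
    zpow_add₀ hζ0, zpow_neg ζ (n : ℤ), zpow_natCast, zpow_neg_one]
  simp only [sub_zero, one_div, inv_pow]
  ring

/-! ### The GKZ operators on analytic families -/

section GKZOperators

variable {A : Type*} [Fintype A] {U : Set (A → ℂ)}

theorem partialDeriv_congr {A : Type*} {U : Set (A → ℂ)} (hU : IsOpen U) {f g : (A → ℂ) → ℂ}
    (hfg : Set.EqOn f g U) (a : A) : Set.EqOn (partialDeriv a f) (partialDeriv a g) U := fun P hP => by
  simp only [partialDeriv]
  rw [Filter.EventuallyEq.fderiv_eq (hfg.eventuallyEq_of_mem (hU.mem_nhds hP))]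

theorem partialDeriv_const_mul (c : ℂ) (f : (A → ℂ) → ℂ) (a : A) :
    partialDeriv a (fun P => c * f P) = fun P => c * partialDeriv a f P := by
  ext P
  have h := congrFun (fderiv_const_smul_field (𝕜 := ℂ) (f := f) c) P
  simp only [partialDeriv]
  have h2 : (c • f) = fun P => c * f P := rfl
  rw [h2] at h
  rw [h]
  rfl

theorem iterate_partialDeriv_congr {A : Type*} {U : Set (A → ℂ)} (hU : IsOpen U) {f g : (A → ℂ) → ℂ}
    (hfg : Set.EqOn f g U) (a : A) (j : ℕ) :
    Set.EqOn ((partialDeriv a)^[j] f) ((partialDeriv a)^[j] g) U := by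
  induction j with
  | zero => exact hfg
  | succ j ih =>
    rw [Function.iterate_succ', Function.comp_apply, Function.comp_apply]
    exact partialDeriv_congr hU ih a

theorem monomialDeriv_congr (hU : IsOpen U) {f g : (A → ℂ) → ℂ} (hfg : Set.EqOn f g U)
    (ν : A → ℕ) : Set.EqOn (monomialDeriv ν f) (monomialDeriv ν g) U := by
  unfold monomialDeriv
  induction (Finset.univ : Finset A).toList with
  | nil => exact hfg
  | cons a l ih =>
    simp only [List.foldr_cons]
    exact iterate_partialDeriv_congr hU ih a _

theorem monomialDeriv_const_mul (c : ℂ) (f : (A → ℂ) → ℂ) (ν : A → ℕ) :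
    monomialDeriv ν (fun P => c * f P) = fun P => c * monomialDeriv ν f P := by
  have hit : ∀ (a : A) (j : ℕ) (g : (A → ℂ) → ℂ), (partialDeriv a)^[j] (fun P => c * g P) =
      fun P => c * (partialDeriv a)^[j] g P := by
    intro a j g
    induction j with
    | zero => rfl
    | succ j ih =>
      rw [Function.iterate_succ', Function.comp_apply, ih, partialDeriv_const_mul]
      rfl
  unfold monomialDeriv
  induction (Finset.univ : Finset A).toList with
  | nil => rfl
  | cons a l ih =>
    simp only [List.foldr_cons]
    rw [ih, hit]

variable {E : Type*} [NormedAddCommGroup E] [NormedSpace ℂ E] {N : Set E}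

theorem AnalyticOnNhd.uncurry_partialDeriv {f : E → (A → ℂ) → ℂ}
    (hf : AnalyticOnNhd ℂ (Function.uncurry f) (N ×ˢ U)) (a : A) :
    AnalyticOnNhd ℂ (Function.uncurry fun x => partialDeriv a (f x)) (N ×ˢ U) := by
  classical
  rintro ⟨x, P⟩ hxP
  have h1 : AnalyticAt ℂ (fun q : E × (A → ℂ) =>
      fderiv ℂ (Function.uncurry f) q (0, Pi.single a 1)) (x, P) :=
    ((ContinuousLinearMap.apply ℂ ℂ ((0, Pi.single a 1) : E × (A → ℂ))).analyticAt _).comp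
      (f := fderiv ℂ (Function.uncurry f)) (hf (x, P) hxP).fderiv
  refine h1.congr ?_
  filter_upwards [(hf (x, P) hxP).eventually_analyticAt] with q hq
  have h2 : HasFDerivAt (fun P => f q.1 P)
      ((fderiv ℂ (Function.uncurry f) q).comp (ContinuousLinearMap.inr ℂ E (A → ℂ))) q.2 :=
    HasFDerivAt.comp (g := Function.uncurry f) (f := fun P => (q.1, P)) q.2
      hq.differentiableAt.hasFDerivAt (hasFDerivAt_prodMk_right q.1 q.2)
  simp only [Function.uncurry_def, partialDeriv]
  rw [h2.fderiv]
  simp only [ContinuousLinearMap.comp_apply, ContinuousLinearMap.inr_apply]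
  congr! 3

theorem AnalyticOnNhd.uncurry_iterate_partialDeriv {f : E → (A → ℂ) → ℂ}
    (hf : AnalyticOnNhd ℂ (Function.uncurry f) (N ×ˢ U)) (a : A) (j : ℕ) :
    AnalyticOnNhd ℂ (Function.uncurry fun x => (partialDeriv a)^[j] (f x)) (N ×ˢ U) := by
  induction j with
  | zero => exact hf
  | succ j ih =>
    simp only [Function.iterate_succ', Function.comp_apply]
    exact ih.uncurry_partialDeriv a

theorem AnalyticOnNhd.uncurry_monomialDeriv {f : E → (A → ℂ) → ℂ}
    (hf : AnalyticOnNhd ℂ (Function.uncurry f) (N ×ˢ U)) (ν : A → ℕ) :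
    AnalyticOnNhd ℂ (Function.uncurry fun x => monomialDeriv ν (f x)) (N ×ˢ U) := by
  unfold monomialDeriv
  induction (Finset.univ : Finset A).toList with
  | nil => exact hf
  | cons a l ih =>
    simp only [List.foldr_cons]
    exact ih.uncurry_iterate_partialDeriv a _

theorem AnalyticOnNhd.uncurry_boxOp {f : E → (A → ℂ) → ℂ}
    (hf : AnalyticOnNhd ℂ (Function.uncurry f) (N ×ˢ U)) (r : A → ℤ) :
    AnalyticOnNhd ℂ (Function.uncurry fun x => boxOp r (f x)) (N ×ˢ U) :=
  (hf.uncurry_monomialDeriv _).sub (hf.uncurry_monomialDeriv _)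

theorem AnalyticOnNhd.uncurry_eulerOp {f : E → (A → ℂ) → ℂ}
    (hf : AnalyticOnNhd ℂ (Function.uncurry f) (N ×ˢ U)) (μ : A → ℤ) :
    AnalyticOnNhd ℂ (Function.uncurry fun x => eulerOp μ (f x)) (N ×ˢ U) := by
  intro q hq
  refine Finset.analyticAt_fun_sum _ fun a _ => ?_
  refine AnalyticAt.mul ?_ (hf.uncurry_partialDeriv a q hq)
  exact analyticAt_const.mul
    (((ContinuousLinearMap.proj a).comp (ContinuousLinearMap.snd ℂ E (A → ℂ))).analyticAt q)

theorem boxOp_congr (hU : IsOpen U) {f g : (A → ℂ) → ℂ} (hfg : Set.EqOn f g U) (r : A → ℤ) :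
    Set.EqOn (boxOp r f) (boxOp r g) U := fun P hP => by
  simp only [boxOp, monomialDeriv_congr hU hfg _ hP]

theorem eulerOp_congr (hU : IsOpen U) {f g : (A → ℂ) → ℂ} (hfg : Set.EqOn f g U) (μ : A → ℤ) :
    Set.EqOn (eulerOp μ f) (eulerOp μ g) U := fun P hP => by
  simp only [eulerOp, partialDeriv_congr hU hfg _ hP]

theorem boxOp_const_mul (c : ℂ) (f : (A → ℂ) → ℂ) (r : A → ℤ) :
    boxOp r (fun P => c * f P) = fun P => c * boxOp r f P := by
  ext P
  simp only [boxOp, monomialDeriv_const_mul]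
  ring

theorem eulerOp_const_mul (c : ℂ) (f : (A → ℂ) → ℂ) (μ : A → ℤ) :
    eulerOp μ (fun P => c * f P) = fun P => c * eulerOp μ f P := by
  ext P
  simp only [eulerOp, partialDeriv_const_mul, Finset.mul_sum]
  exact Finset.sum_congr rfl fun a _ => by ring

open Metric in
theorem partialDeriv_circleIntegral (hU : IsOpen U) {f : ℂ → (A → ℂ) → ℂ} {T : Set ℂ} {c : ℂ}
    {R : ℝ} (hR : 0 ≤ R) (hT : sphere c R ⊆ T)
    (hf : AnalyticOnNhd ℂ (Function.uncurry f) (T ×ˢ U)) (a : A) :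
    Set.EqOn (partialDeriv a fun P => ∮ ζ in C(c, R), f ζ P)
      (fun P => ∮ ζ in C(c, R), partialDeriv a (f ζ) P) U := by
  have h := analyticOnNhd_circleIntegral hU (f := fun P ζ => f ζ P) (c := c) hR ?_ ?_
  · intro P hP
    exact h.2 P hP _
  · exact hf.continuousOn.comp (f := fun p : (A → ℂ) × ℂ => (p.2, p.1))
      (Continuous.continuousOn (by fun_prop)) fun p hp => ⟨hT hp.2, hp.1⟩
  · intro ζ hζ P hP
    exact ((hf (ζ, P) ⟨hT hζ, hP⟩).comp (f := fun P => (ζ, P))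
      (analyticAt_const.prod analyticAt_id)).differentiableAt.differentiableWithinAt

open Metric in
theorem monomialDeriv_circleIntegral (hU : IsOpen U) {f : ℂ → (A → ℂ) → ℂ} {T : Set ℂ} {c : ℂ}
    {R : ℝ} (hR : 0 ≤ R) (hT : sphere c R ⊆ T)
    (hf : AnalyticOnNhd ℂ (Function.uncurry f) (T ×ˢ U)) (ν : A → ℕ) :
    Set.EqOn (monomialDeriv ν fun P => ∮ ζ in C(c, R), f ζ P)
      (fun P => ∮ ζ in C(c, R), monomialDeriv ν (f ζ) P) U := by
  have hit : ∀ (a : A) (j : ℕ) (g : ℂ → (A → ℂ) → ℂ),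
      AnalyticOnNhd ℂ (Function.uncurry g) (T ×ˢ U) →
      Set.EqOn ((partialDeriv a)^[j] fun P => ∮ ζ in C(c, R), g ζ P)
        (fun P => ∮ ζ in C(c, R), (partialDeriv a)^[j] (g ζ) P) U := by
    intro a j g hg
    induction j with
    | zero => exact fun P _ => rfl
    | succ j ih =>
      simp only [Function.iterate_succ', Function.comp_apply]
      exact (partialDeriv_congr hU ih a).trans
        (partialDeriv_circleIntegral hU hR hT (hg.uncurry_iterate_partialDeriv a j) a)
  unfold monomialDeriv
  have key : ∀ l : List A, AnalyticOnNhd ℂ (Function.uncurry fun ζ =>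
      l.foldr (fun a g => (partialDeriv a)^[ν a] g) (f ζ)) (T ×ˢ U) ∧
      Set.EqOn (l.foldr (fun a g => (partialDeriv a)^[ν a] g) fun P => ∮ ζ in C(c, R), f ζ P)
      (fun P => ∮ ζ in C(c, R), l.foldr (fun a g => (partialDeriv a)^[ν a] g) (f ζ) P) U := by
    intro l
    induction l with
    | nil => exact ⟨hf, fun P _ => rfl⟩
    | cons a l ih =>
      simp only [List.foldr_cons]
      exact ⟨ih.1.uncurry_iterate_partialDeriv a _,
        (iterate_partialDeriv_congr hU ih.2 a _).trans (hit a _ _ ih.1)⟩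
  exact (key _).2

open Metric in
/-- The Laurent coefficients of an analytic family are analytic, and they are annihilated, or
multiplied, by the GKZ operators in the same way as the family is.  An affine factor
`κ₀ + ε κ₁` shifts the coefficients. -/
theorem laurentCoeff_of_family (hU : IsOpen U) {f : ℂ → (A → ℂ) → ℂ} {ρ : ℝ} (hρ : 0 < ρ)
    (hf : AnalyticOnNhd ℂ (Function.uncurry f) ((ball 0 ρ \ {0}) ×ˢ U)) {N : ℤ}
    {coeff : ℤ → (A → ℂ) → ℂ}
    (hL : ∀ P ∈ U, HasLaurentExpansion (fun ε => f ε P) N fun i => coeff i P) (i : ℤ) :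
    AnalyticOnNhd ℂ (coeff i) U ∧
    (∀ r : A → ℤ, (∀ ε ∈ ball (0 : ℂ) ρ \ {0}, ∀ P ∈ U, boxOp r (f ε) P = 0) →
      ∀ P ∈ U, boxOp r (coeff i) P = 0) ∧
    ∀ (μ : A → ℤ) (κ₀ κ₁ : ℂ), (∀ ε ∈ ball (0 : ℂ) ρ \ {0}, ∀ P ∈ U,
        eulerOp μ (f ε) P = (κ₀ + ε * κ₁) * f ε P) →
      ∀ P ∈ U, eulerOp μ (coeff i) P = κ₀ * coeff i P + κ₁ * coeff (i - 1) P := by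
  have hr : 0 < ρ / 2 := by positivity
  have hT : sphere (0 : ℂ) (ρ / 2) ⊆ ball 0 ρ \ {0} := by
    intro ζ hζ
    refine ⟨?_, ?_⟩
    · have := mem_sphere.1 hζ
      rw [mem_ball]
      linarith
    · rintro rfl
      simp at hζ
      exact hr.ne hζ
  let C : ℂ := (2 * Real.pi * Complex.I : ℂ)⁻¹
  let g : ℤ → ℂ → (A → ℂ) → ℂ := fun i ζ P => ζ ^ (-i - 1) * f ζ P
  have hg : ∀ i, AnalyticOnNhd ℂ (Function.uncurry (g i)) ((ball 0 ρ \ {0}) ×ˢ U) := by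
    rintro i ⟨ζ, P⟩ hq
    refine AnalyticAt.mul (f := fun q : ℂ × (A → ℂ) => q.1 ^ (-i - 1)) ?_ (hf _ hq)
    have h1 : AnalyticAt ℂ (fun z : ℂ => z ^ (-i - 1)) ζ :=
      AnalyticAt.fun_zpow analyticAt_id (show ζ ≠ 0 from hq.1.2)
    exact h1.comp (f := fun q : ℂ × (A → ℂ) => q.1) (x := (ζ, P)) analyticAt_fst
  have hcoeff : ∀ i, Set.EqOn (coeff i) (fun P => C * ∮ ζ in C(0, ρ / 2), g i ζ P) U := by
    intro i P hP
    refine (hL P hP).coeff_eq_circleIntegral hr (by linarith : ρ / 2 < ρ) ?_ i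
    intro ζ hζ
    exact ((hf (ζ, P) ⟨hζ, hP⟩).comp (f := fun ζ => (ζ, P))
      (analyticAt_id.prod analyticAt_const)).differentiableAt.differentiableWithinAt
  have hgc : ∀ i, AnalyticOnNhd ℂ (fun P => ∮ ζ in C(0, ρ / 2), g i ζ P) U := by
    intro i
    refine (analyticOnNhd_circleIntegral hU (f := fun P ζ => g i ζ P) hr.le ?_ ?_).1
    · exact (hg i).continuousOn.comp (f := fun p : (A → ℂ) × ℂ => (p.2, p.1))
        (Continuous.continuousOn (by fun_prop)) fun p hp => ⟨hT hp.2, hp.1⟩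
    · intro ζ hζ P hP
      exact ((hg i (ζ, P) ⟨hT hζ, hP⟩).comp (f := fun P => (ζ, P))
        (analyticAt_const.prod analyticAt_id)).differentiableAt.differentiableWithinAt
  have hci : ∀ (F : ℂ → (A → ℂ) → ℂ), AnalyticOnNhd ℂ (Function.uncurry F)
      ((ball 0 ρ \ {0}) ×ˢ U) → ∀ P ∈ U, CircleIntegrable (fun ζ => F ζ P) 0 (ρ / 2) := by
    intro F hF P hP
    refine ContinuousOn.circleIntegrable hr.le ?_
    exact hF.continuousOn.comp (f := fun ζ => (ζ, P)) (Continuous.continuousOn (by fun_prop))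
      fun ζ hζ => ⟨hT hζ, hP⟩
  refine ⟨?_, ?_, ?_⟩
  · refine AnalyticOnNhd.congr hU (f := fun P => C * ∮ ζ in C(0, ρ / 2), g i ζ P)
      (fun P hP => analyticAt_const.mul (hgc i P hP)) (hcoeff i).symm
  · intro r hbox P hP
    rw [boxOp_congr hU (hcoeff i) r hP, boxOp_const_mul]
    simp only [boxOp]
    rw [monomialDeriv_circleIntegral hU hr.le hT (hg i) _ hP,
      monomialDeriv_circleIntegral hU hr.le hT (hg i) _ hP,
      ← circleIntegral.integral_sub (hci _ ((hg i).uncurry_monomialDeriv _) P hP)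
        (hci _ ((hg i).uncurry_monomialDeriv _) P hP)]
    rw [circleIntegral.integral_congr (g := fun _ => (0 : ℂ)) hr.le, circleIntegral]
    · simp
    · intro ζ hζ
      have h1 : boxOp r (g i ζ) P = 0 := by
        simp only [g]
        rw [boxOp_const_mul]
        simp only
        rw [hbox ζ (hT hζ) P hP, mul_zero]
      exact h1
  · intro μ κ₀ κ₁ hμ P hP
    rw [eulerOp_congr hU (hcoeff i) μ hP, eulerOp_const_mul, hcoeff i hP, hcoeff (i - 1) hP]
    simp only [eulerOp]
    have h1 : ∀ a, (μ a : ℂ) * P a * partialDeriv a (fun P => ∮ ζ in C(0, ρ / 2), g i ζ P) P =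
        ∮ ζ in C(0, ρ / 2), (μ a : ℂ) * P a * partialDeriv a (g i ζ) P := by
      intro a
      rw [partialDeriv_circleIntegral hU hr.le hT (hg i) a hP, circleIntegral.integral_const_mul]
    have h2 : ∑ a, (∮ ζ in C(0, ρ / 2), (μ a : ℂ) * P a * partialDeriv a (g i ζ) P) =
        ∮ ζ in C(0, ρ / 2), ∑ a, (μ a : ℂ) * P a * partialDeriv a (g i ζ) P := by
      rw [circleIntegral.integral_fun_sum]
      intro a _
      exact (hci _ ((hg i).uncurry_partialDeriv a) P hP).const_fun_smul (a := (μ a : ℂ) * P a)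
    rw [Finset.sum_congr rfl fun a _ => h1 a, h2]
    have h3 : (∮ ζ in C(0, ρ / 2), ∑ a, (μ a : ℂ) * P a * partialDeriv a (g i ζ) P) =
        ∮ ζ in C(0, ρ / 2), (κ₀ * g i ζ P + κ₁ * g (i - 1) ζ P) := by
      refine circleIntegral.integral_congr hr.le fun ζ hζ => ?_
      have h4 : eulerOp μ (g i ζ) P = κ₀ * g i ζ P + κ₁ * g (i - 1) ζ P := by
        simp only [g]
        rw [eulerOp_const_mul]
        simp only
        rw [hμ ζ (hT hζ) P hP,
          show -(i - 1) - 1 = (-i - 1) + 1 by ring, zpow_add₀ (hT hζ).2, zpow_one]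
        ring
      exact h4
    have h5 := circleIntegral.integral_add ((hci _ (hg i) P hP).const_fun_smul (a := κ₀))
      ((hci _ (hg (i - 1)) P hP).const_fun_smul (a := κ₁))
    simp only [smul_eq_mul] at h5
    rw [h3, h5, circleIntegral.integral_const_mul,
      circleIntegral.integral_const_mul]
    ring

end GKZOperators

/-! ### The simplex -/

section Simplex

open MeasureTheory FeynmanGraph

variable {k : ℕ}

/-- The interior of the standard simplex, in the coordinates used by `simplexPoint`. -/
def openSimplex (k : ℕ) : Set (Fin k → ℝ) := {s | ∀ e, 0 < simplexPoint s e}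

theorem sum_simplexPoint (s : Fin k → ℝ) : ∑ e, simplexPoint s e = 1 := by
  simp [simplexPoint, Fin.sum_univ_succ]

theorem continuous_simplexPoint : Continuous (simplexPoint : (Fin k → ℝ) → _) := by
  unfold simplexPoint
  fun_prop

theorem isOpen_openSimplex : IsOpen (openSimplex k) := by
  have : openSimplex k = ⋂ e, {s | 0 < simplexPoint s e} := by
    ext s
    simp [openSimplex]
  rw [this]
  exact isOpen_iInter_of_finite fun e =>
    isOpen_lt continuous_const ((continuous_apply e).comp continuous_simplexPoint)

theorem simplexPoint_le_one {s : Fin k → ℝ} (hs : s ∈ openSimplex k) (e : Fin (k + 1)) :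
    simplexPoint s e ≤ 1 := by
  rw [← sum_simplexPoint s]
  exact Finset.single_le_sum (fun i _ => (hs i).le) (Finset.mem_univ e)

/-- The affine involution which exchanges the barycentric coordinates number `0` and `j + 1`. -/
def simplexSwap (j : Fin k) (s : Fin k → ℝ) : Fin k → ℝ := Function.update s j (1 - ∑ i, s i)

theorem sum_simplexSwap (j : Fin k) (s : Fin k → ℝ) : ∑ i, simplexSwap j s i = 1 - s j := by
  rw [simplexSwap, Finset.sum_update_of_mem (Finset.mem_univ j),
    ← Finset.add_sum_erase Finset.univ s (Finset.mem_univ j), Finset.sdiff_singleton_eq_erase]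
  ring

theorem simplexPoint_simplexSwap (j : Fin k) (s : Fin k → ℝ) (e : Fin (k + 1)) :
    simplexPoint (simplexSwap j s) e = simplexPoint s (Equiv.swap 0 j.succ e) := by
  refine Fin.cases ?_ (fun i => ?_) e
  · simp [simplexPoint, sum_simplexSwap]
  · by_cases hi : i = j
    · subst hi
      simp [simplexPoint, simplexSwap]
    · rw [Equiv.swap_apply_of_ne_of_ne (Fin.succ_ne_zero i) (by simpa using hi)]
      simp [simplexPoint, simplexSwap, hi]

theorem measurePreserving_simplexSwap (j : Fin k) :
    MeasurePreserving (simplexSwap j) volume volume := by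
  let B : (Fin k → ℝ) →ₗ[ℝ] (Fin k → ℝ) :=
    { toFun := fun s => Function.update s j (-∑ i, s i)
      map_add' := fun s t => by
        ext i
        by_cases hi : i = j
        · subst hi
          simp [Finset.sum_add_distrib]
          ring
        · simp [hi]
      map_smul' := fun a s => by
        ext i
        by_cases hi : i = j
        · subst hi
          simp [Finset.mul_sum]
        · simp [hi] }
  have hB : ∀ s, simplexSwap j s = B s + Pi.single j 1 := by
    intro s
    ext i
    by_cases hi : i = j
    · subst hi
      simp [simplexSwap, B]
      ring
    · simp [simplexSwap, B, hi]
  have hBB : B * B = 1 := by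
    ext1 s
    have h1 : ∀ s, B s = simplexSwap j s - Pi.single j 1 := fun s => by rw [hB]; simp
    ext i
    simp only [LinearMap.comp_apply, Module.End.mul_apply, Module.End.one_apply]
    by_cases hi : i = j
    · subst hi
      have h2 : B (B (LinearMap.single ℝ (fun _ => ℝ) s 1)) i =
          -∑ l, B (LinearMap.single ℝ (fun _ => ℝ) s 1) l := by simp [B]
      rw [h2]
      simp only [h1, Pi.sub_apply, Finset.sum_sub_distrib, sum_simplexSwap]
      simp
    · simp [B, hi]
  have hdet : LinearMap.det B * LinearMap.det B = 1 := by
    rw [← map_mul, hBB, map_one]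
  have habs : |(LinearMap.det B)⁻¹| = 1 := by
    rw [abs_inv, inv_eq_one]
    have h2 : |LinearMap.det B| * |LinearMap.det B| = 1 := by rw [← abs_mul, hdet, abs_one]
    nlinarith [abs_nonneg (LinearMap.det B)]
  have hB' : MeasurePreserving B volume volume := by
    refine ⟨(LinearMap.continuous_of_finiteDimensional B).measurable, ?_⟩
    rw [Real.map_linearMap_volume_pi_eq_smul_volume_pi (left_ne_zero_of_mul_eq_one hdet), habs]
    simp
  have h3 : simplexSwap j = (fun s => s + Pi.single j 1) ∘ B := funext hB
  rw [h3]
  exact (measurePreserving_add_right volume _).comp hB'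

theorem ae_simplexPoint_ne_zero :
    ∀ᵐ s : Fin k → ℝ, ∀ e, simplexPoint s e ≠ 0 := by
  have hsucc : ∀ j : Fin k, ∀ᵐ s : Fin k → ℝ, simplexPoint s j.succ ≠ 0 := by
    intro j
    have h := Measure.ae_eval_ne (μ := fun _ : Fin k => (volume : Measure ℝ)) j 0
    rw [← volume_pi] at h
    simpa [simplexPoint] using h
  rw [ae_all_iff]
  refine Fin.cases ?_ hsucc
  rcases isEmpty_or_nonempty (Fin k) with hk | ⟨⟨j⟩⟩
  · refine Eventually.of_forall fun s => ?_
    simp [simplexPoint]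
  · have h := (measurePreserving_simplexSwap j).quasiMeasurePreserving.ae (hsucc j)
    filter_upwards [h] with s hs
    simpa [simplexPoint_simplexSwap] using hs

theorem stdSimplex_ae_eq_openSimplex :
    ({s : Fin k → ℝ | simplexPoint s ∈ stdSimplex ℝ (Fin (k + 1))} : Set (Fin k → ℝ)) =ᵐ[volume]
      openSimplex k := by
  filter_upwards [ae_simplexPoint_ne_zero (k := k)] with s hs
  refine propext ⟨fun h e => lt_of_le_of_ne (h.1 e) (hs e).symm, fun h => ⟨fun e => (h e).le, ?_⟩⟩
  exact sum_simplexPoint s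

/-- Convergence of the Dirichlet integral.  At every point some coordinate is at least
`1 / (k + 1)`; the product of the powers of the other ones is integrable over the unit cube. -/
theorem integrableOn_prod_rpow {η : ℝ} (hη : 0 < η) :
    IntegrableOn (fun s : Fin k → ℝ => ∏ e, simplexPoint s e ^ (η - 1)) (openSimplex k) := by
  let f : ℝ → ℝ := Set.indicator (Set.Ioc 0 1) fun x => x ^ (η - 1)
  have hf : Integrable f := by
    rw [integrable_indicator_iff measurableSet_Ioc]
    have := intervalIntegral.intervalIntegrable_rpow' (a := 0) (b := 1) (r := η - 1) (by linarith)
    rwa [intervalIntegrable_iff_integrableOn_Ioc_of_le zero_le_one] at this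
  have hf0 : ∀ x, 0 ≤ f x := fun x => by
    refine Set.indicator_nonneg (fun x hx => ?_) x
    exact Real.rpow_nonneg hx.1.le _
  let g : (Fin k → ℝ) → ℝ := fun s => ∏ i, f (s i)
  have hg : Integrable g := Integrable.fintype_prod fun _ => hf
  have hg0 : ∀ s, 0 ≤ g s := fun s => Finset.prod_nonneg fun i _ => hf0 _
  have hgs : ∀ j, Integrable (g ∘ simplexSwap j) := fun j =>
    (measurePreserving_simplexSwap j).integrable_comp_of_integrable hg
  let C : ℝ := max 1 (((k : ℝ) + 1) ^ (1 - η))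
  have hmaj : Integrable (fun s => C * (g s + ∑ j, (g ∘ simplexSwap j) s)) :=
    (hg.add (integrable_finsetSum _ fun j _ => hgs j)).const_mul C
  have hval : ∀ s ∈ openSimplex k, ∀ e, f (simplexPoint s e) = simplexPoint s e ^ (η - 1) :=
    fun s hs e => Set.indicator_of_mem (show simplexPoint s e ∈ Set.Ioc 0 1 from
      ⟨hs e, simplexPoint_le_one hs e⟩) _
  refine hmaj.integrableOn.mono' ?_ ?_
  · refine Measurable.aestronglyMeasurable ?_
    refine Finset.measurable_fun_prod _ fun e _ => ?_
    exact ((continuous_apply e).comp continuous_simplexPoint).measurable.pow_const _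
  · refine (ae_restrict_iff' isOpen_openSimplex.measurableSet).2 (Eventually.of_forall fun s hs => ?_)
    rw [Real.norm_of_nonneg (Finset.prod_nonneg fun e _ => Real.rpow_nonneg (hs e).le _)]
    obtain ⟨e, he⟩ : ∃ e, 1 / ((k : ℝ) + 1) ≤ simplexPoint s e := by
      by_contra! hlt
      have h1 := Finset.sum_lt_sum_of_nonempty (Finset.univ_nonempty) fun e _ => hlt e
      rw [sum_simplexPoint] at h1
      simp at h1
      rw [mul_inv_cancel₀ (by positivity)] at h1
      exact lt_irrefl _ h1
    have hC : simplexPoint s e ^ (η - 1) ≤ C := by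
      rcases le_or_gt 1 η with h1 | h1
      · exact (Real.rpow_le_one (hs e).le (simplexPoint_le_one hs e) (by linarith)).trans
          (le_max_left _ _)
      · refine le_trans ?_ (le_max_right _ _)
        have h2 := Real.rpow_le_rpow_of_nonpos (by positivity) he (show η - 1 ≤ 0 by linarith)
        refine h2.trans_eq ?_
        rw [one_div, Real.inv_rpow (by positivity), ← Real.rpow_neg (by positivity)]
        ring_nf
    have hrest : (∏ i : Fin k, simplexPoint s (e.succAbove i) ^ (η - 1)) ≤
        g s + ∑ j, (g ∘ simplexSwap j) s := by
      revert he hC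
      refine Fin.cases ?_ (fun j => ?_) e
      · intro _ _
        have h1 :
            (∏ i : Fin k, simplexPoint s ((0 : Fin (k + 1)).succAbove i) ^ (η - 1)) = g s := by
          refine Finset.prod_congr rfl fun i _ => ?_
          rw [← hval s hs]
          simp [simplexPoint]
        rw [h1]
        exact le_add_of_nonneg_right (Finset.sum_nonneg fun j _ => hg0 _)
      · intro _ _
        have h1 : (∏ i : Fin k, simplexPoint s (j.succ.succAbove i) ^ (η - 1)) =
            (g ∘ simplexSwap j) s := by
          have hpos : ∀ e, 0 < simplexPoint s e ^ (η - 1) := fun e => Real.rpow_pos_of_pos (hs e) _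
          have h2 := Fin.prod_univ_succAbove (fun e => simplexPoint s e ^ (η - 1)) j.succ
          have h3 : ∏ e, simplexPoint s e ^ (η - 1) =
              ∏ e, simplexPoint s (Equiv.swap 0 j.succ e) ^ (η - 1) :=
            (Equiv.prod_comp (Equiv.swap 0 j.succ) fun e => simplexPoint s e ^ (η - 1)).symm
          rw [h3, Fin.prod_univ_succ, Equiv.swap_apply_left] at h2
          have h4 := mul_left_cancel₀ (hpos _).ne' h2
          rw [← h4]
          refine Finset.prod_congr rfl fun i _ => ?_
          rw [← hval s hs, ← simplexPoint_simplexSwap]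
          simp [simplexPoint]
        rw [h1]
        refine le_add_of_nonneg_of_le (hg0 _) ?_
        exact Finset.single_le_sum (f := fun j => (g ∘ simplexSwap j) s) (fun j _ => hg0 _)
          (Finset.mem_univ j)
    rw [Fin.prod_univ_succAbove _ e]
    exact mul_le_mul hC hrest (Finset.prod_nonneg fun i _ => Real.rpow_nonneg (hs _).le _)
      (zero_le_one.trans (le_max_left _ _))

end Simplex

/-! ### Convergence of the integral over the simplex -/

/-- A sum of nonnegative weights `w` against `f` is nonnegative if `f` has nonnegative sums over all
the superlevel sets of `w`. -/
theorem sum_mul_nonneg_of_superlevel {ι : Type*} [Fintype ι] (f w : ι → ℝ) (hw : ∀ e, 0 ≤ w e)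
    (hf : ∀ l > 0, 0 ≤ ∑ e with l ≤ w e, f e) : 0 ≤ ∑ e, f e * w e := by
  classical
  induction hn : (Finset.univ.filter fun e => 0 < w e).card using Nat.strong_induction_on
    generalizing w with
  | _ n ih =>
  rcases (Finset.univ.filter fun e => 0 < w e).eq_empty_or_nonempty with h0 | hne
  · refine (Finset.sum_eq_zero fun e _ => ?_).ge
    have h1 : ¬ 0 < w e := fun h => by
      have : e ∈ Finset.univ.filter fun e => 0 < w e := by simpa using h
      rw [h0] at this
      simp at this
    rw [le_antisymm (not_lt.1 h1) (hw e), mul_zero]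
  · -- lower all the positive weights by the least one of them
    obtain ⟨e₀, he₀, hmin⟩ := Finset.exists_min_image _ w hne
    have hpos : 0 < w e₀ := by simpa using he₀
    let w' : ι → ℝ := fun e => if 0 < w e then w e - w e₀ else 0
    have hw' : ∀ e, 0 ≤ w' e := by
      intro e
      by_cases h : 0 < w e
      · have := hmin e (by simpa using h)
        simp only [w', h, if_true]
        linarith
      · simp [w', h]
    have hlt : (Finset.univ.filter fun e => 0 < w' e).card < n := by
      rw [← hn]
      refine Finset.card_lt_card (Finset.ssubset_iff_of_subset ?_ |>.2 ⟨e₀, he₀, by simp [w']⟩)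
      intro e he
      by_contra h
      have h2 : ¬ 0 < w e := by simpa using h
      simp [w', h2] at he
    have h1 := ih _ hlt w' hw' (fun l hl => ?_) rfl
    · have h2 : ∑ e, f e * w e = ∑ e, f e * w' e + w e₀ * ∑ e with w e₀ ≤ w e, f e := by
        rw [Finset.sum_filter, Finset.mul_sum, ← Finset.sum_add_distrib]
        refine Finset.sum_congr rfl fun e _ => ?_
        by_cases h : 0 < w e
        · have := hmin e (by simpa using h)
          simp only [w', h, if_true, this]
          ring
        · have h3 : w e = 0 := le_antisymm (not_lt.1 h) (hw e)
          simp [w', h3, hpos]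
      rw [h2]
      exact add_nonneg h1 (mul_nonneg hpos.le (hf _ hpos))
    · have h2 : (Finset.univ.filter fun e => l ≤ w' e) =
          Finset.univ.filter fun e => l + w e₀ ≤ w e := by
        ext e
        simp only [Finset.mem_filter, Finset.mem_univ, true_and]
        by_cases h : 0 < w e
        · simp only [w', h, if_true]
          exact ⟨fun h => by linarith, fun h => by linarith⟩
        · simp only [w', h, if_false]
          exact ⟨fun h' => absurd hl (not_lt.2 h'), fun h' => by linarith⟩
      rw [h2]
      exact hf _ (by linarith)

/-- Two-sided bounds for the modulus of a point of the right half-plane give an upper bound for its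
complex powers. -/
theorem Complex.norm_cpow_le_of_two_sided {z c : ℂ} {B M m : ℝ} (hz : z ≠ 0) (hm : 0 < m)
    (hB : 1 ≤ B) (h1 : B⁻¹ * m ≤ ‖z‖) (h2 : ‖z‖ ≤ B * m) (hc : ‖c‖ ≤ M) :
    ‖z ^ c‖ ≤ B ^ M * Real.exp (Real.pi * M) * m ^ c.re := by
  have hB0 : 0 < B := by linarith
  have hM : 0 ≤ M := (norm_nonneg c).trans hc
  have hre : |c.re| ≤ M := (Complex.abs_re_le_norm c).trans hc
  have him : |c.im| ≤ M := (Complex.abs_im_le_norm c).trans hc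
  rw [Complex.norm_cpow_of_ne_zero hz, div_eq_mul_inv, ← Real.exp_neg]
  have h3 : ‖z‖ ^ c.re ≤ B ^ M * m ^ c.re := by
    have hy : 0 < ‖z‖ / m := div_pos (norm_pos_iff.2 hz) hm
    have h4 : ‖z‖ = ‖z‖ / m * m := by field_simp
    rw [h4, Real.mul_rpow hy.le hm.le]
    refine mul_le_mul_of_nonneg_right ?_ (Real.rpow_nonneg hm.le _)
    have h5 : B ^ |c.re| ≤ B ^ M := Real.rpow_le_rpow_of_exponent_le hB hre
    refine le_trans ?_ h5
    rcases le_or_gt 0 c.re with h | h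
    · rw [abs_of_nonneg h]
      exact Real.rpow_le_rpow hy.le (by rwa [div_le_iff₀ hm]) h
    · rw [abs_of_neg h, Real.rpow_neg hB0.le, ← Real.inv_rpow hB0.le]
      exact Real.rpow_le_rpow_of_nonpos (inv_pos.2 hB0) (by rwa [le_div_iff₀ hm]) h.le
  have h6 : Real.exp (-(z.arg * c.im)) ≤ Real.exp (Real.pi * M) := by
    refine Real.exp_le_exp.2 ((neg_le_abs _).trans ?_)
    rw [abs_mul]
    exact mul_le_mul (Complex.abs_arg_le_pi z) him (abs_nonneg _) Real.pi_pos.le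
  calc ‖z‖ ^ c.re * Real.exp (-(z.arg * c.im)) ≤ B ^ M * m ^ c.re * Real.exp (Real.pi * M) :=
        mul_le_mul h3 h6 (Real.exp_pos _).le
          (mul_nonneg (Real.rpow_nonneg hB0.le _) (Real.rpow_nonneg hm.le _))
    _ = _ := by ring

section SimplexIntegral

open MeasureTheory FeynmanGraph

variable {k : ℕ}

/-- The polynomial with coefficients `P i` and exponent vectors `q i`. -/
def formPoly {ι : Type*} [Fintype ι] (q : ι → Fin (k + 1) → ℕ) (P : ι → ℂ)
    (t : Fin (k + 1) → ℝ) : ℂ :=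
  ∑ i, P i * ∏ e, (t e : ℂ) ^ q i e

/-- The greedy property of a family of exponent vectors: for every weight some member of the family
has the least possible sum over all the superlevel sets of the weight simultaneously.  Then, on each
of the sectors `t_{π 0} ≥ t_{π 1} ≥ ⋯`, one of the monomials dominates all the others. -/
def IsGreedy {ι : Type*} (q : ι → Fin (k + 1) → ℕ) : Prop :=
  ∀ w : Fin (k + 1) → ℝ, ∃ i, ∀ (i' : ι) (l : ℝ),
    ∑ e with l ≤ w e, q i e ≤ ∑ e with l ≤ w e, q i' e

/-- The least degree of the monomials `q i` in the variables in `I`. -/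
noncomputable def minDegree {ι : Type*} (q : ι → Fin (k + 1) → ℕ) (I : Finset (Fin (k + 1))) : ℕ :=
  ⨅ i, ∑ e ∈ I, q i e

theorem minDegree_le {ι : Type*} (q : ι → Fin (k + 1) → ℕ) (I : Finset (Fin (k + 1))) (i : ι) :
    minDegree q I ≤ ∑ e ∈ I, q i e :=
  ciInf_le (OrderBot.bddBelow _) i

section

variable {α β : Type*} [Fintype α] [Fintype β]
  (p : α → Fin (k + 1) → ℕ) (q : β → Fin (k + 1) → ℕ)

/-- The integrand `Q ^ c / Ψ ^ d * t ^ v`, for polynomials with arbitrary exponent vectors. -/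
noncomputable def simplexIntegrand (x : Exps k) (P : α ⊕ β → ℂ) (t : Fin (k + 1) → ℝ) : ℂ :=
  formPoly q (fun b => P (Sum.inr b)) t ^ x.1 / formPoly p (fun a => P (Sum.inl a)) t ^ x.2.1 *
    ∏ e, (t e : ℂ) ^ x.2.2 e

/-- The integral of `Q ^ c / Ψ ^ d * t ^ v` over the standard simplex. -/
noncomputable def simplexIntegral (x : Exps k) (P : α ⊕ β → ℂ) : ℂ :=
  ∫ s in {s : Fin k → ℝ | simplexPoint s ∈ stdSimplex ℝ (Fin (k + 1))},
    simplexIntegrand p q x P (simplexPoint s)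

theorem simplexIntegral_eq (x : Exps k) (P : α ⊕ β → ℂ) :
    simplexIntegral p q x P = ∫ s in openSimplex k, simplexIntegrand p q x P (simplexPoint s) :=
  setIntegral_congr_set stdSimplex_ae_eq_openSimplex

/-- The affine form whose vanishing is a condition for a pole of the integral along the face of the
simplex where the variables in `I` vanish. -/
noncomputable def facetForm (I : Finset (Fin (k + 1))) (x : Exps k) : ℂ :=
  x.1 * minDegree q I - x.2.1 * minDegree p I + ∑ e ∈ I, (x.2.2 e + 1)

/-- The domain of convergence of the integral. -/
def convDomain : Set (Exps k) :=
  {x | ∀ I : Finset (Fin (k + 1)), I.Nonempty → I ≠ Finset.univ → 0 < (facetForm p q I x).re}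

/-- The coefficients with positive real parts. -/
def posRe (ι : Type*) : Set (ι → ℂ) := {P | ∀ a, 0 < (P a).re}

end

theorem isOpen_posRe {ι : Type*} [Finite ι] : IsOpen (posRe ι) := by
  have : posRe ι = ⋂ a, {P : ι → ℂ | 0 < (P a).re} := by
    ext
    simp [posRe]
  rw [this]
  exact isOpen_iInter_of_finite fun a => isOpen_lt continuous_const (by fun_prop)

section formPoly

variable {ι : Type*} [Fintype ι] (q : ι → Fin (k + 1) → ℕ)

theorem monomial_eq_ofReal {ι : Type*} (q : ι → Fin (k + 1) → ℕ) (i : ι) (t : Fin (k + 1) → ℝ) :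
    ∏ e, (t e : ℂ) ^ q i e = ((∏ e, t e ^ q i e : ℝ) : ℂ) := by
  push_cast
  rfl

theorem formPoly_re_pos [Nonempty ι] {P : ι → ℂ} (hP : P ∈ posRe ι) {t : Fin (k + 1) → ℝ}
    (ht : ∀ e, 0 < t e) : 0 < (formPoly q P t).re := by
  rw [formPoly, Complex.re_sum]
  refine Finset.sum_pos (fun i _ => ?_) Finset.univ_nonempty
  rw [monomial_eq_ofReal, Complex.re_mul_ofReal]
  exact mul_pos (hP i) (Finset.prod_pos fun e _ => pow_pos (ht e) _)

theorem norm_formPoly_le_of_dominating {P : ι → ℂ} {M : ℝ} (hP : ∀ i, ‖P i‖ ≤ M)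
    {t : Fin (k + 1) → ℝ} (ht : ∀ e, 0 < t e) {i₀ : ι}
    (hi₀ : ∀ i, ∏ e, t e ^ q i e ≤ ∏ e, t e ^ q i₀ e) :
    ‖formPoly q P t‖ ≤ Fintype.card ι * M * ∏ e, t e ^ q i₀ e := by
  have hM : 0 ≤ M := (norm_nonneg _).trans (hP i₀)
  refine (norm_sum_le _ _).trans ?_
  have h1 : ∀ i ∈ Finset.univ, ‖P i * ∏ e, (t e : ℂ) ^ q i e‖ ≤ M * ∏ e, t e ^ q i₀ e := by
    intro i _
    have h2 : 0 ≤ ∏ e, t e ^ q i e := Finset.prod_nonneg fun e _ => pow_nonneg (ht e).le _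
    rw [monomial_eq_ofReal, norm_mul, Complex.norm_real, Real.norm_of_nonneg h2]
    exact mul_le_mul (hP i) (hi₀ i) h2 hM
  refine (Finset.sum_le_sum h1).trans_eq ?_
  rw [Finset.sum_const, Finset.card_univ, nsmul_eq_mul, mul_assoc]

theorem le_norm_formPoly {P : ι → ℂ} {δ : ℝ} (hδ : 0 < δ) (hP : ∀ i, δ ≤ (P i).re)
    {t : Fin (k + 1) → ℝ} (ht : ∀ e, 0 < t e) (i₀ : ι) :
    δ * ∏ e, t e ^ q i₀ e ≤ ‖formPoly q P t‖ := by
  refine le_trans ?_ (Complex.re_le_norm _)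
  rw [formPoly, Complex.re_sum]
  have h1 : ∀ i, (P i * ∏ e, (t e : ℂ) ^ q i e).re = (P i).re * ∏ e, t e ^ q i e := fun i => by
    rw [monomial_eq_ofReal, Complex.re_mul_ofReal]
  have h0 : ∀ i, 0 ≤ ∏ e, t e ^ q i e := fun i => Finset.prod_nonneg fun e _ =>
    pow_nonneg (ht e).le _
  simp only [h1]
  refine le_trans (mul_le_mul_of_nonneg_right (hP i₀) (h0 i₀)) ?_
  exact Finset.single_le_sum (f := fun i => (P i).re * ∏ e, t e ^ q i e)
    (fun i _ => mul_nonneg (hδ.le.trans (hP i)) (h0 i)) (Finset.mem_univ i₀)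

theorem prod_rpow_eq_exp {t : Fin (k + 1) → ℝ} (ht : ∀ e, 0 < t e) (y : Fin (k + 1) → ℝ) :
    ∏ e, t e ^ y e = Real.exp (∑ e, y e * Real.log (t e)) := by
  rw [Real.exp_sum]
  exact Finset.prod_congr rfl fun e _ => by rw [Real.rpow_def_of_pos (ht e), mul_comm]

/-- At a point of the simplex, a monomial which is minimal on all the superlevel sets of the weight
`-log t` dominates all the others. -/
theorem prod_pow_le_of_greedy {ι : Type*} (q : ι → Fin (k + 1) → ℕ) {t : Fin (k + 1) → ℝ}
    (ht : ∀ e, 0 < t e) (ht1 : ∀ e, t e ≤ 1) {i₀ : ι}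
    (hi₀ : ∀ (i' : ι) (l : ℝ), ∑ e with l ≤ -Real.log (t e), q i₀ e ≤
      ∑ e with l ≤ -Real.log (t e), q i' e) (i : ι) :
    ∏ e, t e ^ q i e ≤ ∏ e, t e ^ q i₀ e := by
  have h1 : ∀ i, ∏ e, t e ^ q i e = Real.exp (∑ e, (q i e : ℝ) * Real.log (t e)) := fun i => by
    rw [← prod_rpow_eq_exp ht]
    exact Finset.prod_congr rfl fun e _ => (Real.rpow_natCast _ _).symm
  rw [h1, h1, Real.exp_le_exp, ← sub_nonneg, ← Finset.sum_sub_distrib]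
  have h2 := sum_mul_nonneg_of_superlevel (fun e => (q i e : ℝ) - q i₀ e)
    (fun e => -Real.log (t e)) (fun e => neg_nonneg.2 (Real.log_nonpos (ht e).le (ht1 e)))
    (fun l _ => by
      rw [Finset.sum_sub_distrib, sub_nonneg]
      exact_mod_cast hi₀ i l)
  refine h2.trans_eq (Finset.sum_congr rfl fun e _ => by ring)

/-- The degrees of a dominating monomial in the variables of the superlevel sets are the minimal
ones; so they are additive along the flag of the superlevel sets. -/
theorem sum_eq_minDegree_of_greedy {ι : Type*} (q : ι → Fin (k + 1) → ℕ) {w : Fin (k + 1) → ℝ}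
    {i₀ : ι} (hi₀ : ∀ (i' : ι) (l : ℝ), ∑ e with l ≤ w e, q i₀ e ≤ ∑ e with l ≤ w e, q i' e) (l : ℝ) :
    ∑ e with l ≤ w e, q i₀ e = minDegree q (Finset.univ.filter fun e => l ≤ w e) :=
  have : Nonempty ι := ⟨i₀⟩
  le_antisymm (le_ciInf fun i => hi₀ i l) (minDegree_le q _ i₀)

/-- A form with coefficients of positive real part is comparable with its dominating monomial, and
its argument is bounded; hence the same holds for its complex powers. -/
theorem norm_formPoly_cpow_le {P : ι → ℂ} {M : ℝ} (hM : 1 ≤ M)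
    (hP : ∀ i, M⁻¹ ≤ (P i).re ∧ ‖P i‖ ≤ M) {t : Fin (k + 1) → ℝ} (ht : ∀ e, 0 < t e) {i₀ : ι}
    (hi₀ : ∀ i, ∏ e, t e ^ q i e ≤ ∏ e, t e ^ q i₀ e) {c : ℂ} (hc : ‖c‖ ≤ M) :
    ‖formPoly q P t ^ c‖ ≤ (Fintype.card ι * M) ^ M * Real.exp (Real.pi * M) *
      (∏ e, t e ^ q i₀ e) ^ c.re := by
  have : Nonempty ι := ⟨i₀⟩
  have hM0 : 0 < M := by linarith
  have hm : 0 < ∏ e, t e ^ q i₀ e := Finset.prod_pos fun e _ => pow_pos (ht e) _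
  have hcard : (1 : ℝ) ≤ Fintype.card ι := by exact_mod_cast Fintype.card_pos
  have hre := formPoly_re_pos q (P := P) (fun i => (inv_pos.2 hM0).trans_le (hP i).1) ht
  refine Complex.norm_cpow_le_of_two_sided (fun h => by simp [h] at hre) hm (by nlinarith) ?_ ?_ hc
  · refine le_trans ?_ (le_norm_formPoly q (inv_pos.2 hM0) (fun i => (hP i).1) ht i₀)
    refine mul_le_mul_of_nonneg_right ?_ hm.le
    exact inv_anti₀ hM0 (by nlinarith)
  · exact norm_formPoly_le_of_dominating q (fun i => (hP i).2) ht hi₀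

end formPoly

section

variable {α β : Type*} [Fintype α] [Fintype β]
  (p : α → Fin (k + 1) → ℕ) (q : β → Fin (k + 1) → ℕ)

/-- The domination of the integrand.  The greedy property makes the exponent of the bound on each
sector additive along the flag of faces of the simplex, so that the conditions on the facet forms
suffice. -/
theorem exists_norm_simplexIntegrand_le (hp : IsGreedy p) (hq : IsGreedy q) {M η : ℝ} (hM : 1 ≤ M)
    (hη : 0 < η) : ∃ K : ℝ, ∀ x : Exps k, ‖x‖ ≤ M →
      (∀ I : Finset (Fin (k + 1)), I.Nonempty → I ≠ Finset.univ →
        η * I.card ≤ (facetForm p q I x).re) →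
      ∀ P : α ⊕ β → ℂ, (∀ a, M⁻¹ ≤ (P a).re ∧ ‖P a‖ ≤ M) → ∀ s ∈ openSimplex k,
        ‖simplexIntegrand p q x P (simplexPoint s)‖ ≤ K * ∏ e, simplexPoint s e ^ (η - 1) := by
  let C : ℝ := ∑ e, (M * (∑ i, q i e : ℕ) + M * (∑ i, p i e : ℕ) + M + 1 + η)
  let Aq : ℝ := (Fintype.card β * M) ^ M * Real.exp (Real.pi * M)
  let Ap : ℝ := (Fintype.card α * M) ^ M * Real.exp (Real.pi * M)
  have hM0 : 0 ≤ M := by linarith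
  have hAq0 : 0 ≤ Aq := mul_nonneg (Real.rpow_nonneg (by positivity) _) (Real.exp_pos _).le
  have hAp0 : 0 ≤ Ap := mul_nonneg (Real.rpow_nonneg (by positivity) _) (Real.exp_pos _).le
  refine ⟨Aq * Ap * Real.exp (Real.log (k + 1) * C), fun x hx hL P hP s hs => ?_⟩
  let t := simplexPoint s
  have ht : ∀ e, 0 < t e := hs
  have ht1 : ∀ e, t e ≤ 1 := simplexPoint_le_one hs
  let w : Fin (k + 1) → ℝ := fun e => -Real.log (t e)
  obtain ⟨i₀, hi₀⟩ := hq w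
  obtain ⟨j₀, hj₀⟩ := hp w
  have hx1 : ‖x.1‖ ≤ M := (norm_fst_le x).trans hx
  have hx2 : ‖x.2.1‖ ≤ M := (norm_fst_le x.2).trans ((norm_snd_le x).trans hx)
  have hx3 : ∀ e, ‖x.2.2 e‖ ≤ M := fun e =>
    (norm_le_pi_norm x.2.2 e).trans ((norm_snd_le x.2).trans ((norm_snd_le x).trans hx))
  have hQ := norm_formPoly_cpow_le q hM (P := fun b => P (Sum.inr b)) (fun b => hP _) ht
    (prod_pow_le_of_greedy q ht ht1 hi₀) hx1
  have hΨ := norm_formPoly_cpow_le p hM (P := fun a => P (Sum.inl a)) (fun a => hP _) ht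
    (prod_pow_le_of_greedy p ht ht1 hj₀) (c := -x.2.1) (by rwa [norm_neg])
  have hv : ‖∏ e, (t e : ℂ) ^ x.2.2 e‖ = ∏ e, t e ^ (x.2.2 e).re := by
    rw [norm_prod]
    exact Finset.prod_congr rfl fun e _ => Complex.norm_cpow_eq_rpow_re_of_pos (ht e) _
  let b : Fin (k + 1) → ℝ := fun e => x.1.re * q i₀ e - x.2.1.re * p j₀ e + (x.2.2 e).re + 1
  have hpow : ∀ (r : Fin (k + 1) → ℕ) (a : ℝ),
      (∏ e, t e ^ r e) ^ a = ∏ e, t e ^ (a * r e) := by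
    intro r a
    rw [← Real.finsetProd_rpow _ _ fun e _ => pow_nonneg (ht e).le _]
    refine Finset.prod_congr rfl fun e _ => ?_
    rw [← Real.rpow_natCast, ← Real.rpow_mul (ht e).le, mul_comm]
  have hbound : ‖simplexIntegrand p q x P t‖ ≤ Aq * Ap * ∏ e, t e ^ (b e - 1) := by
    rw [simplexIntegrand, div_eq_mul_inv, ← Complex.cpow_neg, norm_mul, norm_mul, hv]
    have h1 : ∏ e, t e ^ (b e - 1) = (∏ e, t e ^ q i₀ e) ^ x.1.re *
        (∏ e, t e ^ p j₀ e) ^ (-x.2.1).re * ∏ e, t e ^ (x.2.2 e).re := by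
      rw [hpow (q i₀), hpow (p j₀), ← Finset.prod_mul_distrib, ← Finset.prod_mul_distrib]
      refine Finset.prod_congr rfl fun e _ => ?_
      rw [← Real.rpow_add (ht e), ← Real.rpow_add (ht e)]
      congr 1
      simp only [b, Complex.neg_re]
      ring
    rw [h1]
    have hpos : 0 ≤ ∏ e, t e ^ (x.2.2 e).re := Finset.prod_nonneg fun e _ =>
      Real.rpow_nonneg (ht e).le _
    calc _ ≤ Aq * (∏ e, t e ^ q i₀ e) ^ x.1.re * (Ap * (∏ e, t e ^ p j₀ e) ^ (-x.2.1).re) *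
          ∏ e, t e ^ (x.2.2 e).re :=
        mul_le_mul_of_nonneg_right (mul_le_mul hQ hΨ (norm_nonneg _)
          ((norm_nonneg _).trans hQ)) hpos
      _ = _ := by ring
  -- the largest coordinate is at least `1 / (k + 1)`
  obtain ⟨e₀, -, hmin⟩ := Finset.exists_min_image Finset.univ w Finset.univ_nonempty
  have hw0 : 0 ≤ w e₀ := neg_nonneg.2 (Real.log_nonpos (ht e₀).le (ht1 e₀))
  have hw1 : w e₀ ≤ Real.log (k + 1) := by
    have h1 : ∀ e ∈ Finset.univ, t e ≤ t e₀ := fun e he => by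
      have := hmin e he
      simp only [w, neg_le_neg_iff] at this
      exact (Real.log_le_log_iff (ht e) (ht e₀)).1 this
    have h2 := Finset.sum_le_sum h1
    rw [show ∑ e, t e = 1 from sum_simplexPoint s] at h2
    simp only [Finset.sum_const, Finset.card_univ, Fintype.card_fin, nsmul_eq_mul] at h2
    push_cast at h2
    have h3 : Real.log 1 ≤ Real.log ((k + 1) * t e₀) := Real.log_le_log one_pos h2
    rw [Real.log_one, Real.log_mul (by positivity) (ht e₀).ne'] at h3
    simp only [w]
    linarith
  have hlayer : 0 ≤ ∑ e, (b e - η) * (w e - w e₀) := by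
    refine sum_mul_nonneg_of_superlevel _ _ (fun e => sub_nonneg.2 (hmin e (Finset.mem_univ e)))
      fun l hl => ?_
    have hset : (Finset.univ.filter fun e => l ≤ w e - w e₀) =
        Finset.univ.filter fun e => l + w e₀ ≤ w e := by
      ext e
      simp [le_sub_iff_add_le]
    rw [hset]
    let I := Finset.univ.filter fun e => l + w e₀ ≤ w e
    change 0 ≤ ∑ e ∈ I, (b e - η)
    rcases I.eq_empty_or_nonempty with hI | hI
    · simp [hI]
    · have hIu : I ≠ Finset.univ := fun h => by
        have : e₀ ∈ I := h ▸ Finset.mem_univ e₀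
        simp only [I, Finset.mem_filter] at this
        linarith [this.2]
      have h1 := hL I hI hIu
      have h2 : (∑ e ∈ I, (q i₀ e : ℝ)) = minDegree q I := by
        exact_mod_cast sum_eq_minDegree_of_greedy q hi₀ (l + w e₀)
      have h3 : (∑ e ∈ I, (p j₀ e : ℝ)) = minDegree p I := by
        exact_mod_cast sum_eq_minDegree_of_greedy p hj₀ (l + w e₀)
      have h4 : (facetForm p q I x).re = ∑ e ∈ I, b e := by
        simp only [facetForm, b, Complex.add_re, Complex.sub_re, Complex.re_sum, Complex.one_re,
          Complex.mul_re, Complex.natCast_re, Complex.natCast_im, mul_zero, sub_zero,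
          Finset.sum_add_distrib, Finset.sum_sub_distrib,
          ← Finset.mul_sum, h2, h3]
        ring
      rw [Finset.sum_sub_distrib, ← h4, Finset.sum_const, nsmul_eq_mul]
      linarith
  have hCb : -C ≤ ∑ e, (b e - η) := by
    rw [← Finset.sum_neg_distrib]
    refine Finset.sum_le_sum fun e _ => ?_
    have h1 : -M ≤ x.1.re := (abs_le.1 ((Complex.abs_re_le_norm _).trans hx1)).1
    have h2 : x.2.1.re ≤ M := (abs_le.1 ((Complex.abs_re_le_norm _).trans hx2)).2
    have h3 : -M ≤ (x.2.2 e).re := (abs_le.1 ((Complex.abs_re_le_norm _).trans (hx3 e))).1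
    have h4 : (q i₀ e : ℝ) ≤ (∑ i, q i e : ℕ) := by
      exact_mod_cast Finset.single_le_sum (f := fun i => q i e) (fun i _ => Nat.zero_le _)
        (Finset.mem_univ i₀)
    have h5 : (p j₀ e : ℝ) ≤ (∑ i, p i e : ℕ) := by
      exact_mod_cast Finset.single_le_sum (f := fun i => p i e) (fun i _ => Nat.zero_le _)
        (Finset.mem_univ j₀)
    have h6 : (0 : ℝ) ≤ q i₀ e := Nat.cast_nonneg _
    have h7 : (0 : ℝ) ≤ p j₀ e := Nat.cast_nonneg _
    simp only [b]
    nlinarith [mul_le_mul_of_nonneg_left h4 hM0, mul_le_mul_of_nonneg_left h5 hM0,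
      mul_le_mul_of_nonneg_right h1 h6, mul_le_mul_of_nonneg_right h2 h7]
  have hC0 : 0 ≤ C := Finset.sum_nonneg fun e _ => by positivity
  refine hbound.trans ?_
  rw [mul_assoc (Aq * Ap)]
  refine mul_le_mul_of_nonneg_left ?_ (mul_nonneg hAq0 hAp0)
  rw [prod_rpow_eq_exp ht, prod_rpow_eq_exp ht, ← Real.exp_add, Real.exp_le_exp]
  have h1 : ∑ e, (η - 1) * Real.log (t e) - ∑ e, (b e - 1) * Real.log (t e) =
      ∑ e, (b e - η) * (w e - w e₀) + w e₀ * ∑ e, (b e - η) := by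
    rw [Finset.mul_sum, ← Finset.sum_sub_distrib, ← Finset.sum_add_distrib]
    exact Finset.sum_congr rfl fun e _ => by simp only [w]; ring
  have h2 : -(Real.log (k + 1) * C) ≤ w e₀ * ∑ e, (b e - η) := by
    nlinarith [mul_le_mul_of_nonneg_left hCb hw0, mul_le_mul_of_nonneg_right hw1 hC0]
  linarith

end

end SimplexIntegral

section SimplexIntegral

open MeasureTheory FeynmanGraph

variable {k : ℕ}

/-! ### Analyticity of the integral in its domain of convergence -/

variable {α β : Type*} (p : α → Fin (k + 1) → ℕ) (q : β → Fin (k + 1) → ℕ)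

/-- The translation of the exponents caused by the derivative with respect to a coefficient. -/
def expShift : α ⊕ β → Exps k
  | Sum.inl a => (0, 1, fun e => (p a e : ℂ))
  | Sum.inr b => (-1, 0, fun e => (q b e : ℂ))

/-- The factor which the derivative with respect to a coefficient produces. -/
def expFactor (α β : Type*) (x : Exps k) : α ⊕ β → ℂ
  | Sum.inl _ => -x.2.1
  | Sum.inr _ => x.1

/-- The unit vector in the direction of the exponent of `t_e`. -/
def expUnit (e : Fin (k + 1)) : Exps k := (0, 0, Pi.single e 1)

theorem IsGreedy.nonempty {ι : Type*} {q : ι → Fin (k + 1) → ℕ} (hq : IsGreedy q) : Nonempty ι :=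
  ⟨(hq 0).choose⟩

theorem continuous_facetForm (I : Finset (Fin (k + 1))) : Continuous (facetForm p q I) := by
  unfold facetForm
  fun_prop

theorem facetForm_expShift_inl (I : Finset (Fin (k + 1))) (x : Exps k) (a : α) :
    facetForm p q I (x + expShift p q (Sum.inl a)) =
      facetForm p q I x + ((∑ e ∈ I, p a e - minDegree p I : ℕ) : ℂ) := by
  rw [Nat.cast_sub (minDegree_le p I a)]
  simp only [facetForm, expShift, Prod.fst_add, Prod.snd_add, Pi.add_apply, Finset.sum_add_distrib]
  push_cast
  ring

theorem facetForm_expShift_inr (I : Finset (Fin (k + 1))) (x : Exps k) (b : β) :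
    facetForm p q I (x + expShift p q (Sum.inr b)) =
      facetForm p q I x + ((∑ e ∈ I, q b e - minDegree q I : ℕ) : ℂ) := by
  rw [Nat.cast_sub (minDegree_le q I b)]
  simp only [facetForm, expShift, Prod.fst_add, Prod.snd_add, Pi.add_apply, Finset.sum_add_distrib]
  push_cast
  ring

theorem facetForm_expUnit (I : Finset (Fin (k + 1))) (x : Exps k) (e : Fin (k + 1)) :
    facetForm p q I (x + expUnit e) = facetForm p q I x + ((if e ∈ I then 1 else 0 : ℕ) : ℂ) := by
  simp only [facetForm, expUnit, Prod.fst_add, Prod.snd_add, Pi.add_apply, Finset.sum_add_distrib,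
    Finset.sum_pi_single']
  push_cast
  ring

theorem facetForm_combination (I : Finset (Fin (k + 1))) (x y : Exps k) {a b : ℝ}
    (hab : a + b = 1) : facetForm p q I (a • x + b • y) =
      a • facetForm p q I x + b • facetForm p q I y := by
  have h1 : (a : ℂ) + b = 1 := by exact_mod_cast hab
  have h2 : ∀ z : Fin (k + 1) → ℂ, ∑ e ∈ I, (z e + 1) = ∑ e ∈ I, z e + (I.card : ℂ) := fun z => by
    rw [Finset.sum_add_distrib]
    simp
  simp only [facetForm, h2, Prod.fst_add, Prod.snd_add, Prod.smul_fst, Prod.smul_snd, Pi.add_apply,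
    Pi.smul_apply, Complex.real_smul, Finset.sum_add_distrib, ← Finset.mul_sum]
  linear_combination -(I.card : ℂ) * h1

/-- A half-space condition on every facet form. -/
def facetDomain (r : ℝ) : Set (Exps k) :=
  {x | ∀ I : Finset (Fin (k + 1)), I.Nonempty → I ≠ Finset.univ → r < (facetForm p q I x).re}

theorem isOpen_facetDomain (r : ℝ) : IsOpen (facetDomain p q r) := by
  have : facetDomain p q r = ⋂ I : {I : Finset (Fin (k + 1)) // I.Nonempty ∧ I ≠ Finset.univ},
      {x | r < (facetForm p q I.1 x).re} := by
    ext x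
    simp [facetDomain]
  rw [this]
  exact isOpen_iInter_of_finite fun I => isOpen_lt continuous_const
    (Complex.continuous_re.comp (continuous_facetForm p q I.1))

theorem convex_facetDomain (r : ℝ) : Convex ℝ (facetDomain p q r) := by
  intro x hx y hy a b ha hb hab I hI hIu
  have h1 := hx I hI hIu
  have h2 := hy I hI hIu
  rw [facetForm_combination p q I x y hab]
  simp only [Complex.add_re, Complex.real_smul, Complex.re_ofReal_mul]
  rcases ha.eq_or_lt with rfl | ha'
  · rw [zero_add] at hab
    subst hab
    simpa using h2
  · have h3 : b = 1 - a := by linarith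
    subst h3
    nlinarith [mul_pos ha' (sub_pos.2 h1), mul_nonneg hb (sub_nonneg.2 h2.le)]

theorem add_expShift_mem_facetDomain {r : ℝ} {x : Exps k} (hx : x ∈ facetDomain p q r)
    (a : α ⊕ β) : x + expShift p q a ∈ facetDomain p q r := by
  intro I hI hIu
  have h1 := hx I hI hIu
  rcases a with a | b
  · rw [facetForm_expShift_inl, Complex.add_re, Complex.natCast_re]
    exact h1.trans_le (le_add_of_nonneg_right (Nat.cast_nonneg _))
  · rw [facetForm_expShift_inr, Complex.add_re, Complex.natCast_re]
    exact h1.trans_le (le_add_of_nonneg_right (Nat.cast_nonneg _))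

theorem add_expUnit_mem_facetDomain {r : ℝ} {x : Exps k} (hx : x ∈ facetDomain p q r)
    (e : Fin (k + 1)) : x + expUnit e ∈ facetDomain p q r := by
  intro I hI hIu
  rw [facetForm_expUnit, Complex.add_re, Complex.natCast_re]
  exact (hx I hI hIu).trans_le (le_add_of_nonneg_right (Nat.cast_nonneg _))

variable {p q} [Fintype α] [Fintype β]

theorem simplexIntegrand_eq (x : Exps k) (P : α ⊕ β → ℂ) (t : Fin (k + 1) → ℝ) :
    simplexIntegrand p q x P t = formPoly q (fun b => P (Sum.inr b)) t ^ x.1 *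
      formPoly p (fun a => P (Sum.inl a)) t ^ (-x.2.1) * ∏ e, (t e : ℂ) ^ x.2.2 e := by
  rw [simplexIntegrand, div_eq_mul_inv, Complex.cpow_neg]

theorem prod_cpow_add_natCast {t : Fin (k + 1) → ℝ} (ht : ∀ e, 0 < t e) (v : Fin (k + 1) → ℂ)
    (r : Fin (k + 1) → ℕ) :
    ∏ e, (t e : ℂ) ^ (v e + r e) = (∏ e, (t e : ℂ) ^ v e) * ∏ e, (t e : ℂ) ^ r e := by
  rw [← Finset.prod_mul_distrib]
  refine Finset.prod_congr rfl fun e _ => ?_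
  rw [Complex.cpow_add _ _ (Complex.ofReal_ne_zero.2 (ht e).ne'), Complex.cpow_natCast]

theorem simplexIntegrand_expShift_inl (x : Exps k) (P : α ⊕ β → ℂ) {t : Fin (k + 1) → ℝ}
    (ht : ∀ e, 0 < t e) (a : α) : simplexIntegrand p q (x + expShift p q (Sum.inl a)) P t =
      formPoly q (fun b => P (Sum.inr b)) t ^ x.1 *
      formPoly p (fun a => P (Sum.inl a)) t ^ (-x.2.1 - 1) *
      ((∏ e, (t e : ℂ) ^ x.2.2 e) * ∏ e, (t e : ℂ) ^ p a e) := by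
  rw [simplexIntegrand_eq, ← prod_cpow_add_natCast ht]
  simp only [expShift, Prod.fst_add, Prod.snd_add, Pi.add_apply, add_zero]
  congr 3
  ring

theorem simplexIntegrand_expShift_inr (x : Exps k) (P : α ⊕ β → ℂ) {t : Fin (k + 1) → ℝ}
    (ht : ∀ e, 0 < t e) (b : β) : simplexIntegrand p q (x + expShift p q (Sum.inr b)) P t =
      formPoly q (fun b => P (Sum.inr b)) t ^ (x.1 - 1) *
      formPoly p (fun a => P (Sum.inl a)) t ^ (-x.2.1) *
      ((∏ e, (t e : ℂ) ^ x.2.2 e) * ∏ e, (t e : ℂ) ^ q b e) := by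
  rw [simplexIntegrand_eq, ← prod_cpow_add_natCast ht]
  simp only [expShift, Prod.fst_add, Prod.snd_add, Pi.add_apply, add_zero]
  rfl

theorem simplexIntegrand_expUnit (x : Exps k) (P : α ⊕ β → ℂ) {t : Fin (k + 1) → ℝ}
    (ht : ∀ e, 0 < t e) (e : Fin (k + 1)) : simplexIntegrand p q (x + expUnit e) P t =
      t e * simplexIntegrand p q x P t := by
  have h := prod_cpow_add_natCast ht x.2.2 (Pi.single e 1)
  have h1 : ∏ i, (t i : ℂ) ^ ((Pi.single e 1 : Fin (k + 1) → ℕ) i) = t e := by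
    rw [Finset.prod_eq_single e]
    · simp
    · intro i _ hi
      simp [hi]
    · simp
  have h2 : ∀ i, (((Pi.single e 1 : Fin (k + 1) → ℕ) i : ℕ) : ℂ) =
      (Pi.single e 1 : Fin (k + 1) → ℂ) i := fun i => by
    by_cases hi : i = e
    · subst hi
      simp
    · simp [hi]
  simp only [h1, h2] at h
  simp only [simplexIntegrand_eq, expUnit, Prod.fst_add, Prod.snd_add, Pi.add_apply, add_zero, h]
  ring

/-- One factor of `Q ^ x.1` is expanded into monomials. -/
theorem sum_mul_simplexIntegrand_expShift_inr [Nonempty β] (x : Exps k) {P : α ⊕ β → ℂ}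
    (hP : P ∈ posRe (α ⊕ β)) {t : Fin (k + 1) → ℝ} (ht : ∀ e, 0 < t e) :
    ∑ b, P (Sum.inr b) * simplexIntegrand p q (x + expShift p q (Sum.inr b)) P t =
      simplexIntegrand p q x P t := by
  have hre := formPoly_re_pos q (P := fun b => P (Sum.inr b)) (fun b => hP _) ht
  have hne : formPoly q (fun b => P (Sum.inr b)) t ≠ 0 := fun h => by simp [h] at hre
  simp only [simplexIntegrand_expShift_inr x P ht]
  rw [simplexIntegrand_eq, Complex.cpow_sub _ _ hne, Complex.cpow_one]
  have h1 : formPoly q (fun b => P (Sum.inr b)) t = ∑ b, P (Sum.inr b) * ∏ e, (t e : ℂ) ^ q b e :=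
    rfl
  generalize formPoly p (fun a => P (Sum.inl a)) t ^ (-x.2.1) = Z
  generalize (∏ e, (t e : ℂ) ^ x.2.2 e) = V
  calc _ = ∑ b, (formPoly q (fun b => P (Sum.inr b)) t ^ x.1 /
        formPoly q (fun b => P (Sum.inr b)) t * Z * V) * (P (Sum.inr b) * ∏ e, (t e : ℂ) ^ q b e) :=
        Finset.sum_congr rfl fun b _ => by ring
    _ = _ := by
      rw [← Finset.mul_sum, ← h1]
      field_simp

/-- One factor of `Ψ` is split off from `Ψ ^ (-x.2.1)` and expanded into monomials. -/
theorem sum_mul_simplexIntegrand_expShift_inl [Nonempty α] (x : Exps k) {P : α ⊕ β → ℂ}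
    (hP : P ∈ posRe (α ⊕ β)) {t : Fin (k + 1) → ℝ} (ht : ∀ e, 0 < t e) :
    ∑ a, P (Sum.inl a) * simplexIntegrand p q (x + expShift p q (Sum.inl a)) P t =
      simplexIntegrand p q x P t := by
  have hre := formPoly_re_pos p (P := fun a => P (Sum.inl a)) (fun b => hP _) ht
  have hne : formPoly p (fun a => P (Sum.inl a)) t ≠ 0 := fun h => by simp [h] at hre
  simp only [simplexIntegrand_expShift_inl x P ht]
  rw [simplexIntegrand_eq, Complex.cpow_sub _ _ hne, Complex.cpow_one]
  have h1 : formPoly p (fun a => P (Sum.inl a)) t = ∑ a, P (Sum.inl a) * ∏ e, (t e : ℂ) ^ p a e :=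
    rfl
  generalize formPoly q (fun b => P (Sum.inr b)) t ^ x.1 = Z
  generalize (∏ e, (t e : ℂ) ^ x.2.2 e) = V
  calc _ = ∑ a, (Z * (formPoly p (fun a => P (Sum.inl a)) t ^ (-x.2.1) /
        formPoly p (fun a => P (Sum.inl a)) t) * V) * (P (Sum.inl a) * ∏ e, (t e : ℂ) ^ p a e) :=
        Finset.sum_congr rfl fun a _ => by ring
    _ = _ := by
      rw [← Finset.mul_sum, ← h1]
      field_simp

theorem measurable_formPoly {ι : Type*} [Fintype ι] (r : ι → Fin (k + 1) → ℕ) (R : ι → ℂ) :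
    Measurable fun s : Fin k → ℝ => formPoly r R (simplexPoint s) := by
  refine Finset.measurable_fun_sum _ fun i _ => Measurable.const_mul ?_ _
  exact Finset.measurable_fun_prod _ fun e _ => (Complex.continuous_ofReal.comp
    ((continuous_apply e).comp continuous_simplexPoint)).measurable.pow_const _

theorem measurable_simplexIntegrand (x : Exps k) (P : α ⊕ β → ℂ) :
    Measurable fun s : Fin k → ℝ => simplexIntegrand p q x P (simplexPoint s) := by
  have ht : ∀ e, Measurable fun s : Fin k → ℝ => ((simplexPoint s e : ℝ) : ℂ) := fun e =>
    (Complex.continuous_ofReal.comp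
      ((continuous_apply e).comp continuous_simplexPoint)).measurable
  refine Measurable.mul (Measurable.div ((measurable_formPoly q _).pow_const _)
    ((measurable_formPoly p _).pow_const _)) ?_
  exact Finset.measurable_fun_prod _ fun e _ => (ht e).pow_const _

theorem differentiableOn_simplexIntegrand [Nonempty α] [Nonempty β] {t : Fin (k + 1) → ℝ}
    (ht : ∀ e, 0 < t e) :
    DifferentiableOn ℂ (fun y : Exps k × (α ⊕ β → ℂ) => simplexIntegrand p q y.1 y.2 t)
      (Set.univ ×ˢ posRe (α ⊕ β)) := by
  rintro ⟨x, P⟩ ⟨-, hP⟩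
  refine DifferentiableAt.differentiableWithinAt ?_
  simp only [simplexIntegrand_eq]
  have h1 := formPoly_re_pos q (P := fun b => P (Sum.inr b)) (fun b => hP _) ht
  have h2 := formPoly_re_pos p (P := fun a => P (Sum.inl a)) (fun b => hP _) ht
  refine DifferentiableAt.mul (DifferentiableAt.mul ?_ ?_) ?_
  · refine DifferentiableAt.cpow ?_ (by fun_prop) (Or.inl h1)
    unfold formPoly
    fun_prop
  · refine DifferentiableAt.cpow ?_ (by fun_prop) (Or.inl h2)
    unfold formPoly
    fun_prop
  · have h3 : ∀ e, DifferentiableAt ℂ (fun y : Exps k × (α ⊕ β → ℂ) => (t e : ℂ) ^ y.1.2.2 e)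
        (x, P) := fun e => DifferentiableAt.const_cpow (by fun_prop)
      (Or.inl (Complex.ofReal_ne_zero.2 (ht e).ne'))
    fun_prop

/-- An integrable bound for the integrand which is uniform near a given point, with respect to the
exponents and the coefficients. -/
theorem exists_dominating (hp : IsGreedy p) (hq : IsGreedy q) {x₀ : Exps k}
    (hx₀ : x₀ ∈ convDomain p q) {P₀ : α ⊕ β → ℂ} (hP₀ : P₀ ∈ posRe (α ⊕ β)) :
    ∃ N ∈ 𝓝 (x₀, P₀), ∃ g : (Fin k → ℝ) → ℝ, IntegrableOn g (openSimplex k) ∧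
      ∀ y ∈ N, ∀ s ∈ openSimplex k, ‖simplexIntegrand p q y.1 y.2 (simplexPoint s)‖ ≤ g s := by
  obtain ⟨η, hη0, hη⟩ : ∃ η : ℝ, 0 < η ∧ ∀ I : Finset (Fin (k + 1)), I.Nonempty →
      I ≠ Finset.univ → η * I.card < (facetForm p q I x₀).re := by
    have h1 : ∀ᶠ η in 𝓝[>] (0 : ℝ), ∀ I : Finset (Fin (k + 1)), I.Nonempty →
        I ≠ Finset.univ → η * I.card < (facetForm p q I x₀).re := by
      rw [eventually_all]
      intro I
      by_cases hI : I.Nonempty ∧ I ≠ Finset.univ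
      · have h2 : Tendsto (fun η : ℝ => η * I.card) (𝓝[>] 0) (𝓝 (0 * I.card)) :=
          ((continuous_id.mul continuous_const).tendsto 0).mono_left nhdsWithin_le_nhds
        rw [zero_mul] at h2
        exact (h2.eventually_lt_const (hx₀ I hI.1 hI.2)).mono fun η h _ _ => h
      · exact Eventually.of_forall fun η h1 h2 => absurd ⟨h1, h2⟩ hI
    exact ((eventually_mem_nhdsWithin (a := (0 : ℝ)) (s := Set.Ioi 0)).and h1).exists
  obtain ⟨M, hM1, hMx, hMP, hMre⟩ : ∃ M : ℝ, 1 ≤ M ∧ ‖x₀‖ < M ∧ (∀ a, ‖P₀ a‖ < M) ∧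
      ∀ a, M⁻¹ < (P₀ a).re := by
    have h1 : ∀ᶠ M : ℝ in atTop, ∀ a, ‖P₀ a‖ < M := by
      rw [eventually_all]
      exact fun a => eventually_gt_atTop _
    have h2 : ∀ᶠ M : ℝ in atTop, ∀ a, M⁻¹ < (P₀ a).re := by
      rw [eventually_all]
      exact fun a => tendsto_inv_atTop_zero.eventually_lt_const (hP₀ a)
    exact ((eventually_ge_atTop 1).and ((eventually_gt_atTop _).and (h1.and h2))).exists
  obtain ⟨K, hK⟩ := exists_norm_simplexIntegrand_le p q hp hq hM1 hη0
  have hN : ∀ᶠ y : Exps k × (α ⊕ β → ℂ) in 𝓝 (x₀, P₀), ‖y.1‖ < M ∧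
      (∀ I : Finset (Fin (k + 1)), I.Nonempty → I ≠ Finset.univ →
        η * I.card < (facetForm p q I y.1).re) ∧ ∀ a, M⁻¹ < (y.2 a).re ∧ ‖y.2 a‖ < M := by
    refine Eventually.and ?_ (Eventually.and ?_ ?_)
    · exact (continuous_fst.norm.continuousAt (x := (x₀, P₀))).eventually_lt continuousAt_const hMx
    · rw [eventually_all]
      intro I
      by_cases hI : I.Nonempty ∧ I ≠ Finset.univ
      · have hc : Continuous fun y : Exps k × (α ⊕ β → ℂ) => (facetForm p q I y.1).re :=
          Complex.continuous_re.comp ((continuous_facetForm p q I).comp continuous_fst)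
        exact (continuousAt_const.eventually_lt hc.continuousAt (hη I hI.1 hI.2)).mono
          fun y h _ _ => h
      · exact Eventually.of_forall fun y h1 h2 => absurd ⟨h1, h2⟩ hI
    · rw [eventually_all]
      intro a
      have hc : Continuous fun y : Exps k × (α ⊕ β → ℂ) => y.2 a := by fun_prop
      exact (continuousAt_const.eventually_lt (Complex.continuous_re.comp hc).continuousAt
        (hMre a)).and (hc.norm.continuousAt.eventually_lt continuousAt_const (hMP a))
  refine ⟨_, hN, _, (integrableOn_prod_rpow hη0).const_mul K, fun y hy s hs => ?_⟩
  exact hK y.1 hy.1.le (fun I hI hIu => (hy.2.1 I hI hIu).le) y.2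
    (fun a => ⟨(hy.2.2 a).1.le, (hy.2.2 a).2.le⟩) s hs

theorem integrableOn_simplexIntegrand (hp : IsGreedy p) (hq : IsGreedy q) {x : Exps k}
    (hx : x ∈ convDomain p q) {P : α ⊕ β → ℂ} (hP : P ∈ posRe (α ⊕ β)) :
    IntegrableOn (fun s => simplexIntegrand p q x P (simplexPoint s)) (openSimplex k) := by
  obtain ⟨N, hN, g, hg, hb⟩ := exists_dominating hp hq hx hP
  refine hg.mono' (measurable_simplexIntegrand x P).aestronglyMeasurable ?_
  exact (ae_restrict_iff' isOpen_openSimplex.measurableSet).2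
    (Eventually.of_forall fun s hs => hb _ (mem_of_mem_nhds hN) s hs)

theorem sum_mul_simplexIntegral_expShift_inr (hp : IsGreedy p) (hq : IsGreedy q) {x : Exps k}
    (hx : x ∈ convDomain p q) {P : α ⊕ β → ℂ} (hP : P ∈ posRe (α ⊕ β)) :
    ∑ b, P (Sum.inr b) * simplexIntegral p q (x + expShift p q (Sum.inr b)) P =
      simplexIntegral p q x P := by
  have := hq.nonempty
  simp only [simplexIntegral_eq, ← integral_const_mul]
  rw [← integral_finsetSum]
  · refine setIntegral_congr_fun isOpen_openSimplex.measurableSet fun s hs => ?_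
    exact sum_mul_simplexIntegrand_expShift_inr x hP hs
  · intro b _
    exact (integrableOn_simplexIntegrand hp hq (add_expShift_mem_facetDomain p q hx _) hP).const_mul _

theorem sum_mul_simplexIntegral_expShift_inl (hp : IsGreedy p) (hq : IsGreedy q) {x : Exps k}
    (hx : x ∈ convDomain p q) {P : α ⊕ β → ℂ} (hP : P ∈ posRe (α ⊕ β)) :
    ∑ a, P (Sum.inl a) * simplexIntegral p q (x + expShift p q (Sum.inl a)) P =
      simplexIntegral p q x P := by
  have := hp.nonempty
  simp only [simplexIntegral_eq, ← integral_const_mul]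
  rw [← integral_finsetSum]
  · refine setIntegral_congr_fun isOpen_openSimplex.measurableSet fun s hs => ?_
    exact sum_mul_simplexIntegrand_expShift_inl x hP hs
  · intro b _
    exact (integrableOn_simplexIntegrand hp hq (add_expShift_mem_facetDomain p q hx _) hP).const_mul _

/-- The derivative with respect to a coefficient translates the exponents. -/
theorem hasDerivAt_simplexIntegrand_coeff [Nonempty α] [Nonempty β] [DecidableEq (α ⊕ β)]
    (x : Exps k) {P : α ⊕ β → ℂ} (hP : P ∈ posRe (α ⊕ β)) {t : Fin (k + 1) → ℝ}
    (ht : ∀ e, 0 < t e) (a : α ⊕ β) :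
    HasDerivAt (fun z : ℂ => simplexIntegrand p q x (P + z • Pi.single a 1) t)
      (expFactor α β x a * simplexIntegrand p q (x + expShift p q a) P t) 0 := by
  classical
  have h1 := formPoly_re_pos q (P := fun b => P (Sum.inr b)) (fun b => hP _) ht
  have h2 := formPoly_re_pos p (P := fun a => P (Sum.inl a)) (fun b => hP _) ht
  simp only [simplexIntegrand_eq]
  rcases a with a | b
  · have hq' : ∀ z : ℂ,
        formPoly q (fun b => (P + z • (Pi.single (Sum.inl a) 1 : α ⊕ β → ℂ)) (Sum.inr b)) t =
        formPoly q (fun b => P (Sum.inr b)) t := by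
      intro z
      simp
    have hp' : ∀ z : ℂ,
        formPoly p (fun a' => (P + z • (Pi.single (Sum.inl a) 1 : α ⊕ β → ℂ)) (Sum.inl a')) t =
        formPoly p (fun a => P (Sum.inl a)) t + z * ∏ e, (t e : ℂ) ^ p a e := by
      intro z
      simp only [formPoly, Pi.add_apply, Pi.smul_apply, add_mul, Finset.sum_add_distrib]
      congr 1
      rw [Finset.sum_eq_single a]
      · simp
      · intro a' _ ha'
        simp [ha']
      · simp
    simp only [hq', hp']
    have hlin : HasDerivAt (fun z : ℂ => formPoly p (fun a => P (Sum.inl a)) t +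
        z * ∏ e, (t e : ℂ) ^ p a e) (∏ e, (t e : ℂ) ^ p a e) 0 := by
      simpa using ((hasDerivAt_id (0 : ℂ)).mul_const (∏ e, (t e : ℂ) ^ p a e)).const_add
        (formPoly p (fun a => P (Sum.inl a)) t)
    have h3 := hlin.cpow_const (c := -x.2.1) (Or.inl (by simpa using h2))
    have h4 := (h3.const_mul (formPoly q (fun b => P (Sum.inr b)) t ^ x.1)).mul_const
      (∏ e, (t e : ℂ) ^ x.2.2 e)
    refine h4.congr_deriv ?_
    rw [← simplexIntegrand_eq, simplexIntegrand_expShift_inl x P ht]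
    simp only [expFactor, zero_mul, add_zero]
    ring
  · have hp' : ∀ z : ℂ,
        formPoly p (fun a => (P + z • (Pi.single (Sum.inr b) 1 : α ⊕ β → ℂ)) (Sum.inl a)) t =
        formPoly p (fun a => P (Sum.inl a)) t := by
      intro z
      simp
    have hq' : ∀ z : ℂ,
        formPoly q (fun b' => (P + z • (Pi.single (Sum.inr b) 1 : α ⊕ β → ℂ)) (Sum.inr b')) t =
        formPoly q (fun b => P (Sum.inr b)) t + z * ∏ e, (t e : ℂ) ^ q b e := by
      intro z
      simp only [formPoly, Pi.add_apply, Pi.smul_apply, add_mul, Finset.sum_add_distrib]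
      congr 1
      rw [Finset.sum_eq_single b]
      · simp
      · intro b' _ hb'
        simp [hb']
      · simp
    simp only [hq', hp']
    have hlin : HasDerivAt (fun z : ℂ => formPoly q (fun b => P (Sum.inr b)) t +
        z * ∏ e, (t e : ℂ) ^ q b e) (∏ e, (t e : ℂ) ^ q b e) 0 := by
      simpa using ((hasDerivAt_id (0 : ℂ)).mul_const (∏ e, (t e : ℂ) ^ q b e)).const_add
        (formPoly q (fun b => P (Sum.inr b)) t)
    have h3 := hlin.cpow_const (c := x.1) (Or.inl (by simpa using h1))
    have h4 := (h3.mul_const (formPoly p (fun a => P (Sum.inl a)) t ^ (-x.2.1))).mul_const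
      (∏ e, (t e : ℂ) ^ x.2.2 e)
    refine h4.congr_deriv ?_
    rw [← simplexIntegrand_eq, simplexIntegrand_expShift_inr x P ht]
    simp only [expFactor, zero_mul, add_zero]
    ring

/-- The integral is analytic in the exponents and the coefficients, and its derivatives with respect
to the coefficients are given by translations of the exponents. -/
theorem analyticOnNhd_simplexIntegral (hp : IsGreedy p) (hq : IsGreedy q) :
    AnalyticOnNhd ℂ (Function.uncurry (simplexIntegral p q))
      (convDomain p q ×ˢ posRe (α ⊕ β)) ∧
    ∀ x ∈ convDomain p q, ∀ P ∈ posRe (α ⊕ β), ∀ a,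
      partialDeriv a (simplexIntegral p q x) P =
        expFactor α β x a * simplexIntegral p q (x + expShift p q a) P := by
  classical
  have := hq.nonempty
  have := hp.nonempty
  have hopen : IsOpen (convDomain p q ×ˢ posRe (α ⊕ β)) :=
    (isOpen_facetDomain p q 0).prod isOpen_posRe
  have hF : Function.uncurry (simplexIntegral p q) = fun y : Exps k × (α ⊕ β → ℂ) =>
      ∫ s in openSimplex k, simplexIntegrand p q y.1 y.2 (simplexPoint s) := by
    ext y
    exact simplexIntegral_eq p q y.1 y.2
  have hdiff : ∀ s ∈ openSimplex k, DifferentiableOn ℂ (fun y : Exps k × (α ⊕ β → ℂ) =>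
      simplexIntegrand p q y.1 y.2 (simplexPoint s)) (convDomain p q ×ˢ posRe (α ⊕ β)) :=
    fun s hs => (differentiableOn_simplexIntegrand hs).mono
      (Set.prod_mono (Set.subset_univ _) subset_rfl)
  have key := analyticOnNhd_integral_of_dominated (μ := volume.restrict (openSimplex k)) hopen
    (f := fun y s => simplexIntegrand p q y.1 y.2 (simplexPoint s)) ?_ ?_ ?_
  · rw [← hF] at key
    refine ⟨key.1, fun x hx P hP a => ?_⟩
    have h1 := key.2 (x, P) ⟨hx, hP⟩ (0, Pi.single a 1)
    have h2 : HasFDerivAt (fun P => simplexIntegral p q x P)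
        ((fderiv ℂ (Function.uncurry (simplexIntegral p q)) (x, P)).comp
          (ContinuousLinearMap.inr ℂ (Exps k) (α ⊕ β → ℂ))) P :=
      HasFDerivAt.comp (g := Function.uncurry (simplexIntegral p q)) (f := fun P => (x, P)) P
        (key.1 (x, P) ⟨hx, hP⟩).differentiableAt.hasFDerivAt (hasFDerivAt_prodMk_right x P)
    have h3 : partialDeriv a (simplexIntegral p q x) P =
        fderiv ℂ (Function.uncurry (simplexIntegral p q)) (x, P) (0, Pi.single a 1) := by
      simp only [partialDeriv]
      rw [h2.fderiv]
      simp only [ContinuousLinearMap.comp_apply, ContinuousLinearMap.inr_apply]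
      congr! 3
    rw [h3, h1, simplexIntegral_eq, ← integral_const_mul]
    refine setIntegral_congr_fun isOpen_openSimplex.measurableSet fun s hs => ?_
    have h4 : HasFDerivAt (fun y : Exps k × (α ⊕ β → ℂ) =>
        simplexIntegrand p q y.1 y.2 (simplexPoint s)) (fderiv ℂ (fun y : Exps k × (α ⊕ β → ℂ) =>
        simplexIntegrand p q y.1 y.2 (simplexPoint s)) (x, P))
        (x, P + (0 : ℂ) • Pi.single a 1) := by
      have := ((hdiff s hs).differentiableAt (hopen.mem_nhds
        (show (x, P) ∈ convDomain p q ×ˢ posRe (α ⊕ β) from ⟨hx, hP⟩))).hasFDerivAt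
      simpa using this
    have h5 : HasDerivAt (fun z : ℂ => ((x, P + z • Pi.single a 1) : Exps k × (α ⊕ β → ℂ)))
        (0, Pi.single a 1) 0 := by
      refine (hasDerivAt_const (0 : ℂ) x).prodMk ?_
      simpa using ((hasDerivAt_id (0 : ℂ)).smul_const
        (Pi.single a 1 : α ⊕ β → ℂ)).const_add P
    have h6 := h4.comp_hasDerivAt (0 : ℂ) h5
    exact h6.unique (hasDerivAt_simplexIntegrand_coeff x hP hs a)
  · exact fun y _ => (measurable_simplexIntegrand y.1 y.2).aestronglyMeasurable
  · exact (ae_restrict_iff' isOpen_openSimplex.measurableSet).2 (Eventually.of_forall hdiff)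
  · rintro ⟨x, P⟩ ⟨hx, hP⟩
    obtain ⟨N, hN, g, hg, hb⟩ := exists_dominating hp hq hx hP
    exact ⟨N, hN, g, hg, (ae_restrict_iff' isOpen_openSimplex.measurableSet).2
      (Eventually.of_forall fun s hs y hy => hb y hy s hs)⟩

end SimplexIntegral

/-! ### Integration by parts on the simplex -/

section SimplexIntegral

open MeasureTheory FeynmanGraph

variable {k : ℕ}

theorem hasDerivAt_prod_cpow_line {t : Fin (k + 1) → ℝ} (ht : ∀ e, 0 < t e)
    (ξ : Fin (k + 1) → ℝ) (v : Fin (k + 1) → ℂ) :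
    HasDerivAt (fun τ : ℝ => ∏ e, ((t e + τ * ξ e : ℝ) : ℂ) ^ v e)
      ((∑ e, (ξ e / t e : ℝ) * v e) * ∏ e, (t e : ℂ) ^ v e) 0 := by
  have hlin : ∀ e, HasDerivAt (fun τ : ℝ => t e + τ * ξ e) (ξ e) 0 := fun e => by
    simpa using ((hasDerivAt_id (0 : ℝ)).mul_const (ξ e)).const_add (t e)
  have hpos : ∀ᶠ τ : ℝ in 𝓝 0, ∀ e, 0 < t e + τ * ξ e := by
    rw [eventually_all]
    exact fun e => (hlin e).continuousAt.eventually_const_lt (by simpa using ht e)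
  have hexp : ∀ {u : Fin (k + 1) → ℝ}, (∀ e, 0 < u e) →
      ∏ e, (u e : ℂ) ^ v e = Complex.exp (∑ e, (Real.log (u e) : ℂ) * v e) := by
    intro u hu
    rw [Complex.exp_sum]
    refine Finset.prod_congr rfl fun e _ => ?_
    rw [Complex.cpow_def_of_ne_zero (Complex.ofReal_ne_zero.2 (hu e).ne'),
      Complex.ofReal_log (hu e).le]
  have hlog : HasDerivAt (fun τ : ℝ => ∑ e, (Real.log (t e + τ * ξ e) : ℂ) * v e)
      (∑ e, (ξ e / t e : ℝ) * v e) 0 := by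
    refine HasDerivAt.fun_sum fun e _ => HasDerivAt.mul_const ?_ _
    have h1 := (hlin e).log (by simpa using (ht e).ne')
    simpa using h1.ofReal_comp
  refine (hlog.cexp.congr_of_eventuallyEq (hpos.mono fun τ hτ => hexp hτ)).congr_deriv ?_
  rw [hexp ht, mul_comm]
  simp

theorem hasDerivAt_formPoly_line {ι : Type*} [Fintype ι] (q : ι → Fin (k + 1) → ℕ) (P : ι → ℂ)
    {t : Fin (k + 1) → ℝ} (ht : ∀ e, 0 < t e) (ξ : Fin (k + 1) → ℝ) :
    HasDerivAt (fun τ : ℝ => formPoly q P fun e => t e + τ * ξ e)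
      (∑ i, P i * ((∑ e, (ξ e / t e : ℝ) * (q i e : ℂ)) * ∏ e, (t e : ℂ) ^ q i e)) 0 := by
  refine HasDerivAt.fun_sum fun i _ => HasDerivAt.const_mul _ ?_
  simpa only [Complex.cpow_natCast] using hasDerivAt_prod_cpow_line ht ξ fun e => (q i e : ℂ)

variable {α β : Type*} [Fintype α] [Fintype β]
  (p : α → Fin (k + 1) → ℕ) (q : β → Fin (k + 1) → ℕ)

/-- The logarithmic derivative `t_e ∂/∂t_e` of the integrand. -/
noncomputable def simplexIntegrandLogDeriv (x : Exps k) (P : α ⊕ β → ℂ) (t : Fin (k + 1) → ℝ)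
    (e : Fin (k + 1)) : ℂ :=
  ∑ a, (Sum.elim p q a e : ℂ) * P a * (expFactor α β x a *
    simplexIntegrand p q (x + expShift p q a) P t) + x.2.2 e * simplexIntegrand p q x P t

variable {p q}

/-- The derivative of the integrand along a line in the space of the variables. -/
theorem hasDerivAt_simplexIntegrand_line [Nonempty α] [Nonempty β] (x : Exps k) {P : α ⊕ β → ℂ}
    (hP : P ∈ posRe (α ⊕ β)) {t : Fin (k + 1) → ℝ} (ht : ∀ e, 0 < t e) (ξ : Fin (k + 1) → ℝ) :
    HasDerivAt (fun τ : ℝ => simplexIntegrand p q x P fun e => t e + τ * ξ e)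
      (∑ e, (ξ e / t e : ℝ) * simplexIntegrandLogDeriv p q x P t e) 0 := by
  have h1 := formPoly_re_pos q (P := fun b => P (Sum.inr b)) (fun b => hP _) ht
  have h2 := formPoly_re_pos p (P := fun a => P (Sum.inl a)) (fun b => hP _) ht
  simp only [simplexIntegrand_eq]
  have hcpow : ∀ {f : ℝ → ℂ} {f' c : ℂ}, HasDerivAt f f' 0 → 0 < (f 0).re →
      HasDerivAt (fun τ => f τ ^ c) (f' * (c * f 0 ^ (c - 1))) 0 := by
    intro f f' c hf h0
    have h3 : HasDerivAt (fun z : ℂ => z ^ c) (c * f 0 ^ (c - 1)) (f 0) := by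
      simpa using (hasDerivAt_id (f 0)).cpow_const (c := c) (Or.inl h0)
    exact h3.scomp (0 : ℝ) hf
  have h0 : (fun e => t e + 0 * ξ e) = t := by
    ext e
    simp
  have hq' := hcpow (c := x.1) (hasDerivAt_formPoly_line q (fun b => P (Sum.inr b)) ht ξ)
    (by rwa [h0])
  have hp' := hcpow (c := -x.2.1) (hasDerivAt_formPoly_line p (fun a => P (Sum.inl a)) ht ξ)
    (by rwa [h0])
  refine ((hq'.mul hp').mul (hasDerivAt_prod_cpow_line ht ξ x.2.2)).congr_deriv ?_
  simp only [Pi.mul_apply, simplexIntegrandLogDeriv, Fintype.sum_sum_type, Sum.elim_inl, Sum.elim_inr,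
    simplexIntegrand_expShift_inl x P ht, simplexIntegrand_expShift_inr x P ht,
    simplexIntegrand_eq x P t, expFactor, zero_mul, add_zero]
  generalize formPoly q (fun b => P (Sum.inr b)) t ^ x.1 = Z₁
  generalize formPoly q (fun b => P (Sum.inr b)) t ^ (x.1 - 1) = Z₂
  generalize formPoly p (fun a => P (Sum.inl a)) t ^ (-x.2.1) = Z₃
  generalize formPoly p (fun a => P (Sum.inl a)) t ^ (-x.2.1 - 1) = Z₄
  generalize (∏ e, (t e : ℂ) ^ x.2.2 e) = V
  simp only [mul_add, add_mul, Finset.sum_add_distrib, Finset.mul_sum, Finset.sum_mul]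
  rw [Finset.sum_comm (s := (Finset.univ : Finset (Fin (k + 1)))) (t := (Finset.univ : Finset α)),
    Finset.sum_comm (s := (Finset.univ : Finset (Fin (k + 1)))) (t := (Finset.univ : Finset β)),
    add_comm (∑ a : α, _) (∑ b : β, _)]
  congr 1
  · congr 1
    · exact Finset.sum_congr rfl fun b _ => Finset.sum_congr rfl fun e _ => by ring
    · exact Finset.sum_congr rfl fun b _ => Finset.sum_congr rfl fun e _ => by ring
  · exact Finset.sum_congr rfl fun e _ => by ring

theorem norm_formPoly_le_sum {ι : Type*} [Fintype ι] (q : ι → Fin (k + 1) → ℕ) (P : ι → ℂ)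
    {t : Fin (k + 1) → ℝ} (ht : ∀ e, 0 < t e) (ht1 : ∀ e, t e ≤ 1) :
    ‖formPoly q P t‖ ≤ ∑ i, ‖P i‖ := by
  refine (norm_sum_le _ _).trans (Finset.sum_le_sum fun i _ => ?_)
  rw [norm_mul, monomial_eq_ofReal, Complex.norm_real, Real.norm_of_nonneg
    (Finset.prod_nonneg fun e _ => pow_nonneg (ht e).le _)]
  exact mul_le_of_le_one_right (norm_nonneg _) (Finset.prod_le_one
    (fun e _ => pow_nonneg (ht e).le _) fun e _ => pow_le_one₀ (ht e).le (ht1 e))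

theorem Complex.norm_cpow_le_of_re_pos {z c : ℂ} {B : ℝ} (hz : z ≠ 0) (hB : ‖z‖ ≤ B)
    (hc : 0 ≤ c.re) : ‖z ^ c‖ ≤ B ^ c.re * Real.exp (Real.pi * |c.im|) := by
  rw [Complex.norm_cpow_of_ne_zero hz, div_eq_mul_inv, ← Real.exp_neg]
  refine mul_le_mul (Real.rpow_le_rpow (norm_nonneg _) hB hc) (Real.exp_le_exp.2 ?_)
    (Real.exp_pos _).le (Real.rpow_nonneg ((norm_nonneg _).trans hB) _)
  refine (neg_le_abs _).trans ?_
  rw [abs_mul]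
  exact mul_le_mul_of_nonneg_right (Complex.abs_arg_le_pi z) (abs_nonneg _)

/-- The exponents for which the integral is defined in the first place. -/
def initialDomain (k : ℕ) : Set (Exps k) :=
  {x | 0 < x.1.re ∧ x.2.1.re < 0 ∧ ∀ e, 0 < (x.2.2 e).re}

omit [Fintype α] [Fintype β] in
theorem initialDomain_subset_convDomain : initialDomain k ⊆ convDomain p q := by
  rintro x ⟨hc, hd, hv⟩ I hI -
  simp only [facetForm, Complex.add_re, Complex.sub_re, Complex.mul_re, Complex.natCast_re,
    Complex.natCast_im, mul_zero, sub_zero, Complex.re_sum, Complex.one_re]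
  have h1 : 0 < ∑ e ∈ I, ((x.2.2 e).re + 1) := Finset.sum_pos (fun e _ => by linarith [hv e]) hI
  have h2 : 0 ≤ x.1.re * (minDegree q I : ℝ) := by positivity
  have h3 : 0 ≤ -x.2.1.re * (minDegree p I : ℝ) := mul_nonneg (by linarith) (Nat.cast_nonneg _)
  linarith

/-- For exponents in the initial domain the integrand tends to zero at the boundary of the simplex,
so that integration by parts produces no boundary terms. -/
theorem exists_norm_simplexIntegrand_le_prod_rpow [Nonempty α] [Nonempty β] {x : Exps k}
    (hx : x ∈ initialDomain k) {P : α ⊕ β → ℂ} (hP : P ∈ posRe (α ⊕ β)) :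
    ∃ K : ℝ, ∀ s ∈ openSimplex k, ‖simplexIntegrand p q x P (simplexPoint s)‖ ≤
      K * ∏ e, simplexPoint s e ^ (x.2.2 e).re := by
  refine ⟨((∑ b, ‖P (Sum.inr b)‖) ^ x.1.re * Real.exp (Real.pi * |x.1.im|)) *
    ((∑ a, ‖P (Sum.inl a)‖) ^ (-x.2.1).re * Real.exp (Real.pi * |(-x.2.1).im|)), fun s hs => ?_⟩
  have h1 := formPoly_re_pos q (P := fun b => P (Sum.inr b)) (fun b => hP _) hs
  have h2 := formPoly_re_pos p (P := fun a => P (Sum.inl a)) (fun b => hP _) hs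
  have hV : ‖∏ e, (simplexPoint s e : ℂ) ^ x.2.2 e‖ = ∏ e, simplexPoint s e ^ (x.2.2 e).re := by
    rw [norm_prod]
    exact Finset.prod_congr rfl fun e _ => Complex.norm_cpow_eq_rpow_re_of_pos (hs e) _
  rw [simplexIntegrand_eq, norm_mul, norm_mul, hV]
  refine mul_le_mul_of_nonneg_right ?_ (Finset.prod_nonneg fun e _ => Real.rpow_nonneg (hs e).le _)
  have ne0 : ∀ {z : ℂ}, 0 < z.re → z ≠ 0 := fun hz h => by simp [h] at hz
  refine mul_le_mul ?_ ?_ (norm_nonneg _) (by positivity)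
  · exact Complex.norm_cpow_le_of_re_pos (ne0 h1) (norm_formPoly_le_sum q _ hs
      (simplexPoint_le_one hs)) hx.1.le
  · exact Complex.norm_cpow_le_of_re_pos (ne0 h2) (norm_formPoly_le_sum p _ hs
      (simplexPoint_le_one hs)) (by simpa using hx.2.1.le)

theorem MeasureTheory.IntegrableOn.simplexPoint_mul {f : (Fin k → ℝ) → ℂ}
    (hf : IntegrableOn f (openSimplex k)) (e : Fin (k + 1)) :
    IntegrableOn (fun s => (simplexPoint s e : ℂ) * f s) (openSimplex k) := by
  refine Integrable.mono hf (AEStronglyMeasurable.mul ?_ hf.aestronglyMeasurable) ?_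
  · exact (Complex.continuous_ofReal.comp
      ((continuous_apply e).comp continuous_simplexPoint)).aestronglyMeasurable
  · refine (ae_restrict_iff' isOpen_openSimplex.measurableSet).2 (Eventually.of_forall fun s hs => ?_)
    rw [norm_mul, Complex.norm_real, Real.norm_of_nonneg (hs e).le]
    exact mul_le_of_le_one_left (norm_nonneg _) (simplexPoint_le_one hs e)

/-- A vector `ξ` whose coordinates sum to zero is tangent to the simplex. -/
theorem simplexPoint_add_smul {ξ : Fin (k + 1) → ℝ} (hξ : ∑ e, ξ e = 0) (s : Fin k → ℝ) (τ : ℝ)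
    (e : Fin (k + 1)) : simplexPoint (s + τ • fun l => ξ l.succ) e = simplexPoint s e + τ * ξ e := by
  refine Fin.cases ?_ (fun i => ?_) e
  · rw [Fin.sum_univ_succ] at hξ
    simp only [simplexPoint, Fin.cons_zero, Pi.add_apply, Pi.smul_apply, smul_eq_mul,
      Finset.sum_add_distrib, ← Finset.mul_sum]
    linear_combination (-τ) * hξ
  · simp [simplexPoint]

theorem integrableOn_simplexIntegrandLogDeriv (hp : IsGreedy p) (hq : IsGreedy q) {x : Exps k}
    (hx : x ∈ convDomain p q) {P : α ⊕ β → ℂ} (hP : P ∈ posRe (α ⊕ β)) (e : Fin (k + 1)) :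
    IntegrableOn (fun s => simplexIntegrandLogDeriv p q x P (simplexPoint s) e) (openSimplex k) := by
  refine Integrable.add (integrable_finsetSum _ fun a _ => ?_) ?_
  · exact ((integrableOn_simplexIntegrand hp hq (add_expShift_mem_facetDomain p q hx a)
      hP).const_mul _).const_mul _
  · exact (integrableOn_simplexIntegrand hp hq hx hP).const_mul _

/-- The divergence theorem on the simplex in the direction of an edge. -/
theorem integral_simplexIntegrand_edge (hp : IsGreedy p) (hq : IsGreedy q) {x : Exps k}
    (hx : x ∈ initialDomain k) {P : α ⊕ β → ℂ} (hP : P ∈ posRe (α ⊕ β)) (i j : Fin (k + 1)) :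
    ∫ s in openSimplex k, (simplexPoint s j * (simplexIntegrand p q x P (simplexPoint s) +
        simplexIntegrandLogDeriv p q x P (simplexPoint s) i) -
      simplexPoint s i * (simplexIntegrand p q x P (simplexPoint s) +
        simplexIntegrandLogDeriv p q x P (simplexPoint s) j)) = 0 := by
  classical
  have := hp.nonempty
  have := hq.nonempty
  rcases eq_or_ne i j with rfl | hij
  · simp
  have hxc : x ∈ convDomain p q := initialDomain_subset_convDomain hx
  set F := fun s : Fin k → ℝ => simplexIntegrand p q x P (simplexPoint s) with hF
  set D := fun (s : Fin k → ℝ) e => simplexIntegrandLogDeriv p q x P (simplexPoint s) e with hD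
  have hFi : IntegrableOn F (openSimplex k) := integrableOn_simplexIntegrand hp hq hxc hP
  have hDi : ∀ e, IntegrableOn (fun s => D s e) (openSimplex k) :=
    integrableOn_simplexIntegrandLogDeriv hp hq hxc hP
  have hmeas := (isOpen_openSimplex (k := k)).measurableSet
  let g : (Fin k → ℝ) → ℂ := (openSimplex k).indicator fun s =>
    (simplexPoint s i : ℂ) * (simplexPoint s j * F s)
  let g' : (Fin k → ℝ) → ℂ := (openSimplex k).indicator fun s =>
    simplexPoint s j * (F s + D s i) - simplexPoint s i * (F s + D s j)
  have hg : Integrable g := (integrable_indicator_iff hmeas).2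
    ((hFi.simplexPoint_mul j).simplexPoint_mul i)
  have hg' : Integrable g' := (integrable_indicator_iff hmeas).2
    (((hFi.add (hDi i)).simplexPoint_mul j).sub ((hFi.add (hDi j)).simplexPoint_mul i))
  let ξ : Fin (k + 1) → ℝ := Pi.single i 1 - Pi.single j 1
  have hξ : ∑ e, ξ e = 0 := by simp [ξ]
  have hξi : ξ i = 1 := by simp [ξ, hij]
  have hξj : ξ j = -1 := by simp [ξ, hij.symm]
  have hξe : ∀ e, e ≠ i → e ≠ j → ξ e = 0 := fun e h1 h2 => by simp [ξ, h1, h2]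
  have hline : ∀ s, HasLineDerivAt ℝ g (g' s) s (fun l => ξ l.succ) := by
    intro s
    by_cases hs : s ∈ openSimplex k
    · have h1 := hasDerivAt_simplexIntegrand_line (p := p) (q := q) x hP hs ξ
      have hlin : ∀ e, HasDerivAt (fun τ : ℝ => ((simplexPoint s e + τ * ξ e : ℝ) : ℂ)) (ξ e) 0 := by
        intro e
        have : HasDerivAt (fun τ : ℝ => simplexPoint s e + τ * ξ e) (ξ e) 0 := by
          simpa using ((hasDerivAt_id (0 : ℝ)).mul_const (ξ e)).const_add (simplexPoint s e)
        exact this.ofReal_comp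
      have h2 := (hlin i).mul ((hlin j).mul h1)
      have hc : Continuous fun τ : ℝ => s + τ • fun l : Fin k => ξ l.succ := by fun_prop
      have hev : ∀ᶠ τ : ℝ in 𝓝 0, s + τ • (fun l : Fin k => ξ l.succ) ∈ openSimplex k :=
        hc.continuousAt.eventually_mem (isOpen_openSimplex.mem_nhds (by simpa using hs))
      have h3 : (fun τ : ℝ => g (s + τ • fun l => ξ l.succ)) =ᶠ[𝓝 0]
          fun τ : ℝ => ((simplexPoint s i + τ * ξ i : ℝ) : ℂ) *
            (((simplexPoint s j + τ * ξ j : ℝ) : ℂ) *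
              simplexIntegrand p q x P fun e => simplexPoint s e + τ * ξ e) := by
        filter_upwards [hev] with τ hτ
        simp only [g, Set.indicator_of_mem hτ, hF]
        rw [← funext fun e => simplexPoint_add_smul hξ s τ e, simplexPoint_add_smul hξ,
          simplexPoint_add_smul hξ]
      refine (h2.congr_of_eventuallyEq h3).congr_deriv ?_
      have h4 : ∑ e, (ξ e / simplexPoint s e : ℝ) *
            simplexIntegrandLogDeriv p q x P (simplexPoint s) e =
          D s i / simplexPoint s i - D s j / simplexPoint s j := by
        rw [Finset.sum_eq_add i j hij (fun e _ he => by rw [hξe e he.1 he.2]; simp) (by simp)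
          (by simp), hξi, hξj]
        push_cast
        ring
      have hi : (simplexPoint s i : ℂ) ≠ 0 := Complex.ofReal_ne_zero.2 (hs i).ne'
      have hj : (simplexPoint s j : ℂ) ≠ 0 := Complex.ofReal_ne_zero.2 (hs j).ne'
      simp only [h4, g', Set.indicator_of_mem hs, hξi, hξj, hF, zero_mul, add_zero, Pi.mul_apply]
      push_cast
      field_simp
      ring
    · -- outside of the simplex, the function is bounded by a power of the distance
      obtain ⟨K, hK⟩ := exists_norm_simplexIntegrand_le_prod_rpow (p := p) (q := q) hx hP
      have hg0 : g s = 0 := Set.indicator_of_notMem hs _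
      have hg'0 : g' s = 0 := Set.indicator_of_notMem hs _
      rw [hg'0]
      obtain ⟨e, he⟩ : ∃ e, simplexPoint s e ≤ 0 := by
        by_contra! h
        exact hs h
      have hbound : ∀ τ : ℝ, ‖g (s + τ • fun l => ξ l.succ)‖ ≤
          |K| * |τ| ^ (x.2.2 e).re * |τ| := by
        intro τ
        by_cases hτ : s + τ • (fun l : Fin k => ξ l.succ) ∈ openSimplex k
        · set s' := s + τ • (fun l : Fin k => ξ l.succ) with hs'
          have hpt : ∀ l, simplexPoint s' l = simplexPoint s l + τ * ξ l := fun l =>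
            simplexPoint_add_smul hξ s τ l
          have hle1 := simplexPoint_le_one hτ
          have hle : simplexPoint s' e ≤ |τ| := by
            rw [hpt]
            by_cases h1 : e = i
            · rw [h1] at he ⊢
              rw [hξi]
              linarith [le_abs_self τ]
            · by_cases h2 : e = j
              · rw [h2] at he ⊢
                rw [hξj]
                linarith [neg_le_abs τ]
              · rw [hξe e h1 h2]
                linarith [abs_nonneg τ]
          have heij : e = i ∨ e = j := by
            by_contra! h
            have := hτ e
            rw [hpt, hξe e h.1 h.2] at this
            linarith
          simp only [g, Set.indicator_of_mem hτ]
          rw [norm_mul, norm_mul, Complex.norm_real, Complex.norm_real,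
            Real.norm_of_nonneg (hτ i).le, Real.norm_of_nonneg (hτ j).le, ← mul_assoc]
          have h5 : simplexPoint s' i * simplexPoint s' j ≤ |τ| := by
            rcases heij with rfl | rfl
            · exact (mul_le_of_le_one_right (hτ _).le (hle1 j)).trans hle
            · exact (mul_le_of_le_one_left (hτ _).le (hle1 i)).trans hle
          have h6 : ‖F s'‖ ≤ |K| * |τ| ^ (x.2.2 e).re := by
            refine (hK s' hτ).trans (mul_le_mul (le_abs_self K) ?_ (Finset.prod_nonneg fun l _ =>
              Real.rpow_nonneg (hτ l).le _) (abs_nonneg K))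
            rw [← Finset.mul_prod_erase _ _ (Finset.mem_univ e)]
            refine (mul_le_of_le_one_right (Real.rpow_nonneg (hτ e).le _) (Finset.prod_le_one
              (fun l _ => Real.rpow_nonneg (hτ l).le _) fun l _ =>
                Real.rpow_le_one (hτ l).le (hle1 l) (hx.2.2 l).le)).trans ?_
            exact Real.rpow_le_rpow (hτ e).le hle (hx.2.2 e).le
          calc _ ≤ |τ| * (|K| * |τ| ^ (x.2.2 e).re) :=
                mul_le_mul h5 h6 (norm_nonneg _) (abs_nonneg _)
            _ = _ := by ring
        · simp only [g, Set.indicator_of_notMem hτ, norm_zero]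
          positivity
      rw [HasLineDerivAt, hasDerivAt_iff_isLittleO]
      simp only [zero_smul, add_zero, hg0, sub_zero, smul_zero]
      refine Asymptotics.IsLittleO.of_bound fun c hc => ?_
      have h7 : Tendsto (fun τ : ℝ => |K| * |τ| ^ (x.2.2 e).re) (𝓝 0) (𝓝 0) := by
        have : ContinuousAt (fun τ : ℝ => |K| * |τ| ^ (x.2.2 e).re) 0 :=
          continuousAt_const.mul (continuous_abs.continuousAt.rpow_const (Or.inr (hx.2.2 e).le))
        simpa [ContinuousAt, Real.zero_rpow (hx.2.2 e).ne'] using this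
      filter_upwards [h7.eventually_lt_const hc] with τ hτ
      exact (hbound τ).trans (mul_le_mul_of_nonneg_right hτ.le (abs_nonneg τ))
  have key := integral_bilinear_hasLineDerivAt_right_eq_neg_left_of_integrable
    (μ := (volume : Measure (Fin k → ℝ))) (f := fun _ => (1 : ℂ)) (f' := fun _ => 0) (g := g)
    (g' := g') (v := fun l => ξ l.succ) (B := ContinuousLinearMap.mul ℝ ℂ)
    (by simp) (by simpa using hg') (by simpa using hg)
    (fun s _ => hasDerivAt_const (0 : ℝ) (1 : ℂ)) (fun s _ => hline s)
  simp only [ContinuousLinearMap.mul_apply', one_mul, zero_mul, integral_zero, neg_zero, g'] at key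
  rwa [integral_indicator hmeas] at key

end SimplexIntegral

section SimplexIntegral

open MeasureTheory FeynmanGraph

variable {k : ℕ}

variable {α β : Type*} [Fintype α] [Fintype β]
  {p : α → Fin (k + 1) → ℕ} {q : β → Fin (k + 1) → ℕ}

theorem isOpen_initialDomain : IsOpen (initialDomain k) := by
  have : initialDomain k =
      {x | 0 < x.1.re} ∩ ({x | x.2.1.re < 0} ∩ ⋂ e, {x | 0 < (x.2.2 e).re}) := by
    ext
    simp [initialDomain]
  rw [this]
  refine (isOpen_lt continuous_const (by fun_prop)).inter
    ((isOpen_lt (by fun_prop) continuous_const).inter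
      (isOpen_iInter_of_finite fun e => isOpen_lt continuous_const (by fun_prop)))

theorem initialDomain_nonempty : (initialDomain k).Nonempty :=
  ⟨(1, -1, fun _ => 1), by simp [initialDomain]⟩

/-- A family of exponent vectors of monomials of the same degree. -/
def IsHomogeneousFamily {ι : Type*} (q : ι → Fin (k + 1) → ℕ) : Prop :=
  ∀ i, ∑ e, q i e = minDegree q Finset.univ

/-- Euler's theorem on homogeneous functions. -/
theorem sum_simplexIntegrandLogDeriv [Nonempty α] [Nonempty β] (hph : IsHomogeneousFamily p)
    (hqh : IsHomogeneousFamily q) (x : Exps k) {P : α ⊕ β → ℂ} (hP : P ∈ posRe (α ⊕ β))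
    {t : Fin (k + 1) → ℝ} (ht : ∀ e, 0 < t e) :
    ∑ e, (simplexIntegrand p q x P t + simplexIntegrandLogDeriv p q x P t e) =
      facetForm p q Finset.univ x * simplexIntegrand p q x P t := by
  have h1 : ∑ e, ∑ a, (Sum.elim p q a e : ℂ) * P a * (expFactor α β x a *
      simplexIntegrand p q (x + expShift p q a) P t) =
      (x.1 * minDegree q Finset.univ - x.2.1 * minDegree p Finset.univ) *
        simplexIntegrand p q x P t := by
    have h2 : ∀ a, ∑ e, (Sum.elim p q a e : ℂ) * P a * (expFactor α β x a *
        simplexIntegrand p q (x + expShift p q a) P t) = ((∑ e, Sum.elim p q a e : ℕ) : ℂ) *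
          expFactor α β x a * (P a * simplexIntegrand p q (x + expShift p q a) P t) := fun a => by
      push_cast
      simp only [Finset.sum_mul]
      exact Finset.sum_congr rfl fun e _ => by ring
    rw [Finset.sum_comm, Finset.sum_congr rfl fun a _ => h2 a, Fintype.sum_sum_type]
    simp only [Sum.elim_inl, Sum.elim_inr, hph _, hqh _, expFactor, ← Finset.mul_sum]
    rw [sum_mul_simplexIntegrand_expShift_inl x hP ht, sum_mul_simplexIntegrand_expShift_inr x hP ht]
    ring
  simp only [simplexIntegrandLogDeriv, Finset.sum_add_distrib, h1, facetForm, Finset.sum_const,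
    Finset.card_univ, Fintype.card_fin, nsmul_eq_mul, add_mul, Finset.sum_mul]
  ring

/-- The Euler relation for the degree in the variable `t_e`, in the domain where the boundary terms
of the integration by parts vanish. -/
theorem euler_relation_of_mem_initialDomain (hp : IsGreedy p) (hq : IsGreedy q)
    (hph : IsHomogeneousFamily p) (hqh : IsHomogeneousFamily q) {x : Exps k}
    (hx : x ∈ initialDomain k) {P : α ⊕ β → ℂ} (hP : P ∈ posRe (α ⊕ β)) (e : Fin (k + 1)) :
    ∑ a, (Sum.elim p q a e : ℂ) * P a * (expFactor α β x a *
        simplexIntegral p q (x + expShift p q a) P) + (1 + x.2.2 e) * simplexIntegral p q x P =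
      facetForm p q Finset.univ x * simplexIntegral p q (x + expUnit e) P := by
  have := hp.nonempty
  have := hq.nonempty
  have hxc : x ∈ convDomain p q := initialDomain_subset_convDomain hx
  have hF := integrableOn_simplexIntegrand hp hq hxc hP
  have hD := integrableOn_simplexIntegrandLogDeriv hp hq hxc hP
  have hFe := integrableOn_simplexIntegrand hp hq (add_expUnit_mem_facetDomain p q hxc e) hP
  -- sum the divergence theorem over all the edges which contain the vertex number `e`
  have key : ∫ s in openSimplex k, ((simplexIntegrand p q x P (simplexPoint s) +
      simplexIntegrandLogDeriv p q x P (simplexPoint s) e) - facetForm p q Finset.univ x *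
        simplexIntegrand p q (x + expUnit e) P (simplexPoint s)) = 0 := by
    rw [← Finset.sum_const_zero (s := (Finset.univ : Finset (Fin (k + 1)))),
      ← Finset.sum_congr rfl fun j _ => integral_simplexIntegrand_edge hp hq hx hP e j,
      ← integral_finsetSum]
    · refine setIntegral_congr_fun isOpen_openSimplex.measurableSet fun s hs => ?_
      simp only [Finset.sum_sub_distrib, ← Finset.sum_mul, ← Finset.mul_sum]
      rw [sum_simplexIntegrandLogDeriv hph hqh x hP hs, simplexIntegrand_expUnit x P hs,
        ← Complex.ofReal_sum, sum_simplexPoint]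
      push_cast
      ring
    · exact fun j _ => ((hF.add (hD e)).simplexPoint_mul j).sub ((hF.add (hD j)).simplexPoint_mul e)
  have hFD : IntegrableOn (fun s => simplexIntegrand p q x P (simplexPoint s) +
      simplexIntegrandLogDeriv p q x P (simplexPoint s) e) (openSimplex k) := hF.add (hD e)
  rw [integral_sub hFD (hFe.const_mul _), integral_const_mul, sub_eq_zero,
    ← simplexIntegral_eq, integral_add hF (hD e), ← simplexIntegral_eq] at key
  rw [← key]
  simp only [simplexIntegrandLogDeriv]
  rw [integral_add (integrable_finsetSum _ fun a _ => ?_) (hF.const_mul _), integral_finsetSum,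
    integral_const_mul, ← simplexIntegral_eq]
  · simp only [integral_const_mul, ← simplexIntegral_eq]
    ring
  · exact fun a _ => ((integrableOn_simplexIntegrand hp hq (add_expShift_mem_facetDomain p q hxc a)
      hP).const_mul _).const_mul _
  · exact ((integrableOn_simplexIntegrand hp hq (add_expShift_mem_facetDomain p q hxc a)
      hP).const_mul _).const_mul _

omit [Fintype α] [Fintype β] in
theorem analyticOnNhd_facetForm (I : Finset (Fin (k + 1))) :
    AnalyticOnNhd ℂ (facetForm p q I) Set.univ := by
  have : Differentiable ℂ (facetForm p q I) := by
    unfold facetForm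
    fun_prop
  exact this.differentiableOn.analyticOnNhd_of_finiteDimensional isOpen_univ

/-- The Euler relation for the degree in the variable `t_e`. -/
theorem euler_relation (hp : IsGreedy p) (hq : IsGreedy q)
    (hph : IsHomogeneousFamily p) (hqh : IsHomogeneousFamily q) {x : Exps k}
    (hx : x ∈ convDomain p q) {P : α ⊕ β → ℂ} (hP : P ∈ posRe (α ⊕ β)) (e : Fin (k + 1)) :
    ∑ a, (Sum.elim p q a e : ℂ) * P a * (expFactor α β x a *
        simplexIntegral p q (x + expShift p q a) P) + (1 + x.2.2 e) * simplexIntegral p q x P =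
      facetForm p q Finset.univ x * simplexIntegral p q (x + expUnit e) P := by
  have hF : ∀ y : Exps k, (∀ x ∈ convDomain p q, x + y ∈ convDomain p q) →
      AnalyticOnNhd ℂ (fun x => simplexIntegral p q (x + y) P) (convDomain p q) := fun y hy =>
    (analyticOnNhd_simplexIntegral hp hq).1.comp (f := fun x => (x + y, P))
      (fun x _ => ((analyticAt_id (𝕜 := ℂ)).add analyticAt_const).prod analyticAt_const)
      fun x hx => ⟨hy x hx, hP⟩
  obtain ⟨x₀, hx₀⟩ := initialDomain_nonempty (k := k)
  refine AnalyticOnNhd.eqOn_of_preconnected_of_eventuallyEq (𝕜 := ℂ) (f := fun x : Exps k =>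
    ∑ a, (Sum.elim p q a e : ℂ) * P a * (expFactor α β x a *
        simplexIntegral p q (x + expShift p q a) P) + (1 + x.2.2 e) * simplexIntegral p q x P)
    (g := fun x : Exps k => facetForm p q Finset.univ x * simplexIntegral p q (x + expUnit e) P)
    (U := convDomain p q) ?_ ?_ (convex_facetDomain p q 0).isPreconnected
    (initialDomain_subset_convDomain hx₀) ?_ hx
  · have hlin : ∀ {f : Exps k → ℂ}, Differentiable ℂ f → AnalyticOnNhd ℂ f (convDomain p q) :=
      fun hf => (DifferentiableOn.analyticOnNhd_of_finiteDimensional hf.differentiableOn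
        isOpen_univ).mono (Set.subset_univ _)
    refine AnalyticOnNhd.add (Finset.analyticOnNhd_fun_sum _ fun a _ =>
      AnalyticOnNhd.mul analyticOnNhd_const (AnalyticOnNhd.mul (hlin ?_) (hF _ fun x hx =>
        add_expShift_mem_facetDomain p q hx a))) ?_
    · rcases a with a | b
      · simp only [expFactor]
        fun_prop
      · simp only [expFactor]
        fun_prop
    · refine AnalyticOnNhd.mul (hlin (by fun_prop)) ?_
      simpa using hF 0 (by simp)
  · exact AnalyticOnNhd.mul ((analyticOnNhd_facetForm _).mono (Set.subset_univ _))
      (hF _ fun x hx => add_expUnit_mem_facetDomain p q hx e)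
  · filter_upwards [isOpen_initialDomain.mem_nhds hx₀] with x hx
    exact euler_relation_of_mem_initialDomain hp hq hph hqh hx hP e

end SimplexIntegral

/-! ### Meromorphic continuation by recursion -/

theorem Complex.inv_Gamma_eq_ascPochhammer_mul (z : ℂ) (n : ℕ) :
    (Complex.Gamma z)⁻¹ = (ascPochhammer ℂ n).eval z * (Complex.Gamma (z + n))⁻¹ := by
  induction n with
  | zero => simp
  | succ n ih =>
    rw [ih, Complex.one_div_Gamma_eq_self_mul_one_div_Gamma_add_one (z + n), ascPochhammer_succ_eval]
    push_cast
    rw [add_assoc z]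
    ring

section SimplexIntegral

open MeasureTheory FeynmanGraph

variable {k : ℕ}

/-- The nonempty proper subsets of the set of variables; these are the faces of the simplex along
which the integrand can be singular. -/
abbrev Facet (k : ℕ) : Type := {I : Finset (Fin (k + 1)) // I.Nonempty ∧ I ≠ Finset.univ}

section

variable {α β : Type*} (p : α → Fin (k + 1) → ℕ) (q : β → Fin (k + 1) → ℕ)

/-- The excess of the degree in the variables in `I` over the minimal one. -/
noncomputable def degreeExcess (a : α ⊕ β) (I : Finset (Fin (k + 1))) : ℕ :=
  Sum.elim (fun a => ∑ e ∈ I, p a e - minDegree p I) (fun b => ∑ e ∈ I, q b e - minDegree q I) a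

theorem facetForm_expShift (I : Finset (Fin (k + 1))) (x : Exps k) (a : α ⊕ β) :
    facetForm p q I (x + expShift p q a) = facetForm p q I x + degreeExcess p q a I := by
  rcases a with a | b
  · exact facetForm_expShift_inl p q I x a
  · exact facetForm_expShift_inr p q I x b

/-- The product of the reciprocal Gamma functions of the facet forms; it cancels all the poles of
the integral. -/
noncomputable def poleFactor (x : Exps k) : ℂ :=
  ∏ I : Facet k, (Complex.Gamma (facetForm p q I.1 x))⁻¹

/-- A neighbourhood of the domain of convergence, with a different bound for every facet form. -/
def facetRegion (R : Facet k → ℕ) : Set (Exps k) :=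
  {x | ∀ I : Facet k, -(R I : ℝ) < (facetForm p q I.1 x).re}

/-- The polynomial by which the factors `1 / Γ` change under a translation of the exponents which
increases the facet forms by the natural numbers `n`; the first step in the direction `I₀` is left
out. -/
noncomputable def shiftFactor (n : Facet k → ℕ) (I₀ : Facet k) (x : Exps k) : ℂ :=
  (∏ I ∈ Finset.univ.erase I₀, (ascPochhammer ℂ (n I)).eval (facetForm p q I.1 x)) *
    (ascPochhammer ℂ (n I₀ - 1)).eval (facetForm p q I₀.1 x + 1)

variable {p q}

theorem differentiable_facetForm (I : Finset (Fin (k + 1))) :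
    Differentiable ℂ (facetForm p q I) := by
  unfold facetForm
  fun_prop

theorem analyticOnNhd_poleFactor : AnalyticOnNhd ℂ (poleFactor p q) Set.univ := by
  have : Differentiable ℂ (poleFactor p q) := by
    have h : ∀ I : Facet k, Differentiable ℂ fun x => (Complex.Gamma (facetForm p q I.1 x))⁻¹ :=
      fun I => Complex.differentiable_one_div_Gamma.comp (differentiable_facetForm I.1)
    unfold poleFactor
    fun_prop
  exact this.differentiableOn.analyticOnNhd_of_finiteDimensional isOpen_univ

theorem poleFactor_ne_zero {x : Exps k} (hx : x ∈ convDomain p q) : poleFactor p q x ≠ 0 :=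
  Finset.prod_ne_zero_iff.2 fun I _ =>
    inv_ne_zero (Complex.Gamma_ne_zero_of_re_pos (hx I.1 I.2.1 I.2.2))

theorem analyticOnNhd_shiftFactor (n : Facet k → ℕ) (I₀ : Facet k) :
    AnalyticOnNhd ℂ (shiftFactor p q n I₀) Set.univ := by
  have : Differentiable ℂ (shiftFactor p q n I₀) := by
    have h : ∀ I : Facet k, Differentiable ℂ (facetForm p q I.1) := fun I =>
      differentiable_facetForm I.1
    have h' : ∀ (n : ℕ) {f : Exps k → ℂ}, Differentiable ℂ f →
        Differentiable ℂ fun x => (ascPochhammer ℂ n).eval (f x) :=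
      fun n f hf => (ascPochhammer ℂ n).differentiable.fun_comp hf
    have h1 : ∀ I : Facet k, Differentiable ℂ fun x =>
        (ascPochhammer ℂ (n I)).eval (facetForm p q I.1 x) := fun I => h' _ (h I)
    have h2 := h' (n I₀ - 1) ((h I₀).add_const 1)
    unfold shiftFactor
    fun_prop
  exact this.differentiableOn.analyticOnNhd_of_finiteDimensional isOpen_univ

/-- By the functional equation of the Gamma function, the right-hand side is what remains of
`poleFactor p q x` when the factor `facetForm p q I₀ x` is taken out. -/
theorem shiftFactor_mul_poleFactor {n : Facet k → ℕ} {I₀ : Facet k} (hn₀ : n I₀ ≠ 0) {x s : Exps k}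
    (hn : ∀ I : Facet k, facetForm p q I.1 (x + s) = facetForm p q I.1 x + n I) :
    shiftFactor p q n I₀ x * poleFactor p q (x + s) =
      (∏ I ∈ Finset.univ.erase I₀, (Complex.Gamma (facetForm p q I.1 x))⁻¹) *
        (Complex.Gamma (facetForm p q I₀.1 x + 1))⁻¹ := by
  simp only [poleFactor, shiftFactor, hn]
  rw [← Finset.prod_erase_mul _ _ (Finset.mem_univ I₀), mul_mul_mul_comm, ← Finset.prod_mul_distrib]
  congr 1
  · exact Finset.prod_congr rfl fun I _ => (Complex.inv_Gamma_eq_ascPochhammer_mul _ _).symm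
  · rw [Complex.inv_Gamma_eq_ascPochhammer_mul (facetForm p q I₀.1 x + 1) (n I₀ - 1)]
    have : (n I₀ : ℂ) = 1 + ((n I₀ - 1 : ℕ) : ℂ) := by
      rw [← Nat.cast_one, ← Nat.cast_add, Nat.add_sub_cancel' (Nat.one_le_iff_ne_zero.2 hn₀)]
    rw [this, add_assoc]

end

variable {α β : Type*} [Fintype α] [Fintype β]
  {p : α → Fin (k + 1) → ℕ} {q : β → Fin (k + 1) → ℕ}

/-- The recursion for the integral which belongs to a face of the simplex.  All the integrals on the
right-hand side converge on a larger domain in the direction of `I`. -/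
theorem facetForm_mul_simplexIntegral (hp : IsGreedy p) (hq : IsGreedy q)
    (hph : IsHomogeneousFamily p) (hqh : IsHomogeneousFamily q) {x : Exps k}
    (hx : x ∈ convDomain p q) {P : α ⊕ β → ℂ} (hP : P ∈ posRe (α ⊕ β))
    (I : Finset (Fin (k + 1))) :
    facetForm p q I x * simplexIntegral p q x P =
      ∑ e ∈ I, facetForm p q Finset.univ x * simplexIntegral p q (x + expUnit e) P -
        ∑ a, (degreeExcess p q a I : ℂ) * (P a * expFactor α β x a) *
          simplexIntegral p q (x + expShift p q a) P := by
  have h1 := Finset.sum_congr (rfl : I = I) fun e _ => euler_relation hp hq hph hqh hx hP e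
  rw [← h1, Finset.sum_add_distrib, Finset.sum_comm, Fintype.sum_sum_type, Fintype.sum_sum_type]
  have h2 := sum_mul_simplexIntegral_expShift_inl hp hq hx hP
  have h3 := sum_mul_simplexIntegral_expShift_inr hp hq hx hP
  have h4 : ∀ a, ∑ e ∈ I, (Sum.elim p q (Sum.inl a) e : ℂ) * P (Sum.inl a) *
      (expFactor α β x (Sum.inl a) * simplexIntegral p q (x + expShift p q (Sum.inl a)) P) -
      (degreeExcess p q (Sum.inl a) I : ℂ) * (P (Sum.inl a) * expFactor α β x (Sum.inl a)) *
          simplexIntegral p q (x + expShift p q (Sum.inl a)) P =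
      -x.2.1 * minDegree p I * (P (Sum.inl a) *
        simplexIntegral p q (x + expShift p q (Sum.inl a)) P) := fun a => by
    simp only [degreeExcess, Sum.elim_inl, Nat.cast_sub (minDegree_le p I a), expFactor,
      ← Finset.sum_mul]
    push_cast
    ring
  have h5 : ∀ b, ∑ e ∈ I, (Sum.elim p q (Sum.inr b) e : ℂ) * P (Sum.inr b) *
      (expFactor α β x (Sum.inr b) * simplexIntegral p q (x + expShift p q (Sum.inr b)) P) -
      (degreeExcess p q (Sum.inr b) I : ℂ) * (P (Sum.inr b) * expFactor α β x (Sum.inr b)) *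
          simplexIntegral p q (x + expShift p q (Sum.inr b)) P =
      x.1 * minDegree q I * (P (Sum.inr b) *
        simplexIntegral p q (x + expShift p q (Sum.inr b)) P) := fun b => by
    simp only [degreeExcess, Sum.elim_inr, Nat.cast_sub (minDegree_le q I b), expFactor,
      ← Finset.sum_mul]
    push_cast
    ring
  have h6 := Finset.sum_congr (rfl : (Finset.univ : Finset α) = _) fun a _ => h4 a
  have h7 := Finset.sum_congr (rfl : (Finset.univ : Finset β) = _) fun b _ => h5 b
  rw [Finset.sum_sub_distrib, ← Finset.mul_sum, h2] at h6
  rw [Finset.sum_sub_distrib, ← Finset.mul_sum, h3] at h7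
  rw [← Finset.sum_mul]
  simp only [facetForm]
  rw [Finset.sum_congr (rfl : I = I) fun e _ => add_comm (x.2.2 e) 1]
  linear_combination -h6 - h7

/-- The integral, with its poles cancelled, extends to the given region. -/
def HasRegularization (p : α → Fin (k + 1) → ℕ) (q : β → Fin (k + 1) → ℕ) (R : Facet k → ℕ) :
    Prop :=
  ∃ G : Exps k → (α ⊕ β → ℂ) → ℂ,
    AnalyticOnNhd ℂ (Function.uncurry G) (facetRegion p q R ×ˢ posRe (α ⊕ β)) ∧
    ∀ x ∈ convDomain p q, ∀ P ∈ posRe (α ⊕ β), G x P = poleFactor p q x * simplexIntegral p q x P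

/-- The region is enlarged by one unit in the direction of `I₀`: each integral in the recursion has
exponents whose facet form of `I₀` is larger by a positive integer, unless its coefficient is
zero. -/
theorem HasRegularization.add_single (hp : IsGreedy p) (hq : IsGreedy q)
    (hph : IsHomogeneousFamily p) (hqh : IsHomogeneousFamily q) {R R' : Facet k → ℕ} {I₀ : Facet k}
    (hR : HasRegularization p q R) (hR₀ : R' I₀ = R I₀ + 1) (hRI : ∀ I ≠ I₀, R' I = R I) :
    HasRegularization p q R' := by
  classical
  obtain ⟨G, hG, hGeq⟩ := hR
  have hmem : ∀ {x s : Exps k} {n : Facet k → ℕ}, x ∈ facetRegion p q R' → n I₀ ≠ 0 →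
      (∀ I : Facet k, facetForm p q I.1 (x + s) = facetForm p q I.1 x + n I) →
      x + s ∈ facetRegion p q R := by
    intro x s n hx hn₀ hn I
    have h1 := hx I
    rw [hn, Complex.add_re, Complex.natCast_re]
    by_cases hI : I = I₀
    · subst hI
      have h2 : (1 : ℝ) ≤ n I := by exact_mod_cast Nat.one_le_iff_ne_zero.2 hn₀
      rw [hR₀] at h1
      push_cast at h1
      linarith
    · rw [hRI I hI] at h1
      linarith [Nat.cast_nonneg (α := ℝ) (n I)]
  let nU : Fin (k + 1) → Facet k → ℕ := fun e I => if e ∈ I.1 then 1 else 0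
  let nS : α ⊕ β → Facet k → ℕ := fun a I => degreeExcess p q a I.1
  have hnU : ∀ e x, ∀ I : Facet k,
      facetForm p q I.1 (x + expUnit e) = facetForm p q I.1 x + nU e I :=
    fun e x I => facetForm_expUnit p q I.1 x e
  have hnS : ∀ a x, ∀ I : Facet k, facetForm p q I.1 (x + expShift p q a) =
      facetForm p q I.1 x + nS a I := fun a x I => facetForm_expShift p q I.1 x a
  have hnU₀ : ∀ e ∈ I₀.1, nU e I₀ ≠ 0 := fun e he => by simp [nU, he]
  refine ⟨fun x P => ∑ e ∈ I₀.1, facetForm p q Finset.univ x * (shiftFactor p q (nU e) I₀ x *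
      G (x + expUnit e) P) - ∑ a, (nS a I₀ : ℂ) * (P a * expFactor α β x a) *
        (shiftFactor p q (nS a) I₀ x * G (x + expShift p q a) P), ?_, ?_⟩
  · have hfst : ∀ {f : Exps k → ℂ}, AnalyticOnNhd ℂ f Set.univ → AnalyticOnNhd ℂ
        (fun y : Exps k × (α ⊕ β → ℂ) => f y.1) (facetRegion p q R' ×ˢ posRe (α ⊕ β)) :=
      fun hf y _ => (hf y.1 trivial).comp_of_eq analyticAt_fst rfl
    have hGs : ∀ {s : Exps k}, (∀ x ∈ facetRegion p q R', x + s ∈ facetRegion p q R) →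
        AnalyticOnNhd ℂ (fun y : Exps k × (α ⊕ β → ℂ) => G (y.1 + s) y.2)
          (facetRegion p q R' ×ˢ posRe (α ⊕ β)) := fun {s} hs y hy =>
      (hG (y.1 + s, y.2) ⟨hs y.1 hy.1, hy.2⟩).comp_of_eq (g := Function.uncurry G)
        (f := fun y : Exps k × (α ⊕ β → ℂ) => (y.1 + s, y.2))
        ((analyticAt_fst.add analyticAt_const).prod analyticAt_snd) rfl
    refine AnalyticOnNhd.sub (Finset.analyticOnNhd_fun_sum _ fun e he => AnalyticOnNhd.mul
      (hfst (analyticOnNhd_facetForm _)) (AnalyticOnNhd.mul (hfst (analyticOnNhd_shiftFactor _ _))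
        (hGs fun x hx => hmem hx (hnU₀ e he) (hnU e x))))
      (Finset.analyticOnNhd_fun_sum _ fun a _ => ?_)
    by_cases ha : nS a I₀ = 0
    · simp only [ha, Nat.cast_zero, zero_mul]
      exact analyticOnNhd_const
    · refine AnalyticOnNhd.mul (AnalyticOnNhd.mul analyticOnNhd_const (AnalyticOnNhd.mul ?_
        (hfst (f := fun x => expFactor α β x a) ?_))) (AnalyticOnNhd.mul
          (hfst (analyticOnNhd_shiftFactor _ _)) (hGs fun x hx => hmem hx ha (hnS a x)))
      · exact (((ContinuousLinearMap.proj (R := ℂ) (φ := fun _ : α ⊕ β => ℂ) a).comp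
          (ContinuousLinearMap.snd ℂ (Exps k) (α ⊕ β → ℂ))).analyticOnNhd _)
      · have : Differentiable ℂ fun x : Exps k => expFactor α β x a := by
          rcases a with a | b
          · simp only [expFactor]
            fun_prop
          · simp only [expFactor]
            fun_prop
        exact this.differentiableOn.analyticOnNhd_of_finiteDimensional isOpen_univ
  · intro x hx P hP
    have h1 : poleFactor p q x = (∏ I ∈ Finset.univ.erase I₀,
        (Complex.Gamma (facetForm p q I.1 x))⁻¹) * (Complex.Gamma (facetForm p q I₀.1 x + 1))⁻¹ *
          facetForm p q I₀.1 x := by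
      rw [poleFactor, ← Finset.prod_erase_mul _ _ (Finset.mem_univ I₀),
        Complex.one_div_Gamma_eq_self_mul_one_div_Gamma_add_one (facetForm p q I₀.1 x)]
      ring
    rw [h1, mul_assoc, facetForm_mul_simplexIntegral hp hq hph hqh hx hP, mul_sub, Finset.mul_sum,
      Finset.mul_sum]
    refine congrArg₂ (fun z w : ℂ => z - w) ?_ ?_
    · refine Finset.sum_congr rfl fun e he => ?_
      rw [hGeq _ (add_expUnit_mem_facetDomain p q hx e) P hP,
        ← shiftFactor_mul_poleFactor (hnU₀ e he) (hnU e x)]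
      ring
    · refine Finset.sum_congr rfl fun a _ => ?_
      by_cases ha : nS a I₀ = 0
      · have ha' : degreeExcess p q a I₀.1 = 0 := ha
        simp [ha, ha']
      · rw [hGeq _ (add_expShift_mem_facetDomain p q hx a) P hP,
          ← shiftFactor_mul_poleFactor ha (hnS a x)]
        ring

theorem hasRegularization (hp : IsGreedy p) (hq : IsGreedy q)
    (hph : IsHomogeneousFamily p) (hqh : IsHomogeneousFamily q) (R : Facet k → ℕ) :
    HasRegularization p q R := by
  classical
  induction hm : ∑ I, R I generalizing R with
  | zero =>
    have hR : facetRegion p q R = convDomain p q := by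
      have : ∀ I, R I = 0 := by simpa using hm
      ext x
      simp [facetRegion, convDomain, this]
    refine ⟨fun x P => poleFactor p q x * simplexIntegral p q x P, ?_, fun x _ P _ => rfl⟩
    rw [hR]
    refine AnalyticOnNhd.mul (fun y _ => ?_) (analyticOnNhd_simplexIntegral hp hq).1
    exact (analyticOnNhd_poleFactor y.1 trivial).comp_of_eq analyticAt_fst rfl
  | succ m ih =>
    obtain ⟨I₀, hI₀⟩ : ∃ I₀, R I₀ ≠ 0 := by
      by_contra! h
      simp [h] at hm
    refine HasRegularization.add_single hp hq hph hqh (I₀ := I₀)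
      (ih (Function.update R I₀ (R I₀ - 1)) ?_) ?_ fun I hI => ?_
    · rw [Finset.sum_update_of_mem (Finset.mem_univ _)]
      rw [← Finset.add_sum_erase _ _ (Finset.mem_univ I₀), ← Finset.sdiff_singleton_eq_erase] at hm
      omega
    · rw [Function.update_self]
      omega
    · rw [Function.update_of_ne hI]

/-- The integral times `poleFactor` continues to an entire function of the exponents. -/
theorem exists_entire_simplexIntegral (hp : IsGreedy p) (hq : IsGreedy q)
    (hph : IsHomogeneousFamily p) (hqh : IsHomogeneousFamily q) :
    ∃ G : Exps k → (α ⊕ β → ℂ) → ℂ,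
      AnalyticOnNhd ℂ (Function.uncurry G) (Set.univ ×ˢ posRe (α ⊕ β)) ∧
      ∀ x ∈ convDomain p q, ∀ P ∈ posRe (α ⊕ β),
        G x P = poleFactor p q x * simplexIntegral p q x P := by
  choose G hG hGeq using fun r : ℕ => hasRegularization hp hq hph hqh fun _ => r
  have hreg : ∀ r : ℕ, facetRegion p q (fun _ => r) = facetDomain p q (-r) := fun r => by
    ext x
    exact ⟨fun h I h1 h2 => h ⟨I, h1, h2⟩, fun h I => h I.1 I.2.1 I.2.2⟩
  simp only [hreg] at hG
  have hcov : ∀ x : Exps k, ∃ r : ℕ, x ∈ facetDomain p q (-r) := fun x => by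
    have h1 : ∀ᶠ r : ℕ in atTop, ∀ I : Finset (Fin (k + 1)), -(r : ℝ) < (facetForm p q I x).re := by
      rw [eventually_all]
      intro I
      filter_upwards [tendsto_natCast_atTop_atTop.eventually_gt_atTop (-(facetForm p q I x).re)]
        with r hr
      linarith
    obtain ⟨r, hr⟩ := h1.exists
    exact ⟨r, fun I _ _ => hr I⟩
  have hmono : ∀ {r r' : ℕ}, r ≤ r' → facetDomain p q (-r) ⊆ facetDomain p q (-r') :=
    fun {r r'} hrr x hx I h1 h2 => by
      have h3 : (r : ℝ) ≤ r' := by exact_mod_cast hrr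
      linarith [hx I h1 h2]
  have hagree : ∀ {r r' : ℕ}, r ≤ r' → ∀ x ∈ facetDomain p q (-r), ∀ P ∈ posRe (α ⊕ β),
      G r x P = G r' x P := by
    intro r r' hrr x hx P hP
    have hsec : ∀ i, AnalyticOnNhd ℂ (fun x => G i x P) (facetDomain p q (-i)) := fun i x hx =>
      (hG i (x, P) ⟨hx, hP⟩).comp_of_eq (g := Function.uncurry (G i)) (f := fun x => (x, P))
        (analyticAt_id.prod analyticAt_const) rfl
    obtain ⟨x₀, hx₀⟩ := initialDomain_nonempty (k := k)
    have hx₀c : x₀ ∈ facetDomain p q 0 := initialDomain_subset_convDomain hx₀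
    refine (hsec r).eqOn_of_preconnected_of_eventuallyEq ((hsec r').mono (hmono hrr))
      (convex_facetDomain p q _).isPreconnected (z₀ := x₀) ?_ ?_ hx
    · have := @hmono 0 r (Nat.zero_le r) x₀
      simp only [Nat.cast_zero, neg_zero] at this
      exact this hx₀c
    · filter_upwards [(isOpen_facetDomain p q 0).mem_nhds hx₀c] with x hx
      rw [hGeq r x hx P hP, hGeq r' x hx P hP]
  choose r hr using hcov
  have hglue : ∀ {i : ℕ} {x}, x ∈ facetDomain p q (-i) → ∀ P ∈ posRe (α ⊕ β),
      G (r x) x P = G i x P := fun {i x} hx P hP => by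
    rcases le_total (r x) i with h | h
    · exact hagree h x (hr x) P hP
    · exact (hagree h x hx P hP).symm
  refine ⟨fun x P => G (r x) x P, ?_, fun x hx P hP => hGeq _ x hx P hP⟩
  rintro ⟨x, P⟩ ⟨-, hP⟩
  refine (hG (r x) (x, P) ⟨hr x, hP⟩).congr ?_
  filter_upwards [((isOpen_facetDomain p q _).prod isOpen_posRe).mem_nhds
    (show (x, P) ∈ facetDomain p q (-(r x : ℝ)) ×ˢ posRe (α ⊕ β) from ⟨hr x, hP⟩)] with y hy
  exact (hglue hy.1 y.2 hy.2).symm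

end SimplexIntegral

/-! ### The GKZ equations for the integral over the simplex -/

section SimplexIntegral

open MeasureTheory FeynmanGraph

variable {k : ℕ} {α β : Type*} [Fintype α] [Fintype β]
  {p : α → Fin (k + 1) → ℕ} {q : β → Fin (k + 1) → ℕ}

/-- The iterated derivative of the integral with respect to the coefficients, with multiplicities
`ν`. -/
noncomputable def shiftedIntegral (p : α → Fin (k + 1) → ℕ) (q : β → Fin (k + 1) → ℕ) (x : Exps k)
    (ν : α ⊕ β → ℕ) (P : α ⊕ β → ℂ) : ℂ :=
  (∏ j ∈ Finset.range (∑ a, ν (Sum.inl a)), (-x.2.1 - j)) *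
    (∏ j ∈ Finset.range (∑ b, ν (Sum.inr b)), (x.1 - j)) *
      simplexIntegral p q (x + ∑ a, ν a • expShift p q a) P

theorem add_sum_expShift_mem_convDomain {x : Exps k} (hx : x ∈ convDomain p q) (ν : α ⊕ β → ℕ) :
    x + ∑ a, ν a • expShift p q a ∈ convDomain p q := by
  have h1 : ∀ (a : α ⊕ β) (n : ℕ) {y : Exps k}, y ∈ convDomain p q →
      y + n • expShift p q a ∈ convDomain p q := by
    intro a n
    induction n with
    | zero => simp
    | succ n ih =>
      intro y hy
      rw [succ_nsmul, ← add_assoc]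
      exact add_expShift_mem_facetDomain p q (ih hy) a
  have h2 : ∀ s : Finset (α ⊕ β), x + ∑ a ∈ s, ν a • expShift p q a ∈ convDomain p q := by
    classical
    intro s
    induction s using Finset.induction_on with
    | empty => simpa using hx
    | insert a s ha ih =>
      rw [Finset.sum_insert ha, add_comm (ν a • _), ← add_assoc]
      exact h1 a _ ih
  exact h2 _

theorem sum_nsmul_expShift_fst (ν : α ⊕ β → ℕ) :
    (∑ a, ν a • expShift p q a).1 = -((∑ b, ν (Sum.inr b) : ℕ) : ℂ) := by
  simp [Prod.fst_sum, expShift]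

theorem sum_nsmul_expShift_snd_fst (ν : α ⊕ β → ℕ) :
    (∑ a, ν a • expShift p q a).2.1 = ((∑ a, ν (Sum.inl a) : ℕ) : ℂ) := by
  simp [Prod.snd_sum, Prod.fst_sum, expShift]

theorem sum_nsmul_expShift_snd_snd (ν : α ⊕ β → ℕ) (e : Fin (k + 1)) :
    (∑ a, ν a • expShift p q a).2.2 e = ((∑ a, ν a * Sum.elim p q a e : ℕ) : ℂ) := by
  simp [Prod.snd_sum, expShift]

/-- The exponent `x` is translated by `∑ a, ν a • expShift p q a`, which does not depend on the
order of the derivatives. -/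
theorem partialDeriv_shiftedIntegral [DecidableEq (α ⊕ β)] (hp : IsGreedy p) (hq : IsGreedy q)
    {x : Exps k} (hx : x ∈ convDomain p q) (ν : α ⊕ β → ℕ) (a : α ⊕ β) :
    Set.EqOn (partialDeriv a (shiftedIntegral p q x ν)) (shiftedIntegral p q x (ν + Pi.single a 1))
      (posRe (α ⊕ β)) := by
  intro P hP
  have h1 := (analyticOnNhd_simplexIntegral hp hq).2 _ (add_sum_expShift_mem_convDomain hx ν) P hP a
  have h2 : ∑ a', (ν + Pi.single a 1 : α ⊕ β → ℕ) a' • expShift p q a' =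
      ∑ a', ν a' • expShift p q a' + expShift p q a := by
    simp only [Pi.add_apply, add_smul, Finset.sum_add_distrib]
    congr 1
    rw [Finset.sum_eq_single a]
    · simp
    · intro a' _ ha'
      simp [ha']
    · simp
  unfold shiftedIntegral
  rw [partialDeriv_const_mul]
  simp only [h1, h2, ← add_assoc x]
  rcases a with a | b
  · have h3 : ∑ a', (ν + Pi.single (Sum.inl a) 1 : α ⊕ β → ℕ) (Sum.inl a') =
        ∑ a', ν (Sum.inl a') + 1 := by
      simp only [Pi.add_apply, Finset.sum_add_distrib, Pi.single_apply, Finset.sum_boole]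
      rw [Finset.card_eq_one.2 ⟨a, by ext; simp⟩, Nat.cast_one]
    have h4 : ∀ b, (ν + Pi.single (Sum.inl a) 1 : α ⊕ β → ℕ) (Sum.inr b) = ν (Sum.inr b) := by
      simp
    simp only [h3, h4, Finset.prod_range_succ, expFactor, Prod.snd_add, Prod.fst_add,
      sum_nsmul_expShift_snd_fst]
    ring
  · have h3 : ∑ b', (ν + Pi.single (Sum.inr b) 1 : α ⊕ β → ℕ) (Sum.inr b') =
        ∑ b', ν (Sum.inr b') + 1 := by
      simp only [Pi.add_apply, Finset.sum_add_distrib, Pi.single_apply, Finset.sum_boole]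
      rw [Finset.card_eq_one.2 ⟨b, by ext; simp⟩, Nat.cast_one]
    have h4 : ∀ a, (ν + Pi.single (Sum.inr b) 1 : α ⊕ β → ℕ) (Sum.inl a) = ν (Sum.inl a) := by
      simp
    simp only [h3, h4, Finset.prod_range_succ, expFactor, Prod.fst_add,
      sum_nsmul_expShift_fst]
    ring

theorem monomialDeriv_simplexIntegral (hp : IsGreedy p) (hq : IsGreedy q)
    {x : Exps k} (hx : x ∈ convDomain p q) (ν : α ⊕ β → ℕ) :
    Set.EqOn (monomialDeriv ν (simplexIntegral p q x)) (shiftedIntegral p q x ν)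
      (posRe (α ⊕ β)) := by
  classical
  have hiter : ∀ (μ : α ⊕ β → ℕ) (a : α ⊕ β) (n : ℕ),
      Set.EqOn ((partialDeriv a)^[n] (shiftedIntegral p q x μ))
        (shiftedIntegral p q x (μ + Pi.single a n)) (posRe (α ⊕ β)) := by
    intro μ a n
    induction n with
    | zero => simp [Set.eqOn_refl]
    | succ n ih =>
      rw [Function.iterate_succ_apply']
      refine (partialDeriv_congr isOpen_posRe ih a).trans ?_
      rw [Pi.single_add, ← add_assoc]
      exact partialDeriv_shiftedIntegral hp hq hx _ a
  have hfold : ∀ l : List (α ⊕ β), Set.EqOn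
      (l.foldr (fun a g => (partialDeriv a)^[ν a] g) (simplexIntegral p q x))
      (shiftedIntegral p q x (l.map fun a => Pi.single a (ν a)).sum) (posRe (α ⊕ β)) := by
    intro l
    induction l with
    | nil =>
      intro P _
      simp [shiftedIntegral]
    | cons a l ih =>
      rw [List.foldr_cons, List.map_cons, List.sum_cons, add_comm]
      exact (iterate_partialDeriv_congr isOpen_posRe ih a _).trans (hiter _ a _)
  have hsum : ((Finset.univ : Finset (α ⊕ β)).toList.map fun a => Pi.single a (ν a)).sum = ν := by
    rw [Finset.sum_map_toList, Finset.univ_sum_single]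
  have := hfold Finset.univ.toList
  rwa [hsum] at this

/-- The box equations hold since the two differential monomials translate the exponents by the same
vector. -/
theorem boxOp_simplexIntegral (hp : IsGreedy p) (hq : IsGreedy q) (hph : IsHomogeneousFamily p)
    (hqh : IsHomogeneousFamily q) (hq0 : minDegree q Finset.univ ≠ 0) {x : Exps k}
    (hx : x ∈ convDomain p q) {r : α ⊕ β → ℤ} (hr0 : ∑ a, r (Sum.inl a) = 0)
    (hr : ∀ e, ∑ a, r a * (Sum.elim p q a e : ℕ) = 0) {P : α ⊕ β → ℂ}
    (hP : P ∈ posRe (α ⊕ β)) : boxOp r (simplexIntegral p q x) P = 0 := by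
  have hsub : ∀ {ι : Type _} [Fintype ι] (s : ι → ℤ) (w : ι → ℕ), ∑ i, s i * (w i : ℤ) = 0 →
      ∑ i, (s i).toNat * w i = ∑ i, (-s i).toNat * w i := by
    intro ι _ s w h
    zify
    rw [← sub_eq_zero, ← Finset.sum_sub_distrib, ← h]
    refine Finset.sum_congr rfl fun i _ => ?_
    rw [← sub_mul]
    congr 1
    exact Int.toNat_sub_toNat_neg (s i)
  have hα : ∑ a, (r (Sum.inl a)).toNat = ∑ a, (-r (Sum.inl a)).toNat := by
    have : ∑ a, r (Sum.inl a) = ∑ a, ((r (Sum.inl a)).toNat - (-r (Sum.inl a)).toNat : ℤ) :=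
      Finset.sum_congr rfl fun a _ => (Int.toNat_sub_toNat_neg _).symm
    rw [hr0, Finset.sum_sub_distrib] at this
    zify
    linarith
  have he : ∀ e, ∑ a, (r a).toNat * Sum.elim p q a e = ∑ a, (-r a).toNat * Sum.elim p q a e :=
    fun e => hsub r _ (hr e)
  -- the number of derivatives with respect to coefficients of `Q` is found by counting degrees
  have hβ : ∑ b, (r (Sum.inr b)).toNat = ∑ b, (-r (Sum.inr b)).toNat := by
    have hdeg : ∀ ν : α ⊕ β → ℕ, ∑ e, ∑ a, ν a * Sum.elim p q a e =
        (∑ a, ν (Sum.inl a)) * minDegree p Finset.univ +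
          (∑ b, ν (Sum.inr b)) * minDegree q Finset.univ := by
      intro ν
      rw [Finset.sum_comm, Fintype.sum_sum_type]
      simp only [Sum.elim_inl, Sum.elim_inr, ← Finset.mul_sum, hph _, hqh _, Finset.sum_mul]
    have h1 := hdeg fun a => (r a).toNat
    rw [Finset.sum_congr rfl fun e _ => he e, hdeg fun a => (-r a).toNat, hα] at h1
    exact Nat.eq_of_mul_eq_mul_right (Nat.pos_of_ne_zero hq0) (Nat.add_left_cancel h1).symm
  rw [boxOp, sub_eq_zero, monomialDeriv_simplexIntegral hp hq hx _ hP,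
    monomialDeriv_simplexIntegral hp hq hx _ hP, shiftedIntegral, shiftedIntegral, hα, hβ]
  congr 3
  refine Prod.ext ?_ (Prod.ext ?_ (funext fun e => ?_))
  · rw [sum_nsmul_expShift_fst, sum_nsmul_expShift_fst, hβ]
  · rw [sum_nsmul_expShift_snd_fst, sum_nsmul_expShift_snd_fst, hα]
  · rw [sum_nsmul_expShift_snd_snd, sum_nsmul_expShift_snd_snd, he]

/-- The homogeneity of the integral in the coefficients of `Ψ`. -/
theorem eulerOp_zero_simplexIntegral (hp : IsGreedy p) (hq : IsGreedy q) {x : Exps k}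
    (hx : x ∈ convDomain p q) {P : α ⊕ β → ℂ} (hP : P ∈ posRe (α ⊕ β)) :
    eulerOp (Sum.elim (fun _ : α => (1 : ℤ)) fun _ : β => 0) (simplexIntegral p q x) P =
      -x.2.1 * simplexIntegral p q x P := by
  simp only [eulerOp, (analyticOnNhd_simplexIntegral hp hq).2 x hx P hP, Fintype.sum_sum_type,
    Sum.elim_inl, Sum.elim_inr, expFactor, Int.cast_one, Int.cast_zero, zero_mul, one_mul,
    Finset.sum_const_zero, add_zero]
  rw [← sum_mul_simplexIntegral_expShift_inl hp hq hx hP, Finset.mul_sum]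
  exact Finset.sum_congr rfl fun a _ => by ring

/-- The Euler relation as a differential equation; the term with the translated exponent drops out
if the integrand is homogeneous of degree `-n`, which is the case for all the exponents of an
amplitude. -/
theorem eulerOp_simplexIntegral (hp : IsGreedy p) (hq : IsGreedy q) (hph : IsHomogeneousFamily p)
    (hqh : IsHomogeneousFamily q) {x : Exps k} (hx : x ∈ convDomain p q) {P : α ⊕ β → ℂ}
    (hP : P ∈ posRe (α ⊕ β)) (e : Fin (k + 1)) :
    eulerOp (fun a => (Sum.elim p q a e : ℤ)) (simplexIntegral p q x) P =
      facetForm p q Finset.univ x * simplexIntegral p q (x + expUnit e) P -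
        (1 + x.2.2 e) * simplexIntegral p q x P := by
  rw [← euler_relation hp hq hph hqh hx hP e, add_sub_cancel_right]
  simp only [eulerOp, (analyticOnNhd_simplexIntegral hp hq).2 x hx P hP]
  exact Finset.sum_congr rfl fun a _ => by push_cast; ring

/-- If there is no monomial in `Q`, then the integral vanishes where it is defined. -/
theorem simplexIntegral_eq_zero [IsEmpty β] {x : Exps k} (hx : x ∈ initialDomain k)
    (P : α ⊕ β → ℂ) : simplexIntegral p q x P = 0 := by
  have h1 : x.1 ≠ 0 := fun h => by simpa [h] using hx.1
  simp [simplexIntegral, simplexIntegrand, formPoly, h1]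

end SimplexIntegral

/-! ### Spanning trees and cuts as a matroid -/

section Independence

variable {ι M : Type*} [AddCommGroup M] [Module ℝ M]
  {c : ι → M}

theorem LinearIndepOn.finrank_span_image {S : Finset ι} (hS : LinearIndepOn ℝ c (S : Set ι)) :
    Module.finrank ℝ (Submodule.span ℝ (c '' S)) = S.card := by
  have h := finrank_span_eq_card (R := ℝ) (b := fun i : (S : Set ι) => c i) hS
  have h2 : Set.range (fun i : (S : Set ι) => c i) = c '' S := by
    ext
    simp
  rw [h2] at h
  rw [h]
  simp

theorem LinearIndepOn.card_le_finrank_span_image {S W : Finset ι}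
    (hS : LinearIndepOn ℝ c (S : Set ι)) (hSW : S ⊆ W) :
    S.card ≤ Module.finrank ℝ (Submodule.span ℝ (c '' W)) := by
  have : FiniteDimensional ℝ (Submodule.span ℝ (c '' W)) :=
    FiniteDimensional.span_of_finite ℝ (W.finite_toSet.image c)
  rw [← hS.finrank_span_image]
  exact Submodule.finrank_mono (Submodule.span_mono (Set.image_mono hSW))

theorem LinearIndepOn.card_eq_finrank_span_image {S W : Finset ι}
    (hS : LinearIndepOn ℝ c (S : Set ι)) (hSW : S ⊆ W)
    (hW : c '' W ⊆ Submodule.span ℝ (c '' S)) :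
    S.card = Module.finrank ℝ (Submodule.span ℝ (c '' W)) := by
  rw [← hS.finrank_span_image, Submodule.span_eq_of_le _ hW
    (Submodule.span_mono (Set.image_mono hSW))]

/-- The greedy algorithm: there is an independent set which contains a basis of the span of every
superlevel set of the weight. -/
theorem exists_linearIndepOn_forall_superlevel [Finite ι] (c : ι → M) (w : ι → ℝ) :
    ∃ S : Set ι, LinearIndepOn ℝ c S ∧
      ∀ l, c '' {e | l ≤ w e} ⊆ Submodule.span ℝ (c '' (S ∩ {e | l ≤ w e})) := by
  classical
  have := Fintype.ofFinite ι
  have key : ∀ L : Finset ℝ, ∃ S : Set ι, LinearIndepOn ℝ c S ∧ (∀ e ∈ S, ∃ l ∈ L, l ≤ w e) ∧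
      ∀ l ∈ L, c '' {e | l ≤ w e} ⊆ Submodule.span ℝ (c '' (S ∩ {e | l ≤ w e})) := by
    intro L
    induction L using Finset.induction_on_min with
    | empty => exact ⟨∅, linearIndepOn_empty _ _, by simp, by simp⟩
    | insert a L ha ih =>
      obtain ⟨S, hS, hSL, hspan⟩ := ih
      have hSa : S ⊆ {e | a ≤ w e} := fun e he => by
        obtain ⟨l, hl, hle⟩ := hSL e he
        exact (ha l hl).le.trans hle
      obtain ⟨b, hba, hSb, hab, hb⟩ := exists_linearIndepOn_extension hS hSa
      refine ⟨b, hb, fun e he => ⟨a, Finset.mem_insert_self _ _, hba he⟩, fun l hl => ?_⟩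
      rcases Finset.mem_insert.1 hl with rfl | hl
      · rwa [Set.inter_eq_self_of_subset_left hba]
      · exact (hspan l hl).trans (Submodule.span_mono
          (Set.image_mono (Set.inter_subset_inter_left _ hSb)))
  obtain ⟨S, hS, -, hspan⟩ := key (Finset.univ.image w)
  refine ⟨S, hS, fun l => ?_⟩
  rcases (Finset.univ.filter fun e => l ≤ w e).eq_empty_or_nonempty with h | h
  · have : {e | l ≤ w e} = (∅ : Set ι) := by
      ext e
      simpa using Finset.ext_iff.1 h e
    simp [this]
  · obtain ⟨e₀, he₀, hmin⟩ := Finset.exists_min_image _ w h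
    have h1 : {e | l ≤ w e} = {e | w e₀ ≤ w e} := by
      ext e
      have h2 : l ≤ w e₀ := by simpa using he₀
      exact ⟨fun he => hmin e (by simpa using he), fun he => h2.trans he⟩
    rw [h1]
    exact hspan _ (Finset.mem_image_of_mem _ (Finset.mem_univ _))

end Independence

namespace FeynmanGraph

variable {V : Type*} {n : ℕ} (Γ : FeynmanGraph V n)

/-- The boundary of an edge. -/
noncomputable def edgeVec (e : Fin n) : V → ℝ := Γ.boundary (Pi.single e 1)

open Classical in
theorem edgeVec_eq (e : Fin n) :
    Γ.edgeVec e = Pi.single (Γ.tgt e) 1 - Pi.single (Γ.src e) 1 := by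
  ext u
  simp only [edgeVec, boundary, LinearMap.pi_apply, LinearMap.sum_apply, LinearMap.smul_apply,
    LinearMap.proj_apply, Pi.sub_apply, smul_eq_mul]
  rw [Finset.sum_eq_single e]
  · simp [Pi.single_apply, eq_comm]
  · intro e' _ he'
    simp [he']
  · simp

theorem span_range_edgeVec :
    Submodule.span ℝ (Set.range Γ.edgeVec) = LinearMap.range Γ.boundary := by
  have h1 : Set.range Γ.edgeVec = Γ.boundary '' Set.range (Pi.basisFun ℝ (Fin n)) := by
    rw [← Set.range_comp]
    congr 1
    ext e
    simp [edgeVec]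
  rw [h1, ← Submodule.map_span, Module.Basis.span_eq, Submodule.map_top]

variable {Γ}

theorem Joined.refl (S : Finset (Fin n)) (u : V) : Γ.Joined S u u := Relation.EqvGen.refl u

theorem Joined.symm {S : Finset (Fin n)} {u v : V} (h : Γ.Joined S u v) : Γ.Joined S v u :=
  Relation.EqvGen.symm _ _ h

theorem Joined.trans {S : Finset (Fin n)} {u v w : V} (h : Γ.Joined S u v) (h' : Γ.Joined S v w) :
    Γ.Joined S u w :=
  Relation.EqvGen.trans _ _ _ h h'

theorem joined_of_mem {S : Finset (Fin n)} {e : Fin n} (he : e ∈ S) :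
    Γ.Joined S (Γ.src e) (Γ.tgt e) :=
  Relation.EqvGen.rel _ _ ⟨e, he, rfl, rfl⟩

theorem Connected.finite (hΓ : Γ.Connected) : Finite V := by
  obtain ⟨⟨u₀⟩, h⟩ := hΓ
  have h1 : ∀ {u v : V}, Γ.Joined Finset.univ u v → u = v ∨
      (u ∈ Set.range Γ.src ∪ Set.range Γ.tgt ∧ v ∈ Set.range Γ.src ∪ Set.range Γ.tgt) := by
    intro u v huv
    induction huv with
    | rel x y h =>
      obtain ⟨e, -, rfl, rfl⟩ := h
      exact Or.inr ⟨Or.inl ⟨e, rfl⟩, Or.inr ⟨e, rfl⟩⟩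
    | refl x => exact Or.inl rfl
    | symm x y _ ih => exact ih.imp Eq.symm And.symm
    | trans x y z _ _ ih ih' =>
      rcases ih with rfl | ih
      · exact ih'
      · rcases ih' with rfl | ih'
        · exact Or.inr ih
        · exact Or.inr ⟨ih.1, ih'.2⟩
  have h2 : (Set.univ : Set V) ⊆ {u₀} ∪ (Set.range Γ.src ∪ Set.range Γ.tgt) := fun u _ =>
    (h1 (h u u₀)).imp id And.left
  exact Set.finite_univ_iff.1 (((Set.finite_singleton _).union
    ((Set.finite_range _).union (Set.finite_range _))).subset h2)

open Classical in
/-- Two vertices are joined by the edges in `S` if and only if their difference is a boundary of a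
chain on `S`. -/
theorem joined_iff_mem_span [Finite V] (S : Finset (Fin n)) (u v : V) :
    Γ.Joined S u v ↔ (Pi.single v 1 - Pi.single u 1 : V → ℝ) ∈
      Submodule.span ℝ (Γ.edgeVec '' S) := by
  have := Fintype.ofFinite V
  constructor
  · intro h
    induction h with
    | rel x y h =>
      obtain ⟨e, he, rfl, rfl⟩ := h
      rw [← edgeVec_eq]
      exact Submodule.subset_span ⟨e, he, rfl⟩
    | refl x => simp
    | symm x y _ ih =>
      rw [← neg_sub]
      exact Submodule.neg_mem _ ih
    | trans x y z _ _ ih ih' =>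
      rw [← sub_add_sub_cancel _ (Pi.single y 1)]
      exact Submodule.add_mem _ ih' ih
  · intro h
    -- pair with the indicator function of the component of `u`
    let χ : (V → ℝ) →ₗ[ℝ] ℝ := ∑ x, (if Γ.Joined S u x then (1 : ℝ) else 0) • LinearMap.proj x
    have hχ : ∀ x, χ (Pi.single x 1) = if Γ.Joined S u x then 1 else 0 := by
      intro x
      simp only [χ, LinearMap.sum_apply, LinearMap.smul_apply, LinearMap.proj_apply, smul_eq_mul]
      rw [Finset.sum_eq_single x]
      · simp
      · intro y _ hy
        simp [hy]
      · simp
    have h0 : Submodule.span ℝ (Γ.edgeVec '' S) ≤ LinearMap.ker χ := by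
      rw [Submodule.span_le]
      rintro _ ⟨e, he, rfl⟩
      have h1 : Γ.Joined S u (Γ.src e) ↔ Γ.Joined S u (Γ.tgt e) :=
        ⟨fun h => h.trans (joined_of_mem he), fun h => h.trans (joined_of_mem he).symm⟩
      rw [SetLike.mem_coe, LinearMap.mem_ker, edgeVec_eq, map_sub, hχ, hχ]
      simp only [h1, sub_self]
    have h2 := h0 h
    rw [LinearMap.mem_ker, map_sub, hχ, hχ, if_pos (Joined.refl S u)] at h2
    by_contra h3
    rw [if_neg h3] at h2
    norm_num at h2

/-- Forests are the linearly independent sets of edges. -/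
theorem isForest_iff [Finite V] (S : Finset (Fin n)) :
    Γ.IsForest S ↔ LinearIndepOn ℝ Γ.edgeVec (S : Set (Fin n)) := by
  classical
  rw [linearIndepOn_iff_notMem_span]
  refine forall₂_congr fun e _ => not_congr ?_
  rw [joined_iff_mem_span, edgeVec_eq, Finset.coe_erase]

/-- The edge sets which connect the graph are those which span. -/
theorem connectedBy_iff (hΓ : Γ.Connected) (S : Finset (Fin n)) :
    Γ.ConnectedBy S ↔ Set.range Γ.edgeVec ⊆ Submodule.span ℝ (Γ.edgeVec '' S) := by
  classical
  have := hΓ.finite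
  constructor
  · rintro ⟨-, h⟩ _ ⟨e, rfl⟩
    rw [edgeVec_eq]
    exact (joined_iff_mem_span S _ _).1 (h _ _)
  · refine fun h => ⟨hΓ.1, fun u v => (joined_iff_mem_span S u v).2 ?_⟩
    have h1 := (joined_iff_mem_span Finset.univ u v).1 (hΓ.2 u v)
    rw [Finset.coe_univ, Set.image_univ] at h1
    exact Submodule.span_le.2 h h1

variable (Γ) in
/-- The number of edges of a spanning tree. -/
noncomputable def treeRank : ℕ :=
  Module.finrank ℝ (Submodule.span ℝ (Γ.edgeVec '' (Finset.univ : Finset (Fin n))))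

theorem treeRank_add_loopNumber : Γ.treeRank + Γ.loopNumber = n := by
  rw [treeRank, loopNumber, Finset.coe_univ, Set.image_univ, span_range_edgeVec]
  simpa using LinearMap.finrank_range_add_finrank_ker Γ.boundary

/-- Spanning trees are the bases among the sets of edges. -/
theorem isSpanningTree_iff (hΓ : Γ.Connected) (S : Finset (Fin n)) :
    Γ.IsSpanningTree S ↔ LinearIndepOn ℝ Γ.edgeVec (S : Set (Fin n)) ∧ S.card = Γ.treeRank := by
  have := hΓ.finite
  rw [IsSpanningTree, connectedBy_iff hΓ, isForest_iff, and_comm]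
  refine and_congr_right fun hS => ⟨fun h => ?_, fun h => ?_⟩
  · exact hS.card_eq_finrank_span_image (Finset.subset_univ S) (by simpa using h)
  · have h1 : Submodule.span ℝ (Γ.edgeVec '' S) =
        Submodule.span ℝ (Γ.edgeVec '' (Finset.univ : Finset (Fin n))) := by
      refine Submodule.eq_of_le_of_finrank_eq (Submodule.span_mono (Set.image_mono (by simp))) ?_
      rw [hS.finrank_span_image, h, treeRank]
    rw [h1, Finset.coe_univ, Set.image_univ]
    exact Submodule.subset_span

/-- The complements of cuts are the independent sets with one element less than a basis. -/
theorem isCut_iff (hΓ : Γ.Connected) (C : Finset (Fin n)) :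
    Γ.IsCut C ↔ LinearIndepOn ℝ Γ.edgeVec (Cᶜ : Finset (Fin n)) ∧ Cᶜ.card + 1 = Γ.treeRank := by
  have := hΓ.finite
  rw [IsCut, isForest_iff]
  refine and_congr_right fun hS => ⟨fun ⟨h1, h2⟩ => ?_, fun h => ⟨fun hc => ?_, fun e he => ?_⟩⟩
  · rw [connectedBy_iff hΓ, Set.range_subset_iff] at h1
    push Not at h1
    obtain ⟨e, he⟩ := h1
    have h3 := hS.notMem_span_iff.1 he
    have heC : e ∈ C := by simpa using h3.2
    rw [← Finset.coe_insert] at h3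
    rcases h2 e heC with h4 | h4
    · exact absurd ((isForest_iff _).2 h3.1) h4
    · rw [← ((isSpanningTree_iff hΓ _).1 ⟨h4, (isForest_iff _).2 h3.1⟩).2,
        Finset.card_insert_of_notMem (by simpa using heC)]
  · have := ((isSpanningTree_iff hΓ _).1 ⟨hc, (isForest_iff _).2 hS⟩).2
    omega
  · by_cases hf : Γ.IsForest (insert e Cᶜ)
    · right
      refine ((isSpanningTree_iff hΓ _).2 ⟨(isForest_iff _).1 hf, ?_⟩).1
      rw [Finset.card_insert_of_notMem (by simpa using he), h]
    · exact Or.inl hf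

/-- The exponent vectors of the monomials of the first Symanzik polynomial. -/
def treeExp (S : Γ.SpanTree) : Fin n → ℕ := expVec (S.1)ᶜ

theorem sum_expVec (W C : Finset (Fin n)) : ∑ e ∈ W, expVec C e = (W ∩ C).card := by
  simp only [expVec, Finset.sum_boole, Nat.cast_id]
  congr 1

theorem sum_expVec_compl_add (W S : Finset (Fin n)) :
    ∑ e ∈ W, expVec Sᶜ e + (S ∩ W).card = W.card := by
  rw [sum_expVec, Finset.inter_comm S W, ← Finset.sdiff_eq_inter_compl,
    Finset.card_sdiff_add_card_inter]

/-- A spanning tree which contains a basis of every superlevel set of the weight. -/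
theorem exists_isSpanningTree_forall_superlevel (hΓ : Γ.Connected) (w : Fin n → ℝ) :
    ∃ S, Γ.IsSpanningTree S ∧ ∀ (F : Finset (Fin n)),
      LinearIndepOn ℝ Γ.edgeVec (F : Set (Fin n)) → ∀ l : ℝ,
        (F ∩ Finset.univ.filter fun e => l ≤ w e).card ≤
          (S ∩ Finset.univ.filter fun e => l ≤ w e).card := by
  classical
  obtain ⟨S', hS', hspan⟩ := exists_linearIndepOn_forall_superlevel Γ.edgeVec w
  obtain ⟨S, rfl⟩ : ∃ S : Finset (Fin n), (S : Set (Fin n)) = S' :=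
    ⟨S'.toFinset, by simp⟩
  have hcard : ∀ l : ℝ, (S ∩ Finset.univ.filter fun e => l ≤ w e).card =
      Module.finrank ℝ (Submodule.span ℝ (Γ.edgeVec '' (Finset.univ.filter fun e => l ≤ w e))) := by
    intro l
    have h1 : LinearIndepOn ℝ Γ.edgeVec
      ((S ∩ Finset.univ.filter fun e => l ≤ w e : Finset (Fin n)) :
      Set (Fin n)) := hS'.mono (by simp)
    refine h1.card_eq_finrank_span_image Finset.inter_subset_right ?_
    simpa using hspan l
  obtain ⟨l₀, hl₀⟩ : ∃ l : ℝ, ∀ e, l ≤ w e := by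
    obtain ⟨l, hl⟩ := (Set.finite_range w).bddBelow
    exact ⟨l, fun e => hl ⟨e, rfl⟩⟩
  refine ⟨S, (isSpanningTree_iff hΓ S).2 ⟨hS', ?_⟩, fun F hF l => ?_⟩
  · have h1 : (Finset.univ.filter fun e => l₀ ≤ w e) = Finset.univ := by simp [hl₀]
    have h2 := hcard l₀
    rwa [h1, Finset.inter_univ] at h2
  · rw [hcard]
    have h1 : LinearIndepOn ℝ Γ.edgeVec
      ((F ∩ Finset.univ.filter fun e => l ≤ w e : Finset (Fin n)) :
      Set (Fin n)) := hF.mono (by simp)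
    exact h1.card_le_finrank_span_image Finset.inter_subset_right

section

variable {k : ℕ} {Γ : FeynmanGraph V (k + 1)}

/-- The greedy algorithm: the complement of a spanning tree of the greatest weight has the least
possible degree in all the superlevel sets. -/
theorem isGreedy_treeExp (hΓ : Γ.Connected) : IsGreedy (treeExp (Γ := Γ)) := by
  intro w
  obtain ⟨S, hS, hmax⟩ := exists_isSpanningTree_forall_superlevel hΓ w
  refine ⟨⟨S, hS⟩, fun S' l => ?_⟩
  have h1 := hmax S'.1 ((isSpanningTree_iff hΓ _).1 S'.2).1 l
  have h2 := sum_expVec_compl_add (Finset.univ.filter fun e => l ≤ w e) S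
  have h3 := sum_expVec_compl_add (Finset.univ.filter fun e => l ≤ w e) S'.1
  simp only [treeExp]
  omega

theorem sum_treeExp (hΓ : Γ.Connected) (S : Γ.SpanTree) : ∑ e, treeExp S e = Γ.loopNumber := by
  have h1 := sum_expVec_compl_add Finset.univ S.1
  have h2 := ((isSpanningTree_iff hΓ _).1 S.2).2
  have h3 := treeRank_add_loopNumber (Γ := Γ)
  rw [Finset.inter_univ, Finset.card_univ, Fintype.card_fin] at h1
  simp only [treeExp]
  omega

theorem sum_qMonomial (hΓ : Γ.Connected) {m : Fin (k + 1) → ℝ} (T : Γ.QMonomial m) :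
    ∑ e, T.1 e = Γ.loopNumber + 1 := by
  have h3 := treeRank_add_loopNumber (Γ := Γ)
  obtain ⟨T, ⟨C, hC, rfl⟩ | ⟨e, S, -, hS, rfl⟩⟩ := T
  · have h1 := sum_expVec_compl_add Finset.univ Cᶜ
    have h2 := ((isCut_iff hΓ _).1 hC).2
    rw [Finset.inter_univ, Finset.card_univ, Fintype.card_fin, compl_compl] at h1
    simp only
    omega
  · have h1 := sum_treeExp hΓ ⟨S, hS⟩
    simp only [treeExp] at h1
    simp [Finset.sum_add_distrib, h1]

/-- The dominating monomial belongs to a spanning tree of the greatest weight and the least edge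
which can be removed from it or has a mass. -/
theorem isGreedy_qMonomial (hΓ : Γ.Connected) {m : Fin (k + 1) → ℝ} [Nonempty (Γ.QMonomial m)] :
    IsGreedy (fun T : Γ.QMonomial m => T.1) := by
  classical
  intro w
  obtain ⟨S, hS, hmax⟩ := exists_isSpanningTree_forall_superlevel hΓ w
  have hS' := (isSpanningTree_iff hΓ S).1 hS
  have hne : (S ∪ Finset.univ.filter fun e => m e ≠ 0).Nonempty := by
    obtain ⟨T, ⟨C, hC, rfl⟩ | ⟨e, S', he, -⟩⟩ := ‹Nonempty (Γ.QMonomial m)›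
    · have := ((isCut_iff hΓ _).1 hC).2
      exact (Finset.card_pos.1 (by omega)).mono Finset.subset_union_left
    · exact ⟨e, by simp [he]⟩
  obtain ⟨e₀, he₀, hmin⟩ := Finset.exists_min_image _ w hne
  have hT : Γ.IsQMonomial m (expVec Sᶜ + Pi.single e₀ 1) := by
    rcases Finset.mem_union.1 he₀ with h | h
    · refine Or.inl ⟨(S.erase e₀)ᶜ, (isCut_iff hΓ _).2 ?_, ?_⟩
      · rw [compl_compl]
        refine ⟨hS'.1.mono (by simp), ?_⟩
        rw [← hS'.2, Finset.card_erase_add_one h]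
      · ext e
        by_cases he : e = e₀
        · subst he
          simp [expVec, h]
        · simp [expVec, he]
    · exact Or.inr ⟨e₀, S, by simpa using h, hS, rfl⟩
  refine ⟨⟨_, hT⟩, fun T l => ?_⟩
  set W := Finset.univ.filter fun e => l ≤ w e with hW
  have hsingle : ∀ e,
      ∑ e' ∈ W, (Pi.single e 1 : Fin (k + 1) → ℕ) e' = if l ≤ w e then 1 else 0 := by
    intro e
    simp [hW, Finset.sum_pi_single']
  have h1 := sum_expVec_compl_add W S
  -- if the least edge belongs to the superlevel set, then so does the whole tree
  have h2 : l ≤ w e₀ → S ∩ W = S := fun h => Finset.inter_eq_left.2 fun e he =>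
    Finset.mem_filter.2 ⟨Finset.mem_univ _, h.trans (hmin e (Finset.mem_union_left _ he))⟩
  obtain ⟨T, ⟨C, hC, rfl⟩ | ⟨e, S', he, hS₁, rfl⟩⟩ := T
  · have hC' := (isCut_iff hΓ _).1 hC
    have h3 := sum_expVec_compl_add W Cᶜ
    have h4 : (Cᶜ ∩ W).card ≤ (S ∩ W).card := hmax _ hC'.1 l
    have h5 : (Cᶜ ∩ W).card ≤ Cᶜ.card := Finset.card_le_card Finset.inter_subset_left
    rw [compl_compl] at h3
    simp only [Pi.add_apply, Finset.sum_add_distrib, hsingle]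
    split_ifs with h
    · rw [h2 h] at h1
      omega
    · omega
  · have hS₁' := (isSpanningTree_iff hΓ _).1 hS₁
    have h3 := sum_expVec_compl_add W S'
    have h4 : (S' ∩ W).card ≤ (S ∩ W).card := hmax _ hS₁'.1 l
    simp only [Pi.add_apply, Finset.sum_add_distrib, hsingle]
    by_cases h : l ≤ w e₀
    · have h6 : l ≤ w e := h.trans (hmin e (by simp [he]))
      rw [if_pos h, if_pos h6]
      omega
    · rw [if_neg h]
      omega

end

end FeynmanGraph

/-! ### The generalized amplitudes -/

/-- A family which is analytic off the zeros of an entire function vanishes if it vanishes on an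
open set of exponents and coefficients. -/
theorem AnalyticOnNhd.family_eq_zero {X Y : Type*} [NormedAddCommGroup X] [NormedSpace ℂ X]
    [NormedAddCommGroup Y] [NormedSpace ℂ Y] {U W : Set Y} (hUc : IsPreconnected U) (hW : IsOpen W)
    (hWne : W.Nonempty) (hWU : W ⊆ U) {h : X → ℂ} (hh : AnalyticOnNhd ℂ h Set.univ)
    {Φ : X → Y → ℂ} (hΦ : AnalyticOnNhd ℂ (Function.uncurry Φ) ({x | h x ≠ 0} ×ˢ U)) {B : Set X}
    (hB : IsOpen B) (hBne : B.Nonempty) (h0 : ∀ x ∈ B, h x ≠ 0 → ∀ P ∈ W, Φ x P = 0) {x : X}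
    (hx : h x ≠ 0) {P : Y} (hP : P ∈ U) : Φ x P = 0 := by
  refine eq_zero_of_eq_zero_on_open hh (φ := fun x => Φ x P) (fun x hx => ?_) hB hBne
    (fun x hxB hx => ?_) hx
  · exact (hΦ (x, P) ⟨hx, hP⟩).comp_of_eq (g := Function.uncurry Φ) (f := fun x => (x, P))
      (analyticAt_id.prod analyticAt_const) rfl
  · have h1 : AnalyticOnNhd ℂ (Φ x) U := fun P hP =>
      (hΦ (x, P) ⟨hx, hP⟩).comp_of_eq (g := Function.uncurry Φ) (f := fun P => (x, P))
        (analyticAt_const.prod analyticAt_id) rfl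
    obtain ⟨P₀, hP₀⟩ := hWne
    refine h1.eqOn_zero_of_preconnected_of_eventuallyEq_zero hUc (hWU hP₀) ?_ hP
    filter_upwards [hW.mem_nhds hP₀] with P hP
    exact h0 x hxB hx P hP

namespace FeynmanGraph

variable {V : Type*} {k : ℕ} {Γ : FeynmanGraph V (k + 1)} {m : Fin (k + 1) → ℝ}

theorem integralJ_eq (x : Exps k) (P : Γ.Coeffs m) :
    Γ.integralJ m x.1 x.2.1 x.2.2 P =
      simplexIntegral (treeExp (Γ := Γ)) (fun T : Γ.QMonomial m => T.1) x P := rfl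

theorem latticePoint_zero :
    (fun a => Γ.latticePoint m a 0) = Sum.elim (fun _ => (1 : ℤ)) fun _ => 0 := by
  ext a
  rcases a with a | b <;> rfl

theorem latticePoint_succ (e : Fin (k + 1)) :
    (fun a => Γ.latticePoint m a e.succ) = fun a =>
      ((Sum.elim treeExp (fun T : Γ.QMonomial m => T.1) a e : ℕ) : ℤ) := by
  ext a
  rcases a with a | b <;> rfl

theorem isHomogeneousFamily_of_sum_eq {ι : Type*} [Nonempty ι] {q : ι → Fin (k + 1) → ℕ} {d : ℕ}
    (hq : ∀ i, ∑ e, q i e = d) : IsHomogeneousFamily q ∧ minDegree q Finset.univ = d := by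
  have h : minDegree q Finset.univ = d := by simp [minDegree, hq]
  exact ⟨fun i => by rw [hq, h], h⟩

/-- The affine form of the exponents which vanishes if and only if the integrand is homogeneous of
degree `-n`. -/
noncomputable def homogeneityForm (Γ : FeynmanGraph V (k + 1)) (x : Exps k) : ℂ :=
  x.1 * (Γ.loopNumber + 1) - x.2.1 * Γ.loopNumber + ∑ e, (x.2.2 e + 1)

/-- The exponents of an amplitude are those for which `Q ^ c / Ψ ^ d * t ^ v * Ω` is homogeneous of
degree zero. -/
theorem homogeneityForm_toExpsJ (x : Exps k) : Γ.homogeneityForm (Γ.toExpsJ x) = 0 := by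
  simp only [homogeneityForm, toExpsJ, Finset.sum_add_distrib, Finset.sum_const, Finset.card_univ,
    Fintype.card_fin, nsmul_eq_mul]
  ring

/-- The GKZ equations in the region where the integral is defined. -/
theorem gkz_integralJ (hΓ : Γ.Connected) {x : Exps k} (hx : x ∈ initialDomain k) {P : Γ.Coeffs m}
    (hP : P ∈ Γ.rightHalf m) :
    (∀ r : Γ.Idx m → ℤ, ∑ a, r a • Γ.latticePoint m a = 0 →
      boxOp r (Γ.integralJ m x.1 x.2.1 x.2.2) P = 0) ∧
    eulerOp (fun a => Γ.latticePoint m a 0) (Γ.integralJ m x.1 x.2.1 x.2.2) P =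
      -x.2.1 * Γ.integralJ m x.1 x.2.1 x.2.2 P ∧
    ∀ e, eulerOp (fun a => Γ.latticePoint m a e.succ) (Γ.integralJ m x.1 x.2.1 x.2.2) P =
      Γ.homogeneityForm x * Γ.integralJ m x.1 x.2.1 (x.2.2 + Pi.single e 1) P -
        (1 + x.2.2 e) * Γ.integralJ m x.1 x.2.1 x.2.2 P := by
  have hP' : P ∈ posRe (Γ.Idx m) := hP
  have hJ : Γ.integralJ m x.1 x.2.1 x.2.2 =
      simplexIntegral (treeExp (Γ := Γ)) (fun T : Γ.QMonomial m => T.1) x := rfl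
  have hJe : ∀ e, Γ.integralJ m x.1 x.2.1 (x.2.2 + Pi.single e 1) P =
      simplexIntegral (treeExp (Γ := Γ)) (fun T : Γ.QMonomial m => T.1) (x + expUnit e) P := by
    intro e
    rw [← integralJ_eq]
    simp [expUnit]
  rw [latticePoint_zero]
  simp only [hJ, hJe, latticePoint_succ]
  have hp := isGreedy_treeExp hΓ
  have := hp.nonempty
  obtain ⟨hph, hpd⟩ := isHomogeneousFamily_of_sum_eq (sum_treeExp hΓ)
  -- `Q = 0` for a massless graph with one vertex; then the integral is zero
  rcases isEmpty_or_nonempty (Γ.QMonomial m) with hempty | hne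
  · have hzero : ∀ {y : Exps k}, y ∈ initialDomain k → Set.EqOn
        (simplexIntegral (treeExp (Γ := Γ)) (fun T : Γ.QMonomial m => T.1) y)
        (fun P => 0 * (0 : ℂ)) (posRe (Γ.Idx m)) := fun hy P _ => by
      rw [simplexIntegral_eq_zero hy, zero_mul]
    have hxe : ∀ e, x + expUnit e ∈ initialDomain k := fun e => by
      refine ⟨by simpa [expUnit] using hx.1, by simpa [expUnit] using hx.2.1, fun e' => ?_⟩
      have := hx.2.2 e'
      by_cases h : e' = e
      · subst h
        simp only [expUnit, Prod.snd_add, Pi.add_apply, Pi.single_eq_same, Complex.add_re,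
          Complex.one_re]
        linarith
      · simpa [expUnit, h] using this
    refine ⟨fun r _ => ?_, ?_, fun e => ?_⟩
    · rw [boxOp_congr isOpen_posRe (hzero hx) r hP', boxOp_const_mul 0 (fun _ => (0 : ℂ))]
      exact zero_mul _
    · rw [eulerOp_congr isOpen_posRe (hzero hx) _ hP', eulerOp_const_mul 0 (fun _ => (0 : ℂ)),
        hzero hx hP']
      simp
    · rw [eulerOp_congr isOpen_posRe (hzero hx) _ hP', eulerOp_const_mul 0 (fun _ => (0 : ℂ)),
        hzero hx hP', hzero (hxe e) hP']
      simp
  · have hq := isGreedy_qMonomial hΓ (m := m)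
    obtain ⟨hqh, hqd⟩ := isHomogeneousFamily_of_sum_eq (sum_qMonomial hΓ (m := m))
    have hxc : x ∈ convDomain (treeExp (Γ := Γ)) (fun T : Γ.QMonomial m => T.1) :=
      initialDomain_subset_convDomain hx
    refine ⟨fun r hr => ?_, eulerOp_zero_simplexIntegral hp hq hxc hP', fun e => ?_⟩
    · have hr' : ∀ i, ∑ a, r a * Γ.latticePoint m a i = 0 := fun i => by
        simpa using congrFun hr i
      refine boxOp_simplexIntegral hp hq hph hqh (by simp [hqd]) hxc ?_ (fun e => ?_) hP'
      · have := hr' 0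
        simp only [funext_iff.1 latticePoint_zero] at this
        simpa using this
      · have := hr' e.succ
        simp only [funext_iff.1 (latticePoint_succ e)] at this
        exact this
    · rw [eulerOp_simplexIntegral hp hq hph hqh hxc hP' e]
      congr 2
      simp [facetForm, homogeneityForm, hpd, hqd]

/-- Exponents of the amplitude at which none of the facet forms is real.  They show that the image
of `toExpsJ`, where the integrand is homogeneous of degree `-n`, is not contained in the polar
hyperplanes. -/
noncomputable def genericExps (k : ℕ) : Exps k :=
  (0, 0, fun e => Complex.I * (if e = 0 then (k : ℂ) else -1))

theorem sum_genericExps : ∑ e, (genericExps k).2.2 e = 0 := by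
  simp only [genericExps, ← Finset.mul_sum, Fin.sum_univ_succ]
  simp

theorem gammaArg_genericExps : Γ.gammaArg (genericExps k) = ((k + 1 : ℕ) : ℂ) := by
  rw [gammaArg, sum_genericExps]
  simp [genericExps]

/-- The imaginary part of a facet form is the sum over `I` of a function whose sums vanish only
over the empty set and the full set. -/
theorem im_facetForm_genericExps {α β : Type*} (p : α → Fin (k + 1) → ℕ) (q : β → Fin (k + 1) → ℕ)
    (I : Facet k) : (facetForm p q I.1 (Γ.toExpsJ (genericExps k))).im ≠ 0 := by
  have h1 : (facetForm p q I.1 (Γ.toExpsJ (genericExps k))).im =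
      ∑ e ∈ I.1, (if e = 0 then (k : ℝ) else -1) := by
    simp only [facetForm, toExpsJ, sum_genericExps]
    simp only [genericExps]
    simp only [Complex.add_im, Complex.sub_im, Complex.mul_im, Complex.im_sum, Complex.natCast_im,
      Complex.natCast_re, Complex.neg_im, Complex.one_im, Complex.I_re, Complex.I_im,
      Complex.neg_re, sub_zero, zero_mul, mul_zero, neg_zero,
      add_zero, zero_add, one_mul]
    refine Finset.sum_congr rfl fun e _ => ?_
    split_ifs <;> simp
  rw [h1]
  by_cases h0 : (0 : Fin (k + 1)) ∈ I.1
  · have h2 : I.1.card < k + 1 := by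
      simpa using (Finset.card_lt_iff_ne_univ I.1).2 I.2.2
    have h3 : ∑ e ∈ I.1.erase 0, (if e = 0 then (k : ℝ) else -1) = -((I.1.erase 0).card : ℝ) := by
      rw [Finset.sum_congr rfl fun e he => if_neg (Finset.ne_of_mem_erase he)]
      simp
    rw [← Finset.add_sum_erase _ _ h0, h3, Finset.card_erase_of_mem h0, if_pos rfl]
    have h4 : (((I.1.card - 1 : ℕ) : ℝ)) < k := by
      exact_mod_cast (by have := Finset.card_pos.2 I.2.1; omega : I.1.card - 1 < k)
    exact (by linarith : (0 : ℝ) < _).ne'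
  · have h2 : ∀ e ∈ I.1, e ≠ 0 := fun e he h => h0 (h ▸ he)
    rw [Finset.sum_congr rfl fun e he => if_neg (h2 e he)]
    have := I.2.1.card_pos.ne'
    simpa using this

/-- The integral is a quotient of entire functions of the exponents; the denominator does not depend
on the coefficients. -/
theorem exists_entire_integralJ (hΓ : Γ.Connected) (m : Fin (k + 1) → ℝ) :
    ∃ (h : Exps k → ℂ) (G : Exps k → Γ.Coeffs m → ℂ), AnalyticOnNhd ℂ h Set.univ ∧
      AnalyticOnNhd ℂ (Function.uncurry G) (Set.univ ×ˢ Γ.rightHalf m) ∧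
      (∀ x ∈ initialDomain k, h x ≠ 0 ∧ ∀ P ∈ Γ.rightHalf m,
        G x P = h x * Γ.integralJ m x.1 x.2.1 x.2.2 P) ∧
      h (Γ.toExpsJ (genericExps k)) ≠ 0 ∧
      ∀ e, h (Γ.toExpsJ (genericExps k) + expUnit e) ≠ 0 := by
  have hp := isGreedy_treeExp hΓ
  have := hp.nonempty
  rcases isEmpty_or_nonempty (Γ.QMonomial m) with hempty | hne
  · refine ⟨fun _ => 1, fun _ _ => 0, analyticOnNhd_const, analyticOnNhd_const,
      fun x hx => ⟨one_ne_zero, fun P _ => ?_⟩, one_ne_zero, fun _ => one_ne_zero⟩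
    rw [integralJ_eq, simplexIntegral_eq_zero hx, mul_zero]
  · have hq := isGreedy_qMonomial hΓ (m := m)
    obtain ⟨hph, -⟩ := isHomogeneousFamily_of_sum_eq (sum_treeExp hΓ)
    obtain ⟨hqh, -⟩ := isHomogeneousFamily_of_sum_eq (sum_qMonomial hΓ (m := m))
    obtain ⟨G, hG, hGeq⟩ := exists_entire_simplexIntegral hp hq hph hqh
    have hne0 : ∀ x : Exps k, (∀ I : Facet k, (facetForm (treeExp (Γ := Γ))
        (fun T : Γ.QMonomial m => T.1) I.1 x).im ≠ 0) →
        poleFactor (treeExp (Γ := Γ)) (fun T : Γ.QMonomial m => T.1) x ≠ 0 := by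
      refine fun x hx => Finset.prod_ne_zero_iff.2 fun I _ => inv_ne_zero ?_
      exact Complex.Gamma_ne_zero fun j hj => hx I (by simp [hj])
    refine ⟨_, G, analyticOnNhd_poleFactor, hG, fun x hx =>
      ⟨poleFactor_ne_zero (initialDomain_subset_convDomain hx), fun P hP =>
        hGeq x (initialDomain_subset_convDomain hx) P hP⟩, hne0 _ fun I =>
        im_facetForm_genericExps _ _ I, fun e => hne0 _ fun I => ?_⟩
    rw [facetForm_expUnit, Complex.add_im, Complex.natCast_im, add_zero]
    exact im_facetForm_genericExps _ _ I

theorem isOpen_rightHalf : IsOpen (Γ.rightHalf m) := isOpen_posRe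

/-- Any continuation of the integral along the coefficients is regular off the zeros of the common
denominator, and the GKZ equations continue with it. -/
theorem IsContinuationJ.regularAt_and_gkz (hΓ : Γ.Connected) {U : Set (Γ.Coeffs m)} (hU : IsOpen U)
    (hUc : IsPreconnected U) {J : Exps k → Γ.Coeffs m → ℂ} (hJ : Γ.IsContinuationJ m U J)
    {h : Exps k → ℂ} {G : Exps k → Γ.Coeffs m → ℂ} (hh : AnalyticOnNhd ℂ h Set.univ)
    (hG : AnalyticOnNhd ℂ (Function.uncurry G) (Set.univ ×ˢ Γ.rightHalf m))
    (hGeq : ∀ x ∈ initialDomain k, h x ≠ 0 ∧ ∀ P ∈ Γ.rightHalf m,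
      G x P = h x * Γ.integralJ m x.1 x.2.1 x.2.2 P) {x : Exps k} (hx : h x ≠ 0) :
    RegularAt U J x ∧ ∀ P ∈ U,
      (∀ r : Γ.Idx m → ℤ, ∑ a, r a • Γ.latticePoint m a = 0 → boxOp r (J x) P = 0) ∧
      eulerOp (fun a => Γ.latticePoint m a 0) (J x) P = -x.2.1 * J x P ∧
      ∀ e, h (x + expUnit e) ≠ 0 → eulerOp (fun a => Γ.latticePoint m a e.succ) (J x) P =
        Γ.homogeneityForm x * J (x + expUnit e) P - (1 + x.2.2 e) * J x P := by
  obtain ⟨hJm, W, hWsub, hW, hWne, hJW⟩ := hJ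
  have hWU : W ⊆ U := fun P hP => (hWsub hP).1
  have hWr : W ⊆ Γ.rightHalf m := fun P hP => (hWsub hP).2
  have hJW' : ∀ x ∈ initialDomain k, Set.EqOn (J x) (Γ.integralJ m x.1 x.2.1 x.2.2) W :=
    fun x hx P hP => hJW x.1 x.2.1 x.2.2 hx.1 hx.2.1 hx.2.2 P hP
  have hreg : ∀ {y : Exps k}, h y ≠ 0 → RegularAt U J y := fun {y} hy =>
    hJm.regularAt_of_eq_on_open hU hUc hW hWne hWU hh (G₀ := G)
      (fun P hP x _ => (hG (x, P) ⟨trivial, hWr hP⟩).comp_of_eq (g := Function.uncurry G)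
        (f := fun x => (x, P)) (analyticAt_id.prod analyticAt_const) rfl)
      isOpen_initialDomain initialDomain_nonempty
      (fun x hx P hP => by rw [hJW' x hx hP, (hGeq x hx).2 P (hWr hP)]) hy
  have hJan : AnalyticOnNhd ℂ (Function.uncurry J) ({x | h x ≠ 0} ×ˢ U) := fun y hy =>
    (hreg hy.1).analyticAt hy.2
  have hfst : ∀ {f : Exps k → ℂ} {s : Set (Exps k × Γ.Coeffs m)}, Differentiable ℂ f →
      AnalyticOnNhd ℂ (fun y : Exps k × Γ.Coeffs m => f y.1) s := fun hf y _ =>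
    (hf.differentiableOn.analyticOnNhd_of_finiteDimensional isOpen_univ y.1 trivial).comp_of_eq
      analyticAt_fst rfl
  refine ⟨hreg hx, fun P hP => ⟨fun r hr => ?_, ?_, fun e hxe => ?_⟩⟩
  · refine AnalyticOnNhd.family_eq_zero hUc hW hWne hWU hh (hJan.uncurry_boxOp r)
      isOpen_initialDomain initialDomain_nonempty (fun x hx _ P hP => ?_) hx hP
    rw [boxOp_congr hW (hJW' x hx) r hP, (gkz_integralJ hΓ hx (hWr hP)).1 r hr]
  · rw [← sub_eq_zero]
    refine AnalyticOnNhd.family_eq_zero (Φ := fun x P =>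
      eulerOp (fun a => Γ.latticePoint m a 0) (J x) P - -x.2.1 * J x P) hUc hW hWne hWU hh
      ((hJan.uncurry_eulerOp _).sub ((hfst (f := fun x => -x.2.1) (by fun_prop)).mul hJan))
      isOpen_initialDomain initialDomain_nonempty (fun x hx _ P hP => ?_) hx hP
    rw [eulerOp_congr hW (hJW' x hx) _ hP, (gkz_integralJ hΓ hx (hWr hP)).2.1, hJW' x hx hP,
      sub_self]
  · rw [← sub_eq_zero]
    -- this relation involves `J` at two points, so both of them have to avoid the zeros of `h`
    have hh' : AnalyticOnNhd ℂ (fun x => h x * h (x + expUnit e)) Set.univ := fun x _ =>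
      (hh x trivial).mul ((hh (x + expUnit e) trivial).comp_of_eq
        (analyticAt_id.add analyticAt_const) rfl)
    have hsub : {x | h x * h (x + expUnit e) ≠ 0} ×ˢ U ⊆ {x | h x ≠ 0} ×ˢ U :=
      Set.prod_mono (fun y hy => left_ne_zero_of_mul hy) subset_rfl
    have hJe : AnalyticOnNhd ℂ (fun y : Exps k × Γ.Coeffs m => J (y.1 + expUnit e) y.2)
        ({x | h x * h (x + expUnit e) ≠ 0} ×ˢ U) := fun y hy =>
      (hJan (y.1 + expUnit e, y.2) ⟨right_ne_zero_of_mul hy.1, hy.2⟩).comp_of_eq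
        (g := Function.uncurry J) (f := fun y : Exps k × Γ.Coeffs m => (y.1 + expUnit e, y.2))
        ((analyticAt_fst.add analyticAt_const).prod analyticAt_snd) rfl
    refine AnalyticOnNhd.family_eq_zero (Φ := fun x P =>
      eulerOp (fun a => Γ.latticePoint m a e.succ) (J x) P -
        (Γ.homogeneityForm x * J (x + expUnit e) P - (1 + x.2.2 e) * J x P)) hUc hW hWne hWU hh'
      (((hJan.uncurry_eulerOp _).mono hsub).sub (((hfst (f := Γ.homogeneityForm) ?_).mul hJe).sub
        ((hfst (f := fun x => 1 + x.2.2 e) (by fun_prop)).mul (hJan.mono hsub))))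
      isOpen_initialDomain initialDomain_nonempty (fun x hx _ P hP => ?_) (mul_ne_zero hx hxe) hP
    · unfold homogeneityForm
      fun_prop
    · have hxe' : x + expUnit e ∈ initialDomain k := by
        refine ⟨by simpa [expUnit] using hx.1, by simpa [expUnit] using hx.2.1, fun e' => ?_⟩
        have := hx.2.2 e'
        by_cases h : e' = e
        · subst h
          simp only [expUnit, Prod.snd_add, Pi.add_apply, Pi.single_eq_same, Complex.add_re,
            Complex.one_re]
          linarith
        · simpa [expUnit, h] using this
      rw [eulerOp_congr hW (hJW' x hx) _ hP, (gkz_integralJ hΓ hx (hWr hP)).2.2 e, hJW' x hx hP,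
        hJW' _ hxe' hP]
      simp [expUnit]

theorem differentiable_toExpsJ : Differentiable ℂ Γ.toExpsJ := by
  unfold toExpsJ
  fun_prop

theorem differentiable_gammaArg : Differentiable ℂ Γ.gammaArg := by
  unfold gammaArg
  fun_prop

theorem analyticAt_toExpsJ (x : Exps k) : AnalyticAt ℂ Γ.toExpsJ x := by
  have h : ∀ {f : Exps k → ℂ}, Differentiable ℂ f → AnalyticAt ℂ f x := fun hf =>
    hf.differentiableOn.analyticOnNhd_of_finiteDimensional isOpen_univ x trivial
  refine AnalyticAt.prod (h ?_) (AnalyticAt.prod (h ?_) ?_)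
  · fun_prop
  · fun_prop
  · exact analyticAt_snd.comp_of_eq analyticAt_snd rfl

theorem analyticAt_inv_Gamma_gammaArg (x : Exps k) :
    AnalyticAt ℂ (fun x => (Complex.Gamma (Γ.gammaArg x))⁻¹) x :=
  (Complex.differentiable_one_div_Gamma.comp
    differentiable_gammaArg).differentiableOn.analyticOnNhd_of_finiteDimensional isOpen_univ x trivial

theorem gammaArg_ne_neg_natCast {x : Exps k} (hx : (Complex.Gamma (Γ.gammaArg x))⁻¹ ≠ 0) (j : ℕ) :
    Γ.gammaArg x ≠ -(j : ℂ) := fun h => by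
  rw [h, Complex.Gamma_neg_nat_eq_zero] at hx
  simp at hx

/-- The GKZ equations for the generalized amplitude at all its regular points. -/
theorem IsGeneralizedAmplitude.gkz (hΓ : Γ.Connected) {U : Set (Γ.Coeffs m)} (hU : IsOpen U)
    (hUc : IsPreconnected U) {I : Exps k → Γ.Coeffs m → ℂ} (hI : Γ.IsGeneralizedAmplitude m U I)
    {x : Exps k} (hx : RegularAt U I x) {P : Γ.Coeffs m} (hP : P ∈ U) :
    (∀ r : Γ.Idx m → ℤ, ∑ a, r a • Γ.latticePoint m a = 0 → boxOp r (I x) P = 0) ∧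
    eulerOp (fun a => Γ.latticePoint m a 0) (I x) P = -(Γ.toExpsJ x).2.1 * I x P ∧
    ∀ e, eulerOp (fun a => Γ.latticePoint m a e.succ) (I x) P = -(1 + x.2.2 e) * I x P := by
  obtain ⟨hIm, J, hJ, -, hIJ⟩ := hI
  obtain ⟨h, G, hh, hG, hGeq, hgen, hgen'⟩ := exists_entire_integralJ hΓ m
  -- the equations hold off the zeros of an entire function
  let h₁ : Exps k → ℂ := fun x => h (Γ.toExpsJ x) * (∏ e, h (Γ.toExpsJ x + expUnit e)) *
    (Complex.Gamma (Γ.gammaArg x))⁻¹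
  have hh₁ : AnalyticOnNhd ℂ h₁ Set.univ := fun x _ => by
    refine AnalyticAt.mul (AnalyticAt.mul ((hh _ trivial).comp_of_eq (analyticAt_toExpsJ x) rfl)
      (Finset.analyticAt_fun_prod _ fun e _ => ?_)) (analyticAt_inv_Gamma_gammaArg x)
    exact (hh (Γ.toExpsJ x + expUnit e) trivial).comp_of_eq
      ((analyticAt_toExpsJ x).add analyticAt_const) rfl
  have hgen₁ : h₁ (genericExps k) ≠ 0 := by
    refine mul_ne_zero (mul_ne_zero hgen (Finset.prod_ne_zero_iff.2 fun e _ => hgen' e))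
      (inv_ne_zero ?_)
    rw [gammaArg_genericExps]
    exact Complex.Gamma_ne_zero_of_re_pos (by simp; positivity)
  have hrel : ∀ {y : Exps k}, h₁ y ≠ 0 →
      (∀ r : Γ.Idx m → ℤ, ∑ a, r a • Γ.latticePoint m a = 0 → boxOp r (I y) P = 0) ∧
      eulerOp (fun a => Γ.latticePoint m a 0) (I y) P = -(Γ.toExpsJ y).2.1 * I y P ∧
      ∀ e, eulerOp (fun a => Γ.latticePoint m a e.succ) (I y) P = -(1 + y.2.2 e) * I y P := by
    intro y hy
    have hy1 : h (Γ.toExpsJ y) ≠ 0 := left_ne_zero_of_mul (left_ne_zero_of_mul hy)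
    have hy2 : ∀ e, h (Γ.toExpsJ y + expUnit e) ≠ 0 := fun e =>
      Finset.prod_ne_zero_iff.1 (right_ne_zero_of_mul (left_ne_zero_of_mul hy)) e (Finset.mem_univ e)
    obtain ⟨hreg, hgkz⟩ := hJ.regularAt_and_gkz hΓ hU hUc hh hG hGeq hy1
    have hIy : Set.EqOn (I y) (fun P => Complex.Gamma (Γ.gammaArg y) * J (Γ.toExpsJ y) P) U :=
      fun P hP => hIJ y hreg (gammaArg_ne_neg_natCast (right_ne_zero_of_mul hy)) P hP
    obtain ⟨hbox, heuler, heuler'⟩ := hgkz P hP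
    refine ⟨fun r hr => ?_, ?_, fun e => ?_⟩
    · rw [boxOp_congr hU hIy r hP, boxOp_const_mul]
      simp only
      rw [hbox r hr, mul_zero]
    · rw [eulerOp_congr hU hIy _ hP, eulerOp_const_mul, hIy hP]
      simp only
      rw [heuler]
      ring
    · rw [eulerOp_congr hU hIy _ hP, eulerOp_const_mul, hIy hP]
      simp only
      rw [heuler' e (hy2 e), homogeneityForm_toExpsJ]
      simp only [toExpsJ]
      ring
  -- both sides are continuous at a regular point, which is a limit of points with `h₁ y ≠ 0`
  have hdense : ∃ᶠ y in 𝓝 x, h₁ y ≠ 0 := (hh₁.isDenominator hgen₁ x).2.2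
  obtain ⟨N, hN, hIN⟩ := hx
  have hsec : ∀ {Φ : Exps k → Γ.Coeffs m → ℂ}, AnalyticOnNhd ℂ (Function.uncurry Φ) (N ×ˢ U) →
      ContinuousAt (fun y => Φ y P) x := fun {Φ} hΦ =>
    ContinuousAt.comp (f := fun y => (y, P)) (g := Function.uncurry Φ)
      (hΦ (x, P) ⟨mem_of_mem_nhds hN, hP⟩).continuousAt (by fun_prop)
  refine ⟨fun r hr => ?_, ?_, fun e => ?_⟩
  · exact eq_of_frequently_eq_of_continuousAt (f := fun y => boxOp r (I y) P) (g := fun _ => 0)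
      (hsec (hIN.uncurry_boxOp r)) continuousAt_const (hdense.mono fun y hy => (hrel hy).1 r hr)
  · refine eq_of_frequently_eq_of_continuousAt
      (f := fun y => eulerOp (fun a => Γ.latticePoint m a 0) (I y) P)
      (g := fun y => -(Γ.toExpsJ y).2.1 * I y P) (hsec (hIN.uncurry_eulerOp _)) ?_
      (hdense.mono fun y hy => (hrel hy).2.1)
    refine ContinuousAt.mul ?_ (hsec hIN)
    exact (continuous_fst.comp (continuous_snd.comp
      differentiable_toExpsJ.continuous)).neg.continuousAt
  · refine eq_of_frequently_eq_of_continuousAt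
      (f := fun y => eulerOp (fun a => Γ.latticePoint m a e.succ) (I y) P)
      (g := fun y => -(1 + y.2.2 e) * I y P) (hsec (hIN.uncurry_eulerOp _)) ?_
      (hdense.mono fun y hy => (hrel hy).2.2 e)
    exact ContinuousAt.mul (by fun_prop) (hsec hIN)

/-- The meromorphic continuation of the generalized amplitude. -/
theorem exists_isGeneralizedAmplitude (hΓ : Γ.Connected) (m : Fin (k + 1) → ℝ) :
    ∃ I : Exps k → Γ.Coeffs m → ℂ, Γ.IsGeneralizedAmplitude m (Γ.rightHalf m) I := by
  obtain ⟨h, G, hh, hG, hGeq, hgen, -⟩ := exists_entire_integralJ hΓ m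
  have hU : IsOpen (Γ.rightHalf m) := isOpen_rightHalf
  obtain ⟨J, hJm, hJ⟩ := exists_isMeromorphicFamily hU (fun x P => G x P / h x) fun x₀ =>
    ⟨Set.univ, h, G, hh.isDenominator hgen x₀, hG, fun _ _ _ _ _ => rfl⟩
  have hJreg : ∀ {x}, h x ≠ 0 → RegularAt (Γ.rightHalf m) J x ∧
      ∀ P ∈ Γ.rightHalf m, J x P = G x P / h x := fun hx =>
    hJ _ (RegularAt.of_quotient hU univ_mem hh hG (fun _ _ _ _ _ => rfl) hx)
  have hcont : Γ.IsContinuationJ m (Γ.rightHalf m) J := by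
    refine ⟨hJm, Γ.rightHalf m, by simp, hU, ⟨fun _ => 1, fun _ => by simp⟩, ?_⟩
    intro c d v hc hd hv P hP
    have h1 := hGeq (c, d, v) ⟨hc, hd, hv⟩
    rw [(hJreg h1.1).2 P hP, h1.2 P hP, mul_div_cancel_left₀ _ h1.1]
  have hh₁ : AnalyticOnNhd ℂ (fun x => h (Γ.toExpsJ x) * (Complex.Gamma (Γ.gammaArg x))⁻¹)
      Set.univ := fun x _ =>
    ((hh _ trivial).comp_of_eq (analyticAt_toExpsJ x) rfl).mul (analyticAt_inv_Gamma_gammaArg x)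
  have hgen₁ :
      h (Γ.toExpsJ (genericExps k)) * (Complex.Gamma (Γ.gammaArg (genericExps k)))⁻¹ ≠ 0 := by
    refine mul_ne_zero hgen (inv_ne_zero ?_)
    rw [gammaArg_genericExps]
    exact Complex.Gamma_ne_zero_of_re_pos (by simp; positivity)
  obtain ⟨I, hIm, hI⟩ := exists_isMeromorphicFamily hU
    (fun x P => Complex.Gamma (Γ.gammaArg x) * J (Γ.toExpsJ x) P) fun x₀ =>
    ⟨Set.univ, _, fun x P => G (Γ.toExpsJ x) P, hh₁.isDenominator hgen₁ x₀, fun y hy =>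
      (hG (Γ.toExpsJ y.1, y.2) ⟨trivial, hy.2⟩).comp_of_eq (g := Function.uncurry G)
        (f := fun y : Exps k × Γ.Coeffs m => (Γ.toExpsJ y.1, y.2))
        (((analyticAt_toExpsJ y.1).comp_of_eq analyticAt_fst rfl).prod analyticAt_snd) rfl,
      fun x _ hx P hP => by
        rw [(hJreg (left_ne_zero_of_mul hx)).2 P hP]
        simp only [div_eq_mul_inv, mul_inv, inv_inv]
        ring⟩
  refine ⟨I, hIm, J, hcont, ⟨_, (hJreg hgen).1⟩, fun x hxJ hxΓ P hP => (hI x ?_).2 P hP⟩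
  obtain ⟨N, hN, hJN⟩ := hxJ
  have hΓx : ∀ᶠ y in 𝓝 x, (Complex.Gamma (Γ.gammaArg y))⁻¹ ≠ 0 :=
    (analyticAt_inv_Gamma_gammaArg x).continuousAt.eventually_ne
      (inv_ne_zero (Complex.Gamma_ne_zero hxΓ))
  have hNx : ∀ᶠ y in 𝓝 x, Γ.toExpsJ y ∈ N :=
    (analyticAt_toExpsJ x).continuousAt.eventually_mem hN
  refine ⟨_, hΓx.and hNx, fun y hy => AnalyticAt.mul ?_ ?_⟩
  · have h1 := (analyticAt_inv_Gamma_gammaArg y.1).inv hy.1.1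
    simp only [Pi.inv_def, inv_inv] at h1
    exact h1.comp_of_eq (g := fun x => Complex.Gamma (Γ.gammaArg x)) analyticAt_fst rfl
  · exact (hJN (Γ.toExpsJ y.1, y.2) ⟨hy.1.2, hy.2⟩).comp_of_eq (g := Function.uncurry J)
      (f := fun y : Exps k × Γ.Coeffs m => (Γ.toExpsJ y.1, y.2))
      (((analyticAt_toExpsJ y.1).comp_of_eq analyticAt_fst rfl).prod analyticAt_snd) rfl

end FeynmanGraph

theorem mainTheorem8 {V : Type*} {k : ℕ} (Γ : FeynmanGraph V (k + 1)) (hΓ : Γ.Connected)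
    (m : Fin (k + 1) → ℝ) :
    -- the generalized amplitude can be continued meromorphically in the exponents
    (∃ I : FeynmanGraph.Exps k → Γ.Coeffs m → ℂ,
      Γ.IsGeneralizedAmplitude m (Γ.rightHalf m) I) ∧
    -- every branch of it satisfies the following
    ∀ (U : Set (Γ.Coeffs m)), IsOpen U → IsPreconnected U →
    ∀ I : FeynmanGraph.Exps k → Γ.Coeffs m → ℂ, Γ.IsGeneralizedAmplitude m U I →
    ∀ (c₁ c₂ : ℂ) (v : Fin (k + 1) → ℂ) (x y : ℂ) (u : Fin (k + 1) → ℂ),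
    -- the line through `w₀ = (c₁, c₂, v)` in the direction `w = (x, y, u)` is not polar near `w₀`
    (∀ᶠ ε in 𝓝[≠] (0 : ℂ), RegularAt U I ((c₁, c₂, v) + ε • (x, y, u))) →
    ∀ (N : ℤ) (coeff : ℤ → Γ.Coeffs m → ℂ),
    (∀ P ∈ U, HasLaurentExpansion (fun ε => I ((c₁, c₂, v) + ε • (x, y, u)) P) N
      (fun i => coeff i P)) →
    ∀ i : ℤ,
      AnalyticOnNhd ℂ (coeff i) U ∧
      (∀ r : Γ.Idx m → ℤ, ∑ a, r a • Γ.latticePoint m a = 0 →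
        ∀ P ∈ U, boxOp r (coeff i) P = 0) ∧
      (∀ P ∈ U, eulerOp (fun a => Γ.latticePoint m a 0) (coeff i) P =
        ((Γ.loopNumber + 1) * c₁ - (Γ.loopNumber + 1) * c₂ + ∑ e, v e + ((k + 1 : ℕ) : ℂ)) *
            coeff i P +
          ((Γ.loopNumber + 1) * x - (Γ.loopNumber + 1) * y + ∑ e, u e) * coeff (i - 1) P) ∧
      (∀ e : Fin (k + 1), ∀ P ∈ U, eulerOp (fun a => Γ.latticePoint m a e.succ) (coeff i) P =
        (-1 - v e) * coeff i P - u e * coeff (i - 1) P) := by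
  refine ⟨FeynmanGraph.exists_isGeneralizedAmplitude hΓ m, ?_⟩
  intro U hU hUc I hI c₁ c₂ v x y u hreg N coeff hL i
  let w : ℂ → FeynmanGraph.Exps k := fun ε => (c₁, c₂, v) + ε • (x, y, u)
  obtain ⟨ρ, hρ, hρreg⟩ : ∃ ρ > 0, ∀ ε ∈ Metric.ball (0 : ℂ) ρ \ {0}, RegularAt U I (w ε) := by
    rw [eventually_nhdsWithin_iff, Metric.eventually_nhds_iff_ball] at hreg
    obtain ⟨ρ, hρ, h⟩ := hreg
    exact ⟨ρ, hρ, fun ε hε => h ε hε.1 hε.2⟩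
  have hw : ∀ ε, AnalyticAt ℂ w ε := fun ε =>
    analyticAt_const.add (analyticAt_id.smul analyticAt_const)
  have hf : AnalyticOnNhd ℂ (Function.uncurry fun ε => I (w ε))
      ((Metric.ball 0 ρ \ {0}) ×ˢ U) := fun z hz =>
    ((hρreg z.1 hz.1).analyticAt hz.2).comp_of_eq (g := Function.uncurry I)
      (f := fun z : ℂ × Γ.Coeffs m => (w z.1, z.2))
      (((hw z.1).comp_of_eq analyticAt_fst rfl).prod analyticAt_snd) rfl
  obtain ⟨han, hbox, heuler⟩ := laurentCoeff_of_family hU hρ hf hL i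
  refine ⟨han, fun r hr => hbox r fun ε hε P hP => (hI.gkz hΓ hU hUc (hρreg ε hε) hP).1 r hr,
    ?_, fun e P hP => ?_⟩
  · refine heuler _ _ _ fun ε hε P hP => ?_
    rw [(hI.gkz hΓ hU hUc (hρreg ε hε) hP).2.1]
    congr 1
    simp only [w, FeynmanGraph.toExpsJ, Prod.fst_add, Prod.snd_add, Prod.smul_fst, Prod.smul_snd,
      Pi.add_apply, Pi.smul_apply, smul_eq_mul, Finset.sum_add_distrib, ← Finset.mul_sum]
    ring
  · rw [heuler _ (-1 - v e) (-u e) (fun ε hε P hP => ?_) P hP]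
    · ring
    · rw [(hI.gkz hΓ hU hUc (hρreg ε hε) hP).2.2 e]
      congr 1
      simp only [w, Prod.snd_add, Prod.smul_snd, Pi.add_apply, Pi.smul_apply, smul_eq_mul]
      ring
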